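/- **Setting.** Let $d\ge 1$, $m\ge 0$, let $\mathbb V\subseteq\mathbb R^d$ be measurable with Lebesgue measure $dv$, let $u\in\mathbb R$, $0\le\omega_0\le 1$ and $a(v)=(1+|v|)^{\omega_0}$. Functions of $v\in\mathbb V$ have values in $\mathbb R^m$, and $\langle f,g\rangle=\int_{\mathbb V} f\cdot g\,dv$. Let $\mathcal L$ be an operator in $(L^2(dv))^m$ such that - (A1) $\mathcal L$ is self-adjoint and nonnegative with domain $\mathcal D(\mathcal L)=\{f\in (L^2(dv))^m: af\in (L^2(dv))^m\}$; - (A2) $\|\mathcal Lf\|_{L^2(a^{-1}dv)}\le\sigma\|f\|_{L^2(a\,dv)}$ for some $\sigma>0$; thus $\mathcal L$ extends continuously to $(L^2(a\,dv))^m\to(L^2(a^{-1}dv))^m$; - (A3) $\mathrm{Null}\,\mathcal L$ is finite dimensional and contained in $(L^p(dv))^m$ for all $p\in[1,\infty)$; - (A4) $\langle f,\mathcal Lf\rangle\ge\sigma_0\|f-\mathcal Pf\|^2_{L^2(a\,dv)}$ for some $\sigma_0>0$, where $\mathcal P$ is the orthogonal projection of $(L^2(dv))^m$ onto $\mathrm{Null}\,\mathcal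 L$; - $(v_1+u)X\in (L^2(dv))^m$ for all $X\in\mathrm{Null}\,\mathcal L$ (automatic if $\omega_0=1$ or $\mathbb V$ is bounded). Let $\mathcal P_1X=\mathcal P((v_1+u)X)$ on $\mathrm{Null}\,\mathcal L$, a symmetric operator. Let $H^+$ (resp. $H^-$, $H^0$) be the sum of its eigenspaces for positive (resp. negative, zero) eigenvalues, and let $X_{+,i}$ $(1\le i\le\nu_+)$, $X_{-,j}$ $(1\le j\le\nu_-)$, $X_{0,k}$ $(1\le k\le\nu_0)$ be eigenfunctions of $\mathcal P_1$ for positive, negative and zero eigenvalues that together form an orthonormal basis of $\mathrm{Null}\,\mathcal L$. Let $Y_k=\mathcal L^{-1}((v_1+u)X_{0,k})$, where $\mathcal L^{-1}$ is the pseudo-inverse of $\mathcal L$ with values in $(\mathrm{Null}\,\mathcal L)^\perp$, and suppose that $(v_1+u)Y_k\in (L^2(a^{-1}dv))^m$ (automatic if $\omega_0=1$ or $\mathbb V$ is bounded). For $\alpha>0$ define the damped operator $$\mathcal L_df=\mathcal Lf+\alpha\sum_{Z}(v_1+u)Z\,\langle(v_1+u)Z,f\rangle ,$$ where $Z$ runs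 over all $X_{+,i}$, $X_{-,j}$, $X_{0,k}$ and $Y_k$. Incoming data are the $\phi\in(L^2(a\mathbf 1_{v_1+u>0}dv))^m$ with $\int_{v_1+u>0}(v_1+u)|\phi|^2dv<\infty$ (the latter is automatic if $\omega_0=1$ or $\mathbb V$ is bounded). A *damped solution* with data $\phi$ is an $f\in(L^2(a\,dv\,dx))^m$ on $(0,\infty)\times\mathbb V$ with $(v_1+u)\partial_xf\in(L^2(a^{-1}dv\,dx))^m$ (distributional derivative), $$(v_1+u)\partial_xf+\mathcal L_df=0,\qquad f|_{x=0}=\phi\quad\text{for } v_1+u>0,$$ where $f|_{x=0}\in (L^2(|v_1+u|dv))^m$ is the trace of $f$. A *half-space solution* with data $\phi$ and end-state $f_\infty\in H^+\oplus H^0$ is an $f$ with $f-f_\infty\in (L^2(dx;L^2(dv)))^m$, $(v_1+u)\partial_xf\in(L^2(a^{-1}dv\,dx))^m$, $f(x,\cdot)\in (L^2(a\,dv))^m$ for a.e. $x>0$, a trace $f|_{x=0}\in(L^2(|v_1+u|dv))^m$, and $$(v_1+u)\partial_xf+\mathcal Lf=0,\qquad f|_{x=0}=\phi\quad\text{for }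 v_1+u>0 .$$ **Proposition (Recovery).** For every incoming datum there is exactly one damped solution, and all $X_{+,i}$, $X_{0,k}$ are incoming data. Let $\phi$ be an incoming datum, $f$ the damped solution with data $\phi$, and $g_{+,i}$, $g_{0,k}$ the damped solutions with data $X_{+,i}$, $X_{0,k}$. Let $C$ be the $(\nu_++\nu_0)\times(\nu_++\nu_0)$ matrix with the entries $$C_{rs}=\langle(v_1+u)X_r,g_s\rangle\big|_{x=0},\qquad r,s\in\{(+,i)\}\cup\{(0,k)\}.$$ Then $C$ is invertible. Put $$\eta=C^{-1}\bigl(\langle(v_1+u)X_r,f\rangle|_{x=0}\bigr)_r,\qquad g=\sum_i\eta_{+,i}g_{+,i}+\sum_k\eta_{0,k}g_{0,k},\qquad \Phi=\sum_i\eta_{+,i}X_{+,i}+\sum_k\eta_{0,k}X_{0,k}.$$ Then $\Phi\in H^+\oplus H^0$, and $f_\phi=f-g+\Phi$ is a half-space solution with data $\phi$ and end-state $f_{\phi,\infty}=\Phi$. It is the only one: if $h$ is a half-space solution with data $\phi$ and some end-state $h_\infty\in H^+\oplus H^0$, then $h=f_\phi$ almost everywhere and $h_\infty=\Phi$. -/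

import Mathlib

open MeasureTheory Set Filter
open scoped InnerProductSpace ContDiff

noncomputable section

namespace HalfSpace

/-- Velocities `v ∈ ℝᵈ`, with the Euclidean norm `|v|`; the component `v₁` is `v 0`. -/
abbrev Vel (d : ℕ) := EuclideanSpace ℝ (Fin d)

/-- Values of the density function: one real component for each of the `m` species. -/
abbrev Val (m : ℕ) := EuclideanSpace ℝ (Fin m)

/-- `dv` on the velocity space `𝕍 ⊆ ℝᵈ`. -/
abbrev dv {d : ℕ} (𝕍 : Set (Vel d)) : Measure (Vel d) := volume.restrict 𝕍

/-- `dx dv` on `(0, ∞) × 𝕍`. -/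
abbrev dxdv {d : ℕ} (𝕍 : Set (Vel d)) : Measure (ℝ × Vel d) :=
  (volume.restrict (Ioi (0 : ℝ))).prod (dv 𝕍)

/-- The Hilbert space `(L²(dv))ᵐ`. -/
abbrev L2v {d : ℕ} (𝕍 : Set (Vel d)) (m : ℕ) := Lp (Val m) 2 (dv 𝕍)

/-- The weight `a(v) = (1 + |v|) ^ ω₀`. -/
def weight {d : ℕ} (ω₀ : ℝ) (v : Vel d) : ℝ := (1 + ‖v‖) ^ ω₀

/-- The speed `v₁ + u`. -/
def speed {d : ℕ} [NeZero d] (u : ℝ) (v : Vel d) : ℝ := v 0 + u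

/-- `h` lies in the weighted space `L²(ρ dμ)`, for a weight `ρ ≥ 0`. -/
def MemWL2 {Z F : Type*} [MeasurableSpace Z] [NormedAddCommGroup F] [NormedSpace ℝ F]
    (ρ : Z → ℝ) (h : Z → F) (μ : Measure Z) : Prop :=
  MemLp (fun z => Real.sqrt (ρ z) • h z) 2 μ

section Operator

variable {d m : ℕ} [NeZero d] {𝕍 : Set (Vel d)}

/-- The null space of the unbounded operator `L`, as a subspace of `(L²(dv))ᵐ`. -/
def nullSpace (L : L2v 𝕍 m →ₗ.[ℝ] L2v 𝕍 m) : Submodule ℝ (L2v 𝕍 m) :=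
  (LinearMap.ker L.toFun).map L.domain.subtype

/-- The assumptions on the collision operator. Integrals of the weighted squares are over
functions for which these are finite, because `D(L) = L²(a² dv)` and `a ≥ 1`. -/
structure CollisionOperator (ω₀ u : ℝ) (L : L2v 𝕍 m →ₗ.[ℝ] L2v 𝕍 m) : Prop where
  /-- `D(L) = {f ∈ L² : a f ∈ L²}` -/
  mem_domain : ∀ f : L2v 𝕍 m, f ∈ L.domain ↔ MemLp (fun v => weight ω₀ v • f v) 2 (dv 𝕍)
  selfAdjoint : IsSelfAdjoint L
  nonneg : ∀ f : L.domain, 0 ≤ ⟪(f : L2v 𝕍 m), L f⟫_ℝ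
  /-- `L` is bounded from `L²(a dv)` to `L²(a⁻¹ dv)` (stated on `D(L)`, dense in `L²(a dv)`). -/
  bounded : ∃ σ > 0, ∀ f : L.domain,
    ∫ v, (weight ω₀ v)⁻¹ * ‖L f v‖ ^ 2 ∂dv 𝕍 ≤
      σ ^ 2 * ∫ v, weight ω₀ v * ‖(f : L2v 𝕍 m) v‖ ^ 2 ∂dv 𝕍
  finite_null : FiniteDimensional ℝ (nullSpace L)
  null_memLp : ∀ f ∈ nullSpace L, ∀ p : ENNReal, 1 ≤ p → p ≠ ⊤ → MemLp f p (dv 𝕍)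
  /-- Spectral gap; `p` is the orthogonal projection of `f` onto the null space. -/
  gap : ∃ σ > 0, ∀ f : L.domain, ∀ p ∈ nullSpace L, (f : L2v 𝕍 m) - p ∈ (nullSpace L)ᗮ →
    σ * ∫ v, weight ω₀ v * ‖((f : L2v 𝕍 m) - p) v‖ ^ 2 ∂dv 𝕍 ≤ ⟪(f : L2v 𝕍 m), L f⟫_ℝ
  /-- `(v₁ + u) f ∈ L²(dv)` for `f` in the null space, so that `P((v₁ + u) f)` is meaningful.
  It is automatic if `ω₀ = 1` or `𝕍` is bounded. -/
  moment : ∀ f ∈ nullSpace L, MemLp (fun v => speed u v • f v) 2 (dv 𝕍)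

/-- Pseudo-inverse of `L`: the `Y ∈ D(L) ∩ (Null L)^⊥` such that `L Y` is the projection of `g`
onto `(Null L)^⊥`. -/
def pseudoInverse (L : L2v 𝕍 m →ₗ.[ℝ] L2v 𝕍 m) (g : L2v 𝕍 m) : L2v 𝕍 m :=
  open scoped Classical in
  if h : ∃ Y : L.domain, (Y : L2v 𝕍 m) ∈ (nullSpace L)ᗮ ∧ g - L Y ∈ nullSpace L
  then (h.choose : L2v 𝕍 m) else 0

variable {ω₀ u : ℝ} {L : L2v 𝕍 m →ₗ.[ℝ] L2v 𝕍 m}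

/-- The map `f ↦ (v₁ + u) f` from the null space to `(L²(dv))ᵐ`. -/
def mulSpeed (hL : CollisionOperator ω₀ u L) : nullSpace L →ₗ[ℝ] L2v 𝕍 m where
  toFun f := (hL.moment f f.2).toLp _
  map_add' f g := by
    rw [← MemLp.toLp_add]
    apply MemLp.toLp_congr
    filter_upwards [Lp.coeFn_add (f : L2v 𝕍 m) (g : L2v 𝕍 m)] with v hv
    simp only [Submodule.coe_add, Pi.add_apply] at hv ⊢
    rw [hv, smul_add]
  map_smul' c f := by
    rw [RingHom.id_apply, ← MemLp.toLp_const_smul]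
    apply MemLp.toLp_congr
    filter_upwards [Lp.coeFn_smul c (f : L2v 𝕍 m)] with v hv
    simp only [Submodule.coe_smul, Pi.smul_apply] at hv ⊢
    rw [hv, smul_comm]

/-- `P₁ f = P((v₁ + u) f)` on the null space, `P` being the orthogonal projection onto it. -/
def P1 (hL : CollisionOperator ω₀ u L) : Module.End ℝ (nullSpace L) :=
  haveI : FiniteDimensional ℝ (nullSpace L) := hL.finite_null
  (nullSpace L).orthogonalProjectionOnto.toLinearMap ∘ₗ mulSpeed hL

/-- `H⁺`: the sum of the eigenspaces of `P₁` for positive eigenvalues. -/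
def Hplus (hL : CollisionOperator ω₀ u L) : Submodule ℝ (L2v 𝕍 m) :=
  (⨆ lam ∈ Ioi (0 : ℝ), Module.End.eigenspace (P1 hL) lam).map (nullSpace L).subtype

/-- `H⁰`: the eigenspace of `P₁` for the eigenvalue zero. -/
def Hzero (hL : CollisionOperator ω₀ u L) : Submodule ℝ (L2v 𝕍 m) :=
  (Module.End.eigenspace (P1 hL) 0).map (nullSpace L).subtype

/-- A complete orthonormal system of eigenfunctions of `P₁`: the `X₊ᵢ`, `X₋ⱼ` and `X₀ₖ` belong to
positive, negative and zero eigenvalues. Each of the three families may be empty. -/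
structure EigenSystem (hL : CollisionOperator ω₀ u L) (νp νm ν0 : ℕ) where
  plus : Fin νp → nullSpace L
  minus : Fin νm → nullSpace L
  zero : Fin ν0 → nullSpace L
  plus_eigen : ∀ i, ∃ lam > (0 : ℝ), P1 hL (plus i) = lam • plus i
  minus_eigen : ∀ j, ∃ lam < (0 : ℝ), P1 hL (minus j) = lam • minus j
  zero_eigen : ∀ k, P1 hL (zero k) = 0
  orthonormal : Orthonormal ℝ (Sum.elim plus (Sum.elim minus zero))
  complete : Submodule.span ℝ (range (Sum.elim plus (Sum.elim minus zero))) = ⊤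

variable {hL : CollisionOperator ω₀ u L} {νp νm ν0 : ℕ}

/-- The eigenfunctions `X₊ᵢ`, `X₀ₖ` listed together; they span `H⁺ ⊕ H⁰`. -/
def EigenSystem.X (S : EigenSystem hL νp νm ν0) (s : Fin νp ⊕ Fin ν0) : L2v 𝕍 m :=
  Sum.elim (fun i => (S.plus i : L2v 𝕍 m)) (fun k => (S.zero k : L2v 𝕍 m)) s

/-- `L⁻¹((v₁ + u) X₀ₖ)`. -/
def EigenSystem.Y (S : EigenSystem hL νp νm ν0) (k : Fin ν0) : L2v 𝕍 m :=
  pseudoInverse L (mulSpeed hL (S.zero k))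

/-- The moment `⟨(v₁ + u) X, h⟩` over `𝕍`. -/
def flux (𝕍 : Set (Vel d)) (u : ℝ) (X h : Vel d → Val m) : ℝ :=
  ∫ v, speed u v * ⟪X v, h v⟫_ℝ ∂dv 𝕍

/-- The rank one term `(v₁ + u) X ⟨(v₁ + u) X, h⟩`. -/
def dampTerm (𝕍 : Set (Vel d)) (u : ℝ) (X h : Vel d → Val m) (v : Vel d) : Val m :=
  flux 𝕍 u X h • speed u v • X v

/-- The damping `L_d h - L h`. -/
def damping (S : EigenSystem hL νp νm ν0) (α : ℝ) (h : Vel d → Val m) (v : Vel d) : Val m :=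
  α • ((∑ i, dampTerm 𝕍 u (S.plus i : L2v 𝕍 m) h v)
    + (∑ j, dampTerm 𝕍 u (S.minus j : L2v 𝕍 m) h v)
    + (∑ k, dampTerm 𝕍 u (S.zero k : L2v 𝕍 m) h v)
    + ∑ k, dampTerm 𝕍 u (S.Y k) h v)

/-- `L f = h`, for `f ∈ L²(a dv)` and `h ∈ L²(a⁻¹ dv)`, where `L` is extended continuously from
`D(L)` to `L²(a dv)`. As `L` is symmetric, this extension is the transpose of `L` on `D(L)`. -/
def OpEq (ω₀ : ℝ) (L : L2v 𝕍 m →ₗ.[ℝ] L2v 𝕍 m) (f h : Vel d → Val m) : Prop :=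
  MemWL2 (weight ω₀) f (dv 𝕍) ∧ MemWL2 (fun v => (weight ω₀ v)⁻¹) h (dv 𝕍) ∧
  ∀ ψ : L.domain, ∫ v, ⟪h v, (ψ : L2v 𝕍 m) v⟫_ℝ ∂dv 𝕍 = ∫ v, ⟪f v, L ψ v⟫_ℝ ∂dv 𝕍

/-- `w = (v₁ + u) ∂ₓ f` in the sense of distributions on `(0, ∞) × 𝕍`, and `f₀ = f|_{x = 0}` in
the trace sense: Green's formula holds for all smooth `θ` with compact support in `[0, ∞) × ℝᵈ`,
and `f₀ ∈ L²(|v₁ + u| dv)`. -/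
def HasTransport (𝕍 : Set (Vel d)) (u : ℝ) (f w : ℝ × Vel d → Val m) (f₀ : Vel d → Val m) :
    Prop :=
  MemWL2 (fun v => |speed u v|) f₀ (dv 𝕍) ∧
  ∀ θ : ℝ × Vel d → Val m, ContDiff ℝ ∞ θ → HasCompactSupport θ →
    ∫ z, (speed u z.2 * ⟪f z, deriv (fun t => θ (t, z.2)) z.1⟫_ℝ + ⟪w z, θ z⟫_ℝ) ∂dxdv 𝕍 =
      - ∫ v, speed u v * ⟪f₀ v, θ (0, v)⟫_ℝ ∂dv 𝕍

/-- Admissible incoming data: `φ ∈ L²(a 1_{v₁+u>0} dv)` with finite incoming flux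
`∫_{v₁+u>0} (v₁ + u) |φ|² dv`. The latter is automatic if `ω₀ = 1` or `𝕍` is bounded. -/
def IncomingData (𝕍 : Set (Vel d)) (ω₀ u : ℝ) (φ : Vel d → Val m) : Prop :=
  MemWL2 (weight ω₀) φ ((dv 𝕍).restrict {v | 0 < speed u v}) ∧
  MemWL2 (speed u) φ ((dv 𝕍).restrict {v | 0 < speed u v})

/-- `f` solves `(v₁ + u) ∂ₓ f + L_d f = 0` in `(0, ∞) × 𝕍` with `f ∈ L²(a dv dx)` and
`(v₁ + u) ∂ₓ f ∈ L²(a⁻¹ dv dx)`, has the trace `f₀` at `x = 0`, and `f₀ = φ` for `v₁ + u > 0`. -/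
def IsDampedSolution (S : EigenSystem hL νp νm ν0) (α : ℝ) (φ : Vel d → Val m)
    (f : ℝ × Vel d → Val m) (f₀ : Vel d → Val m) : Prop :=
  MemWL2 (fun z => weight ω₀ z.2) f (dxdv 𝕍) ∧
  ∃ w : ℝ × Vel d → Val m,
    MemWL2 (fun z => (weight ω₀ z.2)⁻¹) w (dxdv 𝕍) ∧
    HasTransport 𝕍 u f w f₀ ∧
    (∀ᵐ x ∂volume.restrict (Ioi (0 : ℝ)),
      OpEq ω₀ L (fun v => f (x, v)) (fun v => - w (x, v) - damping S α (fun v' => f (x, v')) v)) ∧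
    ∀ᵐ v ∂dv 𝕍, 0 < speed u v → f₀ v = φ v

/-- `f` solves `(v₁ + u) ∂ₓ f + L f = 0` in `(0, ∞) × 𝕍` with `f|_{x=0} = φ` for `v₁ + u > 0`,
`f - f_∞ ∈ L²(dx; L²(dv))` and `(v₁ + u) ∂ₓ f ∈ L²(a⁻¹ dv dx)`. -/
def IsHalfSpaceSolution (ω₀ u : ℝ) (L : L2v 𝕍 m →ₗ.[ℝ] L2v 𝕍 m) (φ : Vel d → Val m)
    (f : ℝ × Vel d → Val m) (finf : L2v 𝕍 m) : Prop :=
  MemLp (fun z => f z - finf z.2) 2 (dxdv 𝕍) ∧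
  ∃ (w : ℝ × Vel d → Val m) (f₀ : Vel d → Val m),
    MemWL2 (fun z => (weight ω₀ z.2)⁻¹) w (dxdv 𝕍) ∧
    HasTransport 𝕍 u f w f₀ ∧
    (∀ᵐ x ∂volume.restrict (Ioi (0 : ℝ)),
      OpEq ω₀ L (fun v => f (x, v)) (fun v => - w (x, v))) ∧
    ∀ᵐ v ∂dv 𝕍, 0 < speed u v → f₀ v = φ v

/-- The matrix `C`, with entries `⟨(v₁ + u) X_r, g_s⟩` at `x = 0`, where `r` and `s` run through
the indices `(+, i)` and `(0, k)` and `g₀ s` is the trace of `g_s` at `x = 0`. -/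
def EigenSystem.C (S : EigenSystem hL νp νm ν0) (g₀ : Fin νp ⊕ Fin ν0 → Vel d → Val m) :
    Matrix (Fin νp ⊕ Fin ν0) (Fin νp ⊕ Fin ν0) ℝ :=
  Matrix.of fun r s => flux 𝕍 u (S.X r) (g₀ s)

/-- The coefficients `η = C⁻¹ (U₊(f), U₀(f))` at `x = 0`; `f₀` is the trace of `f`. -/
def EigenSystem.eta (S : EigenSystem hL νp νm ν0) (g₀ : Fin νp ⊕ Fin ν0 → Vel d → Val m)
    (f₀ : Vel d → Val m) : Fin νp ⊕ Fin ν0 → ℝ :=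
  Matrix.mulVec (S.C g₀)⁻¹ fun r => flux 𝕍 u (S.X r) f₀

/-- The end-state `Φ = ∑ η₊ᵢ X₊ᵢ + ∑ η₀ₖ X₀ₖ`. -/
def EigenSystem.endState (S : EigenSystem hL νp νm ν0) (η : Fin νp ⊕ Fin ν0 → ℝ) : L2v 𝕍 m :=
  ∑ s, η s • S.X s

/-- `f_φ = f - g + Φ` with `g = ∑ η₊ᵢ g₊ᵢ + ∑ η₀ₖ g₀ₖ`. -/
def EigenSystem.recovered (S : EigenSystem hL νp νm ν0) (η : Fin νp ⊕ Fin ν0 → ℝ)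
    (f : ℝ × Vel d → Val m) (g : Fin νp ⊕ Fin ν0 → ℝ × Vel d → Val m) (z : ℝ × Vel d) : Val m :=
  f z - ∑ s, η s • g s z + S.endState η z.2

end Operator

end HalfSpace

end

/-! Conjugation with the weight turns the problem into one for bounded operators on `L²(dv)`:
`scaledOp` is `K = a^{-1/2} L a^{-1/2}`, and `dampedOp` adds to `K` the multiple `α` of the rank one
squares built from the vectors `a^{-1/2} (v₁ + u) Z` (`coflux`). By the spectral gap, `K` is
coercive modulo `√a Null L`, and the moments against the `(v₁ + u) Z` separate the points of the
null space (`coflux_injective`), so the damped operator is coercive (`dampedOp_coercive`). A Riesz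
argument in the style of Lions (`exists_lions`) then solves the damped problem. Uniqueness follows
from the energy identity `2 ∫ ⟨K_d F, F⟩ dx = ∫ (v₁ + u) |f₀|² dv`, whose right side is nonpositive
when the incoming data vanish (`Solves.eq_zero`). The identity rests on the fact that Green's
formula makes `(v₁ + u) f` an indefinite integral on almost every line `v = const`, with the
prescribed trace as initial value (`HasTransport.isTransport`).

Recovery works because the moments `U_Z(x) = ⟨(v₁ + u) Z, f(x)⟩` of a damped solution obey a closed
linear system `U' = -α G U - D U` (`integral_mode_target`). Here `G` is the symmetric, invertible,
indefinite matrix `⟨(v₁ + u) Z, Z'⟩`, and `D` copies the `X₀ₖ` components into the `Yₖ` components.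
With `c = G⁻¹ U`, the `X₀ₖ` rows of `G c = U` read `U₀ₖ = ∑ₗ ⟨L Yₖ, Yₗ⟩ c_{Yₗ}`, so `⟨c, D U⟩ ≥ 0`
and `d/dx ⟨c, U⟩ ≤ -2α |U|²`. If the moments against all `X₊ᵢ` and `X₀ₖ` vanish at `x = 0`, then
`⟨c, U⟩ = ∑ λ₋ c₋² ≤ 0` there; as `⟨c, U⟩` decays at infinity, `U` vanishes identically
(`moments_eq_zero`). Such a damped solution is an undamped one (`solves_undamped`). The vector `η`
is chosen so that `f - g` has this property, and adding the constant null vector `Φ` restores the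
incoming data (`isHalfSpaceSolution_recovered`).

Invertibility of `C` and uniqueness both come from `Solves.eq_zero_of_incoming`: a decaying undamped
solution with trace `r - q`, where `r` vanishes for incoming velocities and `q ∈ H⁺ ⊕ H⁰`, is zero,
and `q = 0`. The fluxes of a decaying undamped solution against the null space are constant in `x`
and square integrable, hence zero. So its energy flux at `x = 0` is `∫ (v₁ + u) |r|² - ∫ (v₁ + u)
|q|² ≤ 0`, and the energy identity forces the solution to vanish; then `r = q`, and the opposite
signs of the two integrals give `r = q = 0`. -/

noncomputable section

namespace HalfSpace

set_option linter.unusedSectionVars false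

/-! ### Primitives on the half-line -/

/-- `y` coincides almost everywhere on `(0, ∞)` with the primitive of `w` that equals `y₀` at `0`. -/
def IsPrimitive {E : Type*} [NormedAddCommGroup E] [NormedSpace ℝ E] (y w : ℝ → E) (y₀ : E) :
    Prop :=
  ∀ᵐ x ∂volume.restrict (Ioi (0 : ℝ)), y x = y₀ + ∫ t in (0 : ℝ)..x, w t

lemma intervalIntegrable_of_memLp_Ioi {E : Type*} [NormedAddCommGroup E] {w : ℝ → E}
    (h : MemLp w 2 (volume.restrict (Ioi (0 : ℝ)))) {x : ℝ} (hx : 0 ≤ x) :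
    IntervalIntegrable w volume 0 x := by
  rw [intervalIntegrable_iff_integrableOn_Ioc_of_le hx]
  have h2 : MemLp w 2 (volume.restrict (Ioc 0 x)) :=
    h.mono_measure (Measure.restrict_mono Ioc_subset_Ioi_self le_rfl)
  exact h2.integrable (by norm_num)

/-- Both factors are absolutely continuous with almost everywhere derivatives `w₁` and `w₂`, so this
is the fundamental theorem of calculus for their product. -/
lemma integral_mul_primitive {w₁ w₂ : ℝ → ℝ} {T : ℝ} (c₁ c₂ : ℝ)
    (h₁ : IntervalIntegrable w₁ volume 0 T) (h₂ : IntervalIntegrable w₂ volume 0 T) :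
    ∫ x in (0 : ℝ)..T, (w₁ x * (c₂ + ∫ t in (0 : ℝ)..x, w₂ t)
      + (c₁ + ∫ t in (0 : ℝ)..x, w₁ t) * w₂ x) =
    (c₁ + ∫ t in (0 : ℝ)..T, w₁ t) * (c₂ + ∫ t in (0 : ℝ)..T, w₂ t) - c₁ * c₂ := by
  have key : ∀ {w : ℝ → ℝ} (c : ℝ), IntervalIntegrable w volume 0 T →
      AbsolutelyContinuousOnInterval (fun x => c + ∫ t in (0 : ℝ)..x, w t) 0 T := by
    intro w c h
    have h1 := h.absolutelyContinuousOnInterval_intervalIntegral (c := 0) (by simp)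
    have h2 : AbsolutelyContinuousOnInterval (fun _ : ℝ => c) 0 T :=
      (LipschitzWith.const c (α := ℝ)).lipschitzOnWith.absolutelyContinuousOnInterval
    exact h2.fun_add h1
  have hd : ∀ {w : ℝ → ℝ} (c : ℝ), IntervalIntegrable w volume 0 T →
      ∀ᵐ x, x ∈ uIcc 0 T → deriv (fun x => c + ∫ t in (0 : ℝ)..x, w t) x = w x := by
    intro w c h
    filter_upwards [h.ae_hasDerivAt_integral] with x hx hxT
    exact ((hx hxT 0 (by simp)).const_add c).deriv
  have := (key c₁ h₁).integral_deriv_mul_eq_sub (key c₂ h₂)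
  simp only [intervalIntegral.integral_same, add_zero] at this
  rw [← this]
  apply intervalIntegral.integral_congr_ae
  filter_upwards [hd c₁ h₁, hd c₂ h₂] with x hx1 hx2 hx
  rw [hx1 (uIoc_subset_uIcc hx), hx2 (uIoc_subset_uIcc hx)]

/-- The product of the two primitives has an integrable derivative, hence a limit at infinity. It
agrees almost everywhere with the integrable function `y₁ y₂`, so the limit is zero and only the
boundary term at `0` survives. -/
lemma IsPrimitive.integral_mul {y₁ y₂ w₁ w₂ : ℝ → ℝ} {c₁ c₂ : ℝ}
    (hy₁ : MemLp y₁ 2 (volume.restrict (Ioi (0 : ℝ))))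
    (hw₁ : MemLp w₁ 2 (volume.restrict (Ioi (0 : ℝ))))
    (hy₂ : MemLp y₂ 2 (volume.restrict (Ioi (0 : ℝ))))
    (hw₂ : MemLp w₂ 2 (volume.restrict (Ioi (0 : ℝ))))
    (h₁ : IsPrimitive y₁ w₁ c₁) (h₂ : IsPrimitive y₂ w₂ c₂) :
    ∫ x in Ioi (0 : ℝ), (w₁ x * y₂ x + y₁ x * w₂ x) = - (c₁ * c₂) := by
  have hint : IntegrableOn (fun x => w₁ x * y₂ x + y₁ x * w₂ x) (Ioi 0) :=
    (hw₁.integrable_mul hy₂).add (hy₁.integrable_mul hw₂)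
  have hlim := intervalIntegral_tendsto_integral_Ioi (0 : ℝ) hint tendsto_id
  set Y : ℝ → ℝ := fun T => (c₁ + ∫ t in (0 : ℝ)..T, w₁ t) * (c₂ + ∫ t in (0 : ℝ)..T, w₂ t)
  have hY : ∀ T, 0 ≤ T → ∫ x in (0 : ℝ)..T, (w₁ x * y₂ x + y₁ x * w₂ x) = Y T - c₁ * c₂ := by
    intro T hT
    rw [← integral_mul_primitive c₁ c₂ (intervalIntegrable_of_memLp_Ioi hw₁ hT)
      (intervalIntegrable_of_memLp_Ioi hw₂ hT)]
    apply intervalIntegral.integral_congr_ae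
    have e1 := (ae_restrict_iff' measurableSet_Ioi).1 h₁
    have e2 := (ae_restrict_iff' measurableSet_Ioi).1 h₂
    filter_upwards [e1, e2] with x hx1 hx2 hx
    rw [uIoc_of_le hT] at hx
    rw [hx1 hx.1, hx2 hx.1]
  have hYlim : Tendsto Y atTop
      (nhds ((∫ x in Ioi (0 : ℝ), (w₁ x * y₂ x + y₁ x * w₂ x)) + c₁ * c₂)) := by
    have := hlim.add_const (c₁ * c₂)
    refine this.congr' ?_
    filter_upwards [eventually_ge_atTop 0] with T hT
    simp only [id]
    rw [hY T hT]; ring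
  have hYint : IntegrableOn Y (Ioi 0) := by
    refine (hy₁.integrable_mul hy₂).congr ?_
    filter_upwards [h₁, h₂] with x hx1 hx2
    simp only [Pi.mul_apply, Y, hx1, hx2]
  -- An integrable function can only converge to zero, because every neighbourhood of infinity has
  -- infinite measure.
  have h0 := IntegrableAtFilter.eq_zero_of_tendsto (l := atTop) (μ := volume)
    ⟨Ioi 0, Ioi_mem_atTop 0, hYint⟩ ?_ hYlim
  · linarith
  · intro s hs
    obtain ⟨a, ha⟩ := mem_atTop_sets.1 hs
    refine top_le_iff.1 ?_
    rw [← Real.volume_Ici (a := a)]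
    exact measure_mono ha

lemma IsPrimitive.coord {m : ℕ} {y w : ℝ → Val m} {c : Val m} (h : IsPrimitive y w c)
    (hw : MemLp w 2 (volume.restrict (Ioi (0 : ℝ)))) (i : Fin m) :
    IsPrimitive (fun x => y x i) (fun x => w x i) (c i) := by
  filter_upwards [h, ae_restrict_mem measurableSet_Ioi] with x hx hx0
  rw [hx]
  have := (EuclideanSpace.proj i : Val m →L[ℝ] ℝ).intervalIntegral_comp_comm
    (intervalIntegrable_of_memLp_Ioi hw (le_of_lt hx0))
  simp only [PiLp.proj_apply] at this
  rw [this]; simp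

lemma memLp_coord {α : Type*} [MeasurableSpace α] {μ : Measure α} {m : ℕ} {y : α → Val m}
    (h : MemLp y 2 μ) (i : Fin m) : MemLp (fun x => y x i) 2 μ :=
  (EuclideanSpace.proj i : Val m →L[ℝ] ℝ).comp_memLp' h

lemma val_inner {m : ℕ} (x y : Val m) : ⟪x, y⟫_ℝ = ∑ i, x i * y i := by
  simp [PiLp.inner_apply, mul_comm]

lemma integrable_inner {α : Type*} [MeasurableSpace α] {μ : Measure α} {E : Type*}
    [NormedAddCommGroup E] [InnerProductSpace ℝ E] {y z : α → E}
    (hy : MemLp y 2 μ) (hz : MemLp z 2 μ) : Integrable (fun x => ⟪y x, z x⟫_ℝ) μ := by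
  have := hy.norm.integrable_mul hz.norm
  refine this.mono' (hy.1.inner hz.1) (ae_of_all _ fun x => ?_)
  simpa using norm_inner_le_norm (𝕜 := ℝ) (y x) (z x)

lemma IsPrimitive.integral_inner {m : ℕ} {y₁ y₂ w₁ w₂ : ℝ → Val m} {c₁ c₂ : Val m}
    (hy₁ : MemLp y₁ 2 (volume.restrict (Ioi (0 : ℝ))))
    (hw₁ : MemLp w₁ 2 (volume.restrict (Ioi (0 : ℝ))))
    (hy₂ : MemLp y₂ 2 (volume.restrict (Ioi (0 : ℝ))))
    (hw₂ : MemLp w₂ 2 (volume.restrict (Ioi (0 : ℝ))))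
    (h₁ : IsPrimitive y₁ w₁ c₁) (h₂ : IsPrimitive y₂ w₂ c₂) :
    ∫ x in Ioi (0 : ℝ), (⟪w₁ x, y₂ x⟫_ℝ + ⟪y₁ x, w₂ x⟫_ℝ) = - ⟪c₁, c₂⟫_ℝ := by
  simp only [val_inner, ← Finset.sum_add_distrib]
  rw [integral_finsetSum]
  · rw [← Finset.sum_neg_distrib]
    refine Finset.sum_congr rfl fun i _ => ?_
    exact (h₁.coord hw₁ i).integral_mul (memLp_coord hy₁ i) (memLp_coord hw₁ i)
      (memLp_coord hy₂ i) (memLp_coord hw₂ i) (h₂.coord hw₂ i)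
  · intro i _
    exact ((memLp_coord hw₁ i).integrable_mul (memLp_coord hy₂ i)).add
      ((memLp_coord hy₁ i).integrable_mul (memLp_coord hw₂ i))

/-! ### Test functions in one variable and a parametric du Bois-Reymond lemma -/

/-- Rectangles form a π-system that generates the product σ-algebra, and the vanishing of the
integral passes to complements and disjoint unions. -/
lemma ae_eq_zero_of_rectangles {α β : Type*} [MeasurableSpace α] [MeasurableSpace β]
    {μ : Measure α} {ν : Measure β} [SFinite μ] [SFinite ν] {h : α × β → ℝ}
    (hint : Integrable h (μ.prod ν))
    (H : ∀ A B, MeasurableSet A → MeasurableSet B → ∫ z in A ×ˢ B, h z ∂μ.prod ν = 0) :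
    h =ᵐ[μ.prod ν] 0 := by
  have key : ∀ S, MeasurableSet S → ∫ z in S, h z ∂μ.prod ν = 0 := by
    intro S hS
    induction S, hS using MeasurableSpace.induction_on_inter generateFrom_prod.symm
      isPiSystem_prod with
    | empty => simp
    | basic t ht =>
      obtain ⟨A, hA, B, hB, rfl⟩ := ht
      exact H A B hA hB
    | compl t htm ih =>
      have h1 := integral_add_compl htm hint
      have h2 := H univ univ MeasurableSet.univ MeasurableSet.univ
      rw [univ_prod_univ, setIntegral_univ] at h2
      rwa [h2, ih, zero_add] at h1
    | iUnion f hd hm ih =>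
      rw [integral_iUnion hm hd hint.integrableOn]
      simp [ih]
  exact hint.ae_eq_zero_of_forall_setIntegral_eq_zero fun S hS _ => key S hS

lemma prod_restrict_Ioi_eq {Y : Type*} [MeasurableSpace Y] (ν : Measure Y) [SFinite ν]
    (s : Set ℝ) :
    (volume.restrict s).prod ν = ((volume : Measure ℝ).prod ν).restrict (s ×ˢ univ) := by
  rw [← Measure.prod_restrict, Measure.restrict_univ]

lemma ae_prod_Ioi_of_Ioc {Y : Type*} [MeasurableSpace Y] {ν : Measure Y} [SFinite ν]
    {p : ℝ × Y → Prop}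
    (H : ∀ n : ℕ, ∀ᵐ z ∂(volume.restrict (Ioc (0 : ℝ) n)).prod ν, p z) :
    ∀ᵐ z ∂(volume.restrict (Ioi (0 : ℝ))).prod ν, p z := by
  have : Ioi (0 : ℝ) ×ˢ (univ : Set Y) = ⋃ n : ℕ, Ioc (0 : ℝ) n ×ˢ (univ : Set Y) := by
    ext ⟨x, y⟩
    simp only [mem_prod, mem_Ioi, mem_univ, and_true, mem_iUnion, mem_Ioc]
    exact ⟨fun hx => ⟨_, hx, Nat.le_ceil x⟩, fun ⟨_, hx, _⟩ => hx⟩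
  rw [prod_restrict_Ioi_eq, this, ae_restrict_iUnion_iff]
  intro n
  rw [← prod_restrict_Ioi_eq]
  exact H n

lemma exists_forall_mem_Ioc {ζ : ℝ → ℝ} (h1 : HasCompactSupport ζ) (h2 : tsupport ζ ⊆ Ioi 0) :
    ∃ ε > 0, ∃ T > ε, ∀ x, ζ x ≠ 0 → x ∈ Ioc ε T := by
  rcases (tsupport ζ).eq_empty_or_nonempty with h0 | h0
  · refine ⟨1, one_pos, 2, one_lt_two, fun x hx => ?_⟩
    have := subset_tsupport ζ hx
    simp [h0] at this
  · obtain ⟨x0, hx0, hmin⟩ := (IsCompact.exists_isLeast h1 h0)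
    obtain ⟨x1, hx1, hmax⟩ := (IsCompact.exists_isGreatest h1 h0)
    have h00 : 0 < x0 := h2 hx0
    have h01 := hmin hx1
    refine ⟨x0 / 2, by positivity, x1 + 1, by linarith, fun x hx => ?_⟩
    have hx := subset_tsupport ζ hx
    have := hmin hx; have := hmax hx
    constructor <;> linarith

/-- The exceptional set of `y` may depend on the test function. Integrating over a set `B` of
parameters first removes this dependence: the result is a function of `x` alone that annihilates all
test functions, so the integrals of `h` over rectangles vanish. -/
lemma ae_eq_zero_of_test {Y : Type*} [MeasurableSpace Y] {ν : Measure Y} [SFinite ν]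
    {h : ℝ × Y → ℝ}
    (hint : ∀ T : ℝ, Integrable h ((volume.restrict (Ioc (0 : ℝ) T)).prod ν))
    (H : ∀ ζ : ℝ → ℝ, ContDiff ℝ ∞ ζ → HasCompactSupport ζ → tsupport ζ ⊆ Ioi 0 →
      ∀ᵐ y ∂ν, ∫ x in Ioi (0 : ℝ), ζ x * h (x, y) = 0) :
    h =ᵐ[(volume.restrict (Ioi (0 : ℝ))).prod ν] 0 := by
  have key : ∀ B : Set Y, MeasurableSet B →
      ∀ᵐ x : ℝ, x ∈ Ioi (0 : ℝ) → ∫ y in B, h (x, y) ∂ν = 0 := by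
    intro B hB
    have hintB : ∀ T : ℝ, Integrable h ((volume.restrict (Ioc (0 : ℝ) T)).prod (ν.restrict B)) :=
      fun T => (hint T).mono_measure (Measure.prod_mono le_rfl Measure.restrict_le_self)
    have hg : ∀ T : ℝ, IntegrableOn (fun x => ∫ y in B, h (x, y) ∂ν) (Ioc 0 T) :=
      fun T => (hintB T).integral_prod_left
    refine isOpen_Ioi.ae_eq_zero_of_integral_contDiff_smul_eq_zero ?_ ?_
    · intro x hx
      refine ⟨Ioc 0 (x + 1), ?_, hg _⟩
      refine mem_nhdsWithin.2 ⟨Iio (x + 1), isOpen_Iio, by simp, ?_⟩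
      rintro y ⟨hy1, hy2⟩
      exact ⟨hy2, le_of_lt hy1⟩
    · intro ζ hζ1 hζ2 hζ3
      obtain ⟨ε, hε, T, hT, hsupp⟩ := exists_forall_mem_Ioc hζ2 hζ3
      have hsupp' : ∀ x, x ∉ Ioc 0 T → ζ x = 0 := fun x hx => by
        by_contra hne
        exact hx ⟨hε.trans (hsupp x hne).1, (hsupp x hne).2⟩
      rw [← setIntegral_eq_integral_of_forall_compl_eq_zero (s := Ioc 0 T)
        (fun x hx => by rw [hsupp' x hx, zero_smul])]
      have hI : Integrable (fun z : ℝ × Y => ζ z.1 * h z)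
          ((volume.restrict (Ioc (0 : ℝ) T)).prod (ν.restrict B)) := by
        obtain ⟨C, hC⟩ := hζ2.exists_bound_of_continuous hζ1.continuous
        exact (hintB T).bdd_mul (c := C)
          (hζ1.continuous.measurable.comp measurable_fst).aestronglyMeasurable
          (ae_of_all _ fun z => hC _)
      calc ∫ x in Ioc 0 T, ζ x • ∫ y in B, h (x, y) ∂ν
          = ∫ x in Ioc 0 T, ∫ y in B, ζ x * h (x, y) ∂ν := by
            simp only [smul_eq_mul, integral_const_mul]
        _ = ∫ y in B, (∫ x in Ioc 0 T, ζ x * h (x, y)) ∂ν := integral_integral_swap hI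
        _ = 0 := by
            refine integral_eq_zero_of_ae ?_
            filter_upwards [ae_restrict_of_ae (H ζ hζ1 hζ2 hζ3)] with y hy
            simp only [Pi.zero_apply]
            refine Eq.trans ?_ hy
            symm
            refine setIntegral_eq_of_subset_of_forall_sdiff_eq_zero measurableSet_Ioi
              Ioc_subset_Ioi_self ?_
            intro x hx
            rw [hsupp' x hx.2, zero_mul]
  refine ae_prod_Ioi_of_Ioc fun n => ?_
  refine ae_eq_zero_of_rectangles (hint n) fun A B hA hB => ?_
  rw [setIntegral_prod _ (hint n).integrableOn, Measure.restrict_restrict hA]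
  refine integral_eq_zero_of_ae ?_
  have hm : MeasurableSet (A ∩ Ioc (0 : ℝ) n) := hA.inter measurableSet_Ioc
  filter_upwards [ae_restrict_of_ae (key B hB), ae_restrict_mem hm] with x hx hxm
  exact hx hxm.2.1

/-- The zero mean makes the primitive vanish again to the right of the support; this is the step
that turns test functions of mean zero into derivatives of test functions. -/
lemma exists_primitive_test {ψ : ℝ → ℝ} (h1 : ContDiff ℝ ∞ ψ) (h2 : HasCompactSupport ψ)
    (h3 : tsupport ψ ⊆ Ioi 0) (h4 : ∫ x in Ioi (0 : ℝ), ψ x = 0) :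
    ∃ Z : ℝ → ℝ, ContDiff ℝ ∞ Z ∧ HasCompactSupport Z ∧ tsupport Z ⊆ Ioi 0 ∧
      deriv Z = ψ ∧ ∀ x, Z x = ∫ t in (0 : ℝ)..x, ψ t := by
  obtain ⟨ε, hε, T, hT, hsupp⟩ := exists_forall_mem_Ioc h2 h3
  have hd : ∀ x, HasDerivAt (fun x => ∫ t in (0 : ℝ)..x, ψ t) (ψ x) x := fun x =>
    intervalIntegral.integral_hasDerivAt_right (h1.continuous.intervalIntegrable _ _)
      (h1.continuous.stronglyMeasurableAtFilter _ _) h1.continuous.continuousAt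
  have hderiv : deriv (fun x => ∫ t in (0 : ℝ)..x, ψ t) = ψ := funext fun x => (hd x).deriv
  have hz : ∀ x, x ∉ Icc ε T → ∫ t in (0 : ℝ)..x, ψ t = 0 := by
    intro x hx
    rcases lt_or_ge x ε with hxε | hxε
    · refine intervalIntegral.integral_zero_ae (ae_of_all _ fun t ht => ?_)
      by_contra hne
      have := (hsupp t hne).1
      rcases mem_uIoc.1 ht with h | h
      · linarith [h.2]
      · linarith [h.2]
    · have hxT : T < x := by
        by_contra hh
        exact hx ⟨hxε, not_lt.1 hh⟩
      rw [intervalIntegral.integral_of_le (by linarith)]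
      refine Eq.trans ?_ h4
      symm
      refine setIntegral_eq_of_subset_of_forall_sdiff_eq_zero measurableSet_Ioi
        Ioc_subset_Ioi_self ?_
      intro t ht
      by_contra hne
      exact ht.2 ⟨ht.1, ((hsupp t hne).2.trans hxT.le)⟩
  have hts : tsupport (fun x => ∫ t in (0 : ℝ)..x, ψ t) ⊆ Icc ε T := by
    refine closure_minimal ?_ isClosed_Icc
    intro x hx
    by_contra hne
    exact hx (hz x hne)
  refine ⟨fun x => ∫ t in (0 : ℝ)..x, ψ t, ?_, ?_, ?_, hderiv, fun _ => rfl⟩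
  · rw [contDiff_infty_iff_deriv, hderiv]
    exact ⟨fun x => (hd x).differentiableAt, h1⟩
  · exact HasCompactSupport.of_support_subset_isCompact isCompact_Icc
      ((subset_tsupport _).trans hts)
  · exact hts.trans fun x hx => lt_of_lt_of_le hε hx.1

lemma exists_normalized_test :
    ∃ ζ : ℝ → ℝ, ContDiff ℝ ∞ ζ ∧ HasCompactSupport ζ ∧ tsupport ζ ⊆ Ioi 0 ∧
      ∫ x in Ioi (0 : ℝ), ζ x = 1 := by
  let b : ContDiffBump (2 : ℝ) := ⟨1 / 2, 1, by norm_num, by norm_num⟩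
  have hts : tsupport (b.normed volume) ⊆ Ioi (0 : ℝ) := by
    rw [b.tsupport_normed_eq]
    intro x hx
    have := abs_le.1 (Real.dist_eq x 2 ▸ Metric.mem_closedBall.1 hx)
    simp only [mem_Ioi]
    have h1 : b.rOut = 1 := rfl
    rw [h1] at this
    linarith [this.1]
  refine ⟨b.normed volume, b.contDiff_normed, b.hasCompactSupport_normed, hts, ?_⟩
  rw [setIntegral_eq_integral_of_forall_compl_eq_zero, b.integral_normed]
  intro x hx
  by_contra hne
  exact hx (hts (subset_tsupport _ hne))

lemma integrableOn_test_mul {ζ g : ℝ → ℝ} (h1 : Continuous ζ) (h2 : HasCompactSupport ζ)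
    (h3 : tsupport ζ ⊆ Ioi 0) (hg : ∀ n : ℕ, IntegrableOn g (Ioc 0 n)) :
    IntegrableOn (fun x => ζ x * g x) (Ioi 0) := by
  obtain ⟨ε, hε, T, hT, hsupp⟩ := exists_forall_mem_Ioc h2 h3
  obtain ⟨n, hn⟩ := exists_nat_ge T
  obtain ⟨C, hC⟩ := h2.exists_bound_of_continuous h1
  have hI : IntegrableOn (fun x => ζ x * g x) (Ioc 0 n) :=
    (hg n).bdd_mul (c := C) h1.aestronglyMeasurable (ae_of_all _ hC)
  refine hI.of_forall_sdiff_eq_zero measurableSet_Ioi fun x hx => ?_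
  have : ζ x = 0 := by
    by_contra hne
    exact hx.2 ⟨hx.1, (hsupp x hne).2.trans hn⟩
  rw [this, zero_mul]

lemma integral_test_parts {Z w : ℝ → ℝ} (h1 : ContDiff ℝ ∞ Z) (h2 : HasCompactSupport Z)
    (h3 : tsupport Z ⊆ Ioi 0) (hw : ∀ n : ℕ, IntegrableOn w (Ioc 0 n)) :
    ∫ x in Ioi (0 : ℝ), (deriv Z x * (∫ t in (0 : ℝ)..x, w t) + Z x * w x) = 0 := by
  obtain ⟨ε, hε, T, hT, hsupp⟩ := exists_forall_mem_Ioc h2 h3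
  obtain ⟨ε', hε', T', hT', hsupp'⟩ := exists_forall_mem_Ioc h2.deriv
    ((tsupport_deriv_subset).trans h3)
  obtain ⟨n, hn⟩ := exists_nat_gt (max T T')
  have hTn := (le_max_left _ _).trans_lt hn
  have hTn' := (le_max_right _ _).trans_lt hn
  have hn0 : (0 : ℝ) ≤ n := Nat.cast_nonneg n
  have hdc : Continuous (deriv Z) := h1.continuous_deriv (by simp)
  have hZ0 : Z 0 = 0 := by
    by_contra hne
    linarith [(hsupp 0 hne).1]
  have hZ : ∀ x, ∫ t in (0 : ℝ)..x, deriv Z t = Z x := fun x => by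
    rw [intervalIntegral.integral_deriv_eq_sub
      (fun y _ => (h1.differentiable (by simp)) y) (hdc.intervalIntegrable _ _), hZ0, sub_zero]
  have hZn : Z n = 0 := by
    by_contra hne
    linarith [(hsupp n hne).2]
  have := integral_mul_primitive (T := n) 0 0 (hdc.intervalIntegrable 0 n)
    ((intervalIntegrable_iff_integrableOn_Ioc_of_le hn0).2 (hw n))
  simp only [zero_add, hZ, hZn, zero_mul, sub_zero] at this
  rw [intervalIntegral.integral_of_le hn0] at this
  refine Eq.trans ?_ this
  refine setIntegral_eq_of_subset_of_forall_sdiff_eq_zero measurableSet_Ioi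
    Ioc_subset_Ioi_self fun x hx => ?_
  have e1 : Z x = 0 := by
    by_contra hne
    exact hx.2 ⟨hx.1, (hsupp x hne).2.trans hTn.le⟩
  have e2 : deriv Z x = 0 := by
    by_contra hne
    exact hx.2 ⟨hx.1, (hsupp' x hne).2.trans hTn'.le⟩
  rw [e1, e2]; simp

lemma ae_ae_of_ae_prod_swap {α β : Type*} [MeasurableSpace α] [MeasurableSpace β]
    {μ : Measure α} {ν : Measure β} [SFinite μ] [SFinite ν] {p : α × β → Prop}
    (h : ∀ᵐ z ∂μ.prod ν, p z) : ∀ᵐ y ∂ν, ∀ᵐ x ∂μ, p (x, y) :=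
  Measure.ae_ae_of_ae_prod
    ((Measure.measurePreserving_swap (μ := ν) (ν := μ)).quasiMeasurePreserving.ae h)

section Primitive

variable {Y : Type*} [MeasurableSpace Y] {ν : Measure Y} [SFinite ν]

/-- The primitive is an integral over all `t > 0` of `w(t, y)` times the indicator of `t ≤ x`. For a
measurable representative of `w` this integrand is jointly measurable in `(x, y, t)`. -/
lemma aestronglyMeasurable_primitive {F : Type*} [NormedAddCommGroup F] [NormedSpace ℝ F]
    {w : ℝ × Y → F}
    (hw : AEStronglyMeasurable w ((volume.restrict (Ioi (0 : ℝ))).prod ν)) :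
    AEStronglyMeasurable (fun z : ℝ × Y => ∫ t in (0 : ℝ)..z.1, w (t, z.2))
      ((volume.restrict (Ioi (0 : ℝ))).prod ν) := by
  let k : (ℝ × Y) × ℝ → F := fun q => indicator {q : (ℝ × Y) × ℝ | q.2 ≤ q.1.1}
    (fun q => hw.mk w (q.2, q.1.2)) q
  have hk : StronglyMeasurable k := by
    refine StronglyMeasurable.indicator ?_ (measurableSet_le measurable_snd
      measurable_fst.fst)
    exact hw.stronglyMeasurable_mk.comp_measurable
      (measurable_snd.prodMk measurable_fst.snd)
  have hI := hk.integral_prod_right' (ν := volume.restrict (Ioi (0 : ℝ)))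
  refine ⟨_, hI, ?_⟩
  have h1 : ∀ᵐ y ∂ν, ∀ᵐ t ∂volume.restrict (Ioi (0 : ℝ)), w (t, y) = hw.mk w (t, y) := by
    exact ae_ae_of_ae_prod_swap hw.ae_eq_mk
  have h2 := (Measure.quasiMeasurePreserving_snd
    (μ := volume.restrict (Ioi (0 : ℝ))) (ν := ν)).ae h1
  have h3 := (Measure.quasiMeasurePreserving_fst
    (μ := volume.restrict (Ioi (0 : ℝ))) (ν := ν)).ae (ae_restrict_mem measurableSet_Ioi)
  filter_upwards [h2, h3] with z hz hz0
  rw [intervalIntegral.integral_of_le (le_of_lt hz0)]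
  have : ∀ t, k (z, t) = indicator (Iic z.1) (fun t => hw.mk w (t, z.2)) t := fun t => rfl
  simp only [this]
  rw [setIntegral_indicator measurableSet_Iic, Ioi_inter_Iic]
  exact integral_congr_ae (ae_restrict_of_ae_restrict_of_subset Ioc_subset_Ioi_self hz)

/-- On `(0, T]` the primitive is dominated by `∫₀ᵀ |w(t, y)| dt`, a function of `y` only. -/
lemma integrable_primitive {w : ℝ × Y → ℝ}
    (hwm : AEStronglyMeasurable w ((volume.restrict (Ioi (0 : ℝ))).prod ν))
    (hw : ∀ T : ℝ, Integrable w ((volume.restrict (Ioc (0 : ℝ) T)).prod ν)) (T : ℝ) :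
    Integrable (fun z : ℝ × Y => ∫ t in (0 : ℝ)..z.1, w (t, z.2))
      ((volume.restrict (Ioc (0 : ℝ) T)).prod ν) := by
  have hM : Integrable (fun z : ℝ × Y => ∫ t in Ioc 0 T, ‖w (t, z.2)‖)
      ((volume.restrict (Ioc (0 : ℝ) T)).prod ν) :=
    ((hw T).norm.integral_prod_right).comp_snd _
  refine hM.mono' ((aestronglyMeasurable_primitive hwm).mono_measure
    (Measure.prod_mono (Measure.restrict_mono Ioc_subset_Ioi_self le_rfl) le_rfl)) ?_
  have h2 := (Measure.quasiMeasurePreserving_snd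
    (μ := volume.restrict (Ioc (0 : ℝ) T)) (ν := ν)).ae (hw T).prod_left_ae
  have h3 := (Measure.quasiMeasurePreserving_fst
    (μ := volume.restrict (Ioc (0 : ℝ) T)) (ν := ν)).ae (ae_restrict_mem measurableSet_Ioc)
  filter_upwards [h2, h3] with z hz hz0
  rw [intervalIntegral.integral_of_le (le_of_lt hz0.1)]
  refine (norm_integral_le_integral_norm _).trans ?_
  exact setIntegral_mono_set hz.norm (ae_of_all _ fun t => norm_nonneg _)
    (Ioc_subset_Ioc_right hz0.2).eventuallyLE

/-- The difference `G` of `p` and the primitive of `w` has zero weak derivative in `x`. It is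
therefore equal to its average `c(y)` against a fixed normalized test function `ζ₁`, which also
shows that `c` is measurable. -/
lemma exists_isPrimitive_of_test {p w : ℝ × Y → ℝ}
    (hp : ∀ T : ℝ, Integrable p ((volume.restrict (Ioc (0 : ℝ) T)).prod ν))
    (hwm : AEStronglyMeasurable w ((volume.restrict (Ioi (0 : ℝ))).prod ν))
    (hw : ∀ T : ℝ, Integrable w ((volume.restrict (Ioc (0 : ℝ) T)).prod ν))
    (H : ∀ ζ : ℝ → ℝ, ContDiff ℝ ∞ ζ → HasCompactSupport ζ → tsupport ζ ⊆ Ioi 0 →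
      ∀ᵐ y ∂ν, ∫ x in Ioi (0 : ℝ), (deriv ζ x * p (x, y) + ζ x * w (x, y)) = 0) :
    ∃ c : Y → ℝ, AEStronglyMeasurable c ν ∧
      ∀ᵐ y ∂ν, IsPrimitive (fun x => p (x, y)) (fun x => w (x, y)) (c y) := by
  obtain ⟨ζ₁, hζ1, hζ2, hζ3, hζ4⟩ := exists_normalized_test
  obtain ⟨ε₁, hε₁, T₁, hT₁, hsupp₁⟩ := exists_forall_mem_Ioc hζ2 hζ3
  set G : ℝ × Y → ℝ := fun z => p z - ∫ t in (0 : ℝ)..z.1, w (t, z.2) with hG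
  have hGint : ∀ T : ℝ, Integrable G ((volume.restrict (Ioc (0 : ℝ) T)).prod ν) :=
    fun T => (hp T).sub (integrable_primitive hwm hw T)
  set c : Y → ℝ := fun y => ∫ x in Ioi (0 : ℝ), ζ₁ x * G (x, y) with hc
  have hcint : Integrable c ν := by
    have hI : Integrable (fun z : ℝ × Y => ζ₁ z.1 * G z)
        ((volume.restrict (Ioc (0 : ℝ) T₁)).prod ν) := by
      obtain ⟨C, hC⟩ := hζ2.exists_bound_of_continuous hζ1.continuous
      exact (hGint T₁).bdd_mul (c := C)
        (hζ1.continuous.measurable.comp measurable_fst).aestronglyMeasurable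
        (ae_of_all _ fun z => hC _)
    refine hI.integral_prod_right.congr (ae_of_all _ fun y => ?_)
    symm
    refine setIntegral_eq_of_subset_of_forall_sdiff_eq_zero measurableSet_Ioi
      Ioc_subset_Ioi_self fun x hx => ?_
    have : ζ₁ x = 0 := by
      by_contra hne
      exact hx.2 ⟨hx.1, (hsupp₁ x hne).2⟩
    rw [this, zero_mul]
  have slice : ∀ {g : ℝ × Y → ℝ},
      (∀ T : ℝ, Integrable g ((volume.restrict (Ioc (0 : ℝ) T)).prod ν)) →
      ∀ᵐ y ∂ν, ∀ n : ℕ, IntegrableOn (fun x => g (x, y)) (Ioc 0 n) := by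
    intro g hg
    rw [ae_all_iff]
    exact fun n => (hg n).prod_left_ae
  refine ⟨c, hcint.aestronglyMeasurable, ?_⟩
  have hzero : (fun z => G z - c z.2) =ᵐ[(volume.restrict (Ioi (0 : ℝ))).prod ν] 0 := by
    refine ae_eq_zero_of_test (fun T => (hGint T).sub (hcint.comp_snd _)) ?_
    intro ζ h1 h2 h3
    set μ₀ := ∫ x in Ioi (0 : ℝ), ζ x
    have hone : ∀ n : ℕ, IntegrableOn (fun _ : ℝ => (1 : ℝ)) (Ioc 0 n) := fun n =>
      integrableOn_const (by simp)
    have iζ : IntegrableOn ζ (Ioi 0) := by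
      simpa using integrableOn_test_mul h1.continuous h2 h3 hone
    have iζ₁ : IntegrableOn ζ₁ (Ioi 0) := by
      simpa using integrableOn_test_mul hζ1.continuous hζ2 hζ3 hone
    -- Subtracting the right multiple of `ζ₁` gives mean zero, so `ζ = Z' + μ₀ ζ₁`. Then `G` is
    -- orthogonal to `Z'`, and the `ζ₁` part reproduces `μ₀ c(y)`.
    obtain ⟨Z, hZ1, hZ2, hZ3, hZ4, -⟩ := exists_primitive_test (ψ := fun x => ζ x - μ₀ * ζ₁ x)
      (h1.sub (contDiff_const.mul hζ1))
      (by
        refine HasCompactSupport.of_support_subset_isCompact (h2.isCompact.union hζ2.isCompact) ?_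
        intro x hx
        by_contra hne
        rw [mem_union, not_or] at hne
        exact hx (by simp [image_eq_zero_of_notMem_tsupport hne.1,
          image_eq_zero_of_notMem_tsupport hne.2]))
      (by
        refine (closure_minimal ?_ ((isClosed_tsupport ζ).union (isClosed_tsupport ζ₁))).trans
          (union_subset h3 hζ3)
        intro x hx
        by_contra hne
        rw [mem_union, not_or] at hne
        exact hx (by simp [image_eq_zero_of_notMem_tsupport hne.1,
          image_eq_zero_of_notMem_tsupport hne.2]))
      (by
        rw [integral_sub iζ (iζ₁.const_mul _), integral_const_mul, hζ4, mul_one, sub_self])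
    filter_upwards [H Z hZ1 hZ2 hZ3, slice hp, slice hGint, slice hw] with y hy hyp hyG hyw
    have hparts := integral_test_parts hZ1 hZ2 hZ3 hyw
    have iZ : Continuous (deriv Z) := hZ1.continuous_deriv (by simp)
    have iW : ∀ n : ℕ, IntegrableOn (fun x => ∫ t in (0 : ℝ)..x, w (t, y)) (Ioc 0 n) := fun n => by
      refine ((hyp n).sub (hyG n)).congr (ae_of_all _ fun x => ?_)
      simp [hG]
    have hZt := (tsupport_deriv_subset (f := Z)).trans hZ3
    have hsub : ∫ x in Ioi (0 : ℝ), deriv Z x * G (x, y) = 0 := by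
      have j1 : Integrable (fun x => deriv Z x * p (x, y) + Z x * w (x, y))
          (volume.restrict (Ioi 0)) :=
        Integrable.add (integrableOn_test_mul iZ hZ2.deriv hZt hyp)
          (integrableOn_test_mul hZ1.continuous hZ2 hZ3 hyw)
      have j2 : Integrable (fun x => deriv Z x * (∫ t in (0 : ℝ)..x, w (t, y)) + Z x * w (x, y))
          (volume.restrict (Ioi 0)) :=
        Integrable.add (integrableOn_test_mul iZ hZ2.deriv hZt iW)
          (integrableOn_test_mul hZ1.continuous hZ2 hZ3 hyw)
      have j3 := integral_sub j1 j2
      rw [hy, hparts, sub_zero] at j3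
      refine Eq.trans ?_ j3
      refine integral_congr_ae (ae_of_all _ fun x => ?_)
      simp only [hG]; ring
    have e1 : ∀ x, ζ x * (G (x, y) - c y) =
        deriv Z x * G (x, y) + μ₀ * (ζ₁ x * G (x, y)) - ζ x * c y := fun x => by
      rw [hZ4]; ring
    simp only [e1]
    have i1 := integrableOn_test_mul iZ hZ2.deriv hZt hyG
    have i2 := (integrableOn_test_mul hζ1.continuous hζ2 hζ3 hyG).const_mul μ₀
    have i3 : Integrable (fun x => deriv Z x * G (x, y) + μ₀ * (ζ₁ x * G (x, y)))
      (volume.restrict (Ioi 0)) := Integrable.add i1 i2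
    rw [integral_sub i3 (iζ.mul_const _), integral_add i1 i2, hsub, integral_const_mul,
      integral_mul_const]
    simp [hc, μ₀]
  filter_upwards [ae_ae_of_ae_prod_swap hzero] with y hy
  filter_upwards [hy] with x hx
  simp only [Pi.zero_apply, hG] at hx
  linarith

end Primitive

/-! ### Weighted `L²` spaces, their slices, and the weight and speed functions -/

section WeightedL2

variable {Z F : Type*} [MeasurableSpace Z] [NormedAddCommGroup F] [InnerProductSpace ℝ F]
  {ρ : Z → ℝ} {f g : Z → F} {μ : Measure Z}

lemma MemWL2.add (hf : MemWL2 ρ f μ) (hg : MemWL2 ρ g μ) :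
    MemWL2 ρ (fun z => f z + g z) μ := by
  have := MemLp.add hf hg
  refine this.ae_eq (ae_of_all _ fun z => ?_)
  simp [smul_add]

lemma MemWL2.const_smul (c : ℝ) (hf : MemWL2 ρ f μ) : MemWL2 ρ (fun z => c • f z) μ := by
  have := MemLp.const_smul hf c
  refine this.ae_eq (ae_of_all _ fun z => ?_)
  simp [smul_comm c]

lemma MemWL2.neg (hf : MemWL2 ρ f μ) : MemWL2 ρ (fun z => - f z) μ := by
  simpa using hf.const_smul (-1)

lemma MemWL2.sub (hf : MemWL2 ρ f μ) (hg : MemWL2 ρ g μ) :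
    MemWL2 ρ (fun z => f z - g z) μ := by
  simpa [sub_eq_add_neg] using hf.add hg.neg

lemma MemWL2.zero : MemWL2 ρ (fun _ => (0 : F)) μ := by
  simp [MemWL2]

lemma MemWL2.sum {ι : Type*} (s : Finset ι) {h : ι → Z → F} (H : ∀ i, MemWL2 ρ (h i) μ) :
    MemWL2 ρ (fun z => ∑ i ∈ s, h i z) μ := by
  classical
  induction s using Finset.induction_on with
  | empty => simpa using MemWL2.zero
  | insert i s hi ih =>
    simp only [Finset.sum_insert hi]
    exact (H i).add ih

lemma MemWL2.congr (hf : MemWL2 ρ f μ) (h : f =ᵐ[μ] g) : MemWL2 ρ g μ := by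
  refine MemLp.ae_eq ?_ hf
  filter_upwards [h] with z hz
  rw [hz]

/-- The factors `√ρ` and `1 / √ρ` cancel in the pairing, which puts `L²(ρ)` and `L²(ρ⁻¹)` in
duality. -/
lemma MemWL2.inner_integrable (hρ : ∀ z, 0 < ρ z) (hf : MemWL2 ρ f μ)
    (hg : MemWL2 (fun z => (ρ z)⁻¹) g μ) : Integrable (fun z => ⟪f z, g z⟫_ℝ) μ := by
  refine (integrable_inner hf hg).congr (ae_of_all _ fun z => ?_)
  have := (Real.sqrt_pos.2 (hρ z)).ne'
  simp only [inner_smul_left, inner_smul_right, Real.sqrt_inv, RCLike.conj_to_real]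
  field_simp

lemma MemWL2.aestronglyMeasurable_of_pos (hm : Measurable ρ) (hρ : ∀ᵐ z ∂μ, 0 < ρ z)
    (hf : MemWL2 ρ f μ) : AEStronglyMeasurable f μ := by
  have h1 : AEStronglyMeasurable (fun z => (Real.sqrt (ρ z))⁻¹) μ :=
    (hm.sqrt.inv).aestronglyMeasurable
  refine (h1.smul hf.1).congr ?_
  filter_upwards [hρ] with z hz
  have := (Real.sqrt_pos.2 hz).ne'
  simp [smul_smul, this]

lemma MemWL2.memLp (hm : Measurable ρ) (hρ : ∀ z, 1 ≤ ρ z) (hf : MemWL2 ρ f μ) :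
    MemLp f 2 μ := by
  refine MemLp.mono hf (hf.aestronglyMeasurable_of_pos hm
    (ae_of_all _ fun z => lt_of_lt_of_le one_pos (hρ z))) (ae_of_all _ fun z => ?_)
  rw [norm_smul, Real.norm_of_nonneg (Real.sqrt_nonneg _)]
  have : 1 ≤ Real.sqrt (ρ z) := Real.one_le_sqrt.2 (hρ z)
  nlinarith [norm_nonneg (f z)]

lemma memWL2_inv_of_memLp (hm : Measurable ρ) (hρ : ∀ z, 1 ≤ ρ z) (hf : MemLp f 2 μ) :
    MemWL2 (fun z => (ρ z)⁻¹) f μ := by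
  refine hf.mono (hm.inv.sqrt.aestronglyMeasurable.smul hf.1) (ae_of_all _ fun z => ?_)
  rw [norm_smul, Real.norm_of_nonneg (Real.sqrt_nonneg _)]
  have h1 : Real.sqrt (ρ z)⁻¹ ≤ 1 := Real.sqrt_le_one.2 (inv_le_one_of_one_le₀ (hρ z))
  nlinarith [norm_nonneg (f z)]

lemma memWL2_iff_integrable (hf : AEStronglyMeasurable f μ) (hm : Measurable ρ)
    (hρ : ∀ z, 0 ≤ ρ z) : MemWL2 ρ f μ ↔ Integrable (fun z => ρ z * ‖f z‖ ^ 2) μ := by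
  have h : AEStronglyMeasurable (fun z => Real.sqrt (ρ z) • f z) μ :=
    hm.sqrt.aestronglyMeasurable.smul hf
  rw [MemWL2, memLp_two_iff_integrable_sq_norm h]
  refine integrable_congr (ae_of_all _ fun z => ?_)
  simp only [norm_smul, mul_pow, Real.norm_of_nonneg (Real.sqrt_nonneg _), Real.sq_sqrt (hρ z)]

end WeightedL2

section Slices

variable {α β F : Type*} [MeasurableSpace α] [MeasurableSpace β] [NormedAddCommGroup F]
  {μ : Measure α} {ν : Measure β} [SFinite μ] [SFinite ν]

lemma memLp_slice_right {f : α × β → F} (hf : MemLp f 2 (μ.prod ν)) :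
    ∀ᵐ x ∂μ, MemLp (fun y => f (x, y)) 2 ν := by
  filter_upwards [hf.1.prodMk_left, ((memLp_two_iff_integrable_sq_norm hf.1).1 hf).prod_right_ae]
    with x h1 h2
  exact (memLp_two_iff_integrable_sq_norm h1).2 h2

lemma memLp_slice_left {f : α × β → F} (hf : MemLp f 2 (μ.prod ν)) :
    ∀ᵐ y ∂ν, MemLp (fun x => f (x, y)) 2 μ :=
  memLp_slice_right (hf.comp_measurePreserving Measure.measurePreserving_swap)

end Slices

section Velocity

variable {d m : ℕ} {𝕍 : Set (Vel d)} {ω₀ u : ℝ}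

lemma weight_pos (ω₀ : ℝ) (v : Vel d) : 0 < weight ω₀ v :=
  Real.rpow_pos_of_pos (by positivity) _

lemma one_le_weight (h0 : 0 ≤ ω₀) (v : Vel d) : 1 ≤ weight ω₀ v :=
  Real.one_le_rpow (by linarith [norm_nonneg v]) h0

lemma continuous_weight (ω₀ : ℝ) : Continuous (weight ω₀ : Vel d → ℝ) :=
  (continuous_const.add continuous_norm).rpow_const
    fun v => Or.inl (add_pos_of_pos_of_nonneg one_pos (norm_nonneg v)).ne'

lemma measurable_weight (ω₀ : ℝ) : Measurable (weight ω₀ : Vel d → ℝ) :=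
  (continuous_weight ω₀).measurable

lemma measurable_weight_snd (ω₀ : ℝ) : Measurable (fun z : ℝ × Vel d => weight ω₀ z.2) :=
  (measurable_weight ω₀).comp measurable_snd

variable [NeZero d]

lemma continuous_speed (u : ℝ) : Continuous (speed u : Vel d → ℝ) := by
  unfold speed; fun_prop

/-- The zero set of the speed is a hyperplane. This is what permits division by `v₁ + u` on almost
every line. -/
lemma speed_ne_zero_ae (𝕍 : Set (Vel d)) (u : ℝ) : ∀ᵐ v ∂dv 𝕍, speed u v ≠ 0 := by
  refine ae_restrict_of_ae ?_
  have h := (EuclideanSpace.volume_preserving_symm_measurableEquiv_toLp (Fin d))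
  have h2 : ∀ᵐ w : Fin d → ℝ, w 0 ≠ -u := by
    rw [ae_iff]
    simp only [ne_eq, not_not]
    exact Measure.pi_hyperplane (fun _ : Fin d => (volume : Measure ℝ)) 0 (-u)
  filter_upwards [h.quasiMeasurePreserving.ae h2] with v hv hs
  apply hv
  simp only [speed] at hs
  change v 0 = -u
  linarith

end Velocity

/-! ### Transport along lines and Green's formula -/

section Transport

variable {d m : ℕ} [NeZero d] {𝕍 : Set (Vel d)} {ω₀ u : ℝ}

/-- `w = (v₁ + u) ∂ₓ f` along almost every line `v = const`, with the initial value `f₀`. -/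
def IsTransport (𝕍 : Set (Vel d)) (u : ℝ) (f w : ℝ × Vel d → Val m) (f₀ : Vel d → Val m) :
    Prop :=
  ∀ᵐ v ∂dv 𝕍, IsPrimitive (fun x => speed u v • f (x, v)) (fun x => w (x, v))
    (speed u v • f₀ v)

lemma slice_source (hω0 : 0 ≤ ω₀) {f : ℝ × Vel d → Val m}
    (hf : MemWL2 (fun z => weight ω₀ z.2) f (dxdv 𝕍)) :
    ∀ᵐ v ∂dv 𝕍, MemLp (fun x => f (x, v)) 2 (volume.restrict (Ioi (0 : ℝ))) :=
  memLp_slice_left (hf.memLp (measurable_weight_snd ω₀) fun z => one_le_weight hω0 z.2)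

/-- For fixed `v` the weight is a positive constant and can be divided out. -/
lemma slice_target {w : ℝ × Vel d → Val m}
    (hw : MemWL2 (fun z => (weight ω₀ z.2)⁻¹) w (dxdv 𝕍)) :
    ∀ᵐ v ∂dv 𝕍, MemLp (fun x => w (x, v)) 2 (volume.restrict (Ioi (0 : ℝ))) := by
  filter_upwards [memLp_slice_left hw] with v hv
  refine (hv.const_smul (Real.sqrt (weight ω₀ v)⁻¹)⁻¹).ae_eq (ae_of_all _ fun x => ?_)
  have := (Real.sqrt_pos.2 (inv_pos.2 (weight_pos ω₀ v))).ne'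
  simp only [Pi.smul_apply, smul_smul, inv_mul_cancel₀ this, one_smul]

/-- The primitives are `(v₁ + u) f₁` and `(v₁ + u) f₂`, so integration by parts carries one factor
of the speed on the left and two on the right. One of them cancels. -/
lemma IsTransport.slice_energy {f₁ w₁ f₂ w₂ : ℝ × Vel d → Val m} {f₁₀ f₂₀ : Vel d → Val m}
    (hω0 : 0 ≤ ω₀)
    (hf₁ : MemWL2 (fun z => weight ω₀ z.2) f₁ (dxdv 𝕍))
    (hw₁ : MemWL2 (fun z => (weight ω₀ z.2)⁻¹) w₁ (dxdv 𝕍))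
    (hf₂ : MemWL2 (fun z => weight ω₀ z.2) f₂ (dxdv 𝕍))
    (hw₂ : MemWL2 (fun z => (weight ω₀ z.2)⁻¹) w₂ (dxdv 𝕍))
    (h₁ : IsTransport 𝕍 u f₁ w₁ f₁₀) (h₂ : IsTransport 𝕍 u f₂ w₂ f₂₀) :
    ∀ᵐ v ∂dv 𝕍, ∫ x in Ioi (0 : ℝ), (⟪w₁ (x, v), f₂ (x, v)⟫_ℝ + ⟪f₁ (x, v), w₂ (x, v)⟫_ℝ) =
      - (speed u v * ⟪f₁₀ v, f₂₀ v⟫_ℝ) := by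
  filter_upwards [h₁, h₂, speed_ne_zero_ae 𝕍 u, slice_source hω0 hf₁, slice_source hω0 hf₂,
    slice_target hw₁, slice_target hw₂] with v h1 h2 hb i1 i2 j1 j2
  have := h1.integral_inner (i1.const_smul (speed u v)) j1 (i2.const_smul (speed u v)) j2 h2
  simp only [Pi.smul_apply, inner_smul_left, inner_smul_right, RCLike.conj_to_real,
    ← mul_add] at this
  rw [integral_const_mul] at this
  apply mul_left_cancel₀ hb
  rw [this]; ring

lemma integrable_energy {f w : ℝ × Vel d → Val m}
    (hf : MemWL2 (fun z => weight ω₀ z.2) f (dxdv 𝕍))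
    (hw : MemWL2 (fun z => (weight ω₀ z.2)⁻¹) w (dxdv 𝕍)) :
    Integrable (fun z => ⟪f z, w z⟫_ℝ) (dxdv 𝕍) :=
  hf.inner_integrable (fun z => weight_pos ω₀ z.2) hw

lemma integrable_energy' {f w : ℝ × Vel d → Val m}
    (hf : MemWL2 (fun z => weight ω₀ z.2) f (dxdv 𝕍))
    (hw : MemWL2 (fun z => (weight ω₀ z.2)⁻¹) w (dxdv 𝕍)) :
    Integrable (fun z => ⟪w z, f z⟫_ℝ) (dxdv 𝕍) := by
  simpa only [real_inner_comm] using integrable_energy hf hw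

/-- Green's formula for two functions with `L²` transport derivatives. -/
lemma IsTransport.energy {f₁ w₁ f₂ w₂ : ℝ × Vel d → Val m} {f₁₀ f₂₀ : Vel d → Val m}
    (hω0 : 0 ≤ ω₀)
    (hf₁ : MemWL2 (fun z => weight ω₀ z.2) f₁ (dxdv 𝕍))
    (hw₁ : MemWL2 (fun z => (weight ω₀ z.2)⁻¹) w₁ (dxdv 𝕍))
    (hf₂ : MemWL2 (fun z => weight ω₀ z.2) f₂ (dxdv 𝕍))
    (hw₂ : MemWL2 (fun z => (weight ω₀ z.2)⁻¹) w₂ (dxdv 𝕍))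
    (h₁ : IsTransport 𝕍 u f₁ w₁ f₁₀) (h₂ : IsTransport 𝕍 u f₂ w₂ f₂₀) :
    ∫ z, (⟪w₁ z, f₂ z⟫_ℝ + ⟪f₁ z, w₂ z⟫_ℝ) ∂dxdv 𝕍 =
      - ∫ v, speed u v * ⟪f₁₀ v, f₂₀ v⟫_ℝ ∂dv 𝕍 := by
  have hint : Integrable (fun z => ⟪w₁ z, f₂ z⟫_ℝ + ⟪f₁ z, w₂ z⟫_ℝ) (dxdv 𝕍) :=
    (integrable_energy' hf₂ hw₁).add (integrable_energy hf₁ hw₂)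
  rw [integral_prod_symm _ hint, ← integral_neg]
  exact integral_congr_ae (slice_energy hω0 hf₁ hw₁ hf₂ hw₂ h₁ h₂)

/-- Green's formula of `f` with itself on each line gives `|v₁ + u| |f₀|²` as the modulus of `2 ∫
⟨w, f⟩ dx`, which is integrable in `v` by Fubini. -/
lemma IsTransport.memWL2_trace {f w : ℝ × Vel d → Val m} {f₀ : Vel d → Val m}
    (hω0 : 0 ≤ ω₀)
    (hf : MemWL2 (fun z => weight ω₀ z.2) f (dxdv 𝕍))
    (hw : MemWL2 (fun z => (weight ω₀ z.2)⁻¹) w (dxdv 𝕍))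
    (h : IsTransport 𝕍 u f w f₀) (hm : AEStronglyMeasurable f₀ (dv 𝕍)) :
    MemWL2 (fun v => |speed u v|) f₀ (dv 𝕍) := by
  rw [memWL2_iff_integrable hm (continuous_speed u).abs.measurable fun v => abs_nonneg _]
  have hint : Integrable (fun z => ⟪w z, f z⟫_ℝ + ⟪f z, w z⟫_ℝ) (dxdv 𝕍) :=
    (integrable_energy' hf hw).add (integrable_energy hf hw)
  refine hint.integral_prod_right.norm.congr ?_
  filter_upwards [slice_energy hω0 hf hw hf hw h h] with v hv
  rw [hv, norm_neg, norm_mul, Real.norm_eq_abs, real_inner_self_eq_norm_sq]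
  simp

lemma continuous_deriv_slice {E F : Type*} [NormedAddCommGroup E] [NormedSpace ℝ E]
    [NormedAddCommGroup F] [NormedSpace ℝ F] {θ : ℝ × E → F} (h : ContDiff ℝ ∞ θ) :
    Continuous (fun z : ℝ × E => deriv (fun t => θ (t, z.2)) z.1) := by
  have h1 : ∀ z : ℝ × E, deriv (fun t => θ (t, z.2)) z.1 = fderiv ℝ θ z (1, 0) := by
    intro z
    have h2 : HasDerivAt (fun t : ℝ => ((t, z.2) : ℝ × E)) (1, 0) z.1 :=
      (hasDerivAt_id z.1).prodMk (hasDerivAt_const _ _)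
    have h3 := ((h.differentiable (by simp)) z).hasFDerivAt
    exact (HasFDerivAt.comp_hasDerivAt z.1 h3 h2).deriv
  simp only [h1]
  exact (h.continuous_fderiv (by simp)).clm_apply continuous_const

lemma hasDerivAt_slice {E F : Type*} [NormedAddCommGroup E] [NormedSpace ℝ E]
    [NormedAddCommGroup F] [NormedSpace ℝ F] {θ : ℝ × E → F} (h : ContDiff ℝ ∞ θ) (x : ℝ) (v : E) :
    HasDerivAt (fun t => θ (t, v)) (deriv (fun t => θ (t, v)) x) x := by
  have : Differentiable ℝ (fun t => θ (t, v)) :=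
    (h.differentiable (by simp)).comp (differentiable_id.prodMk (differentiable_const v))
  exact (this x).hasDerivAt

lemma hasCompactSupport_deriv_slice {E F : Type*} [NormedAddCommGroup E] [NormedSpace ℝ E]
    [NormedAddCommGroup F] [NormedSpace ℝ F] {θ : ℝ × E → F} (h : HasCompactSupport θ) :
    HasCompactSupport (fun z : ℝ × E => deriv (fun t => θ (t, z.2)) z.1) := by
  refine HasCompactSupport.of_support_subset_isCompact h.isCompact fun z hz => ?_
  by_contra hne
  apply hz
  have h1 : θ =ᶠ[nhds z] 0 := notMem_tsupport_iff_eventuallyEq.1 hne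
  have h2 : Tendsto (fun t : ℝ => ((t, z.2) : ℝ × E)) (nhds z.1) (nhds z) := by
    have : Continuous (fun t : ℝ => ((t, z.2) : ℝ × E)) := by fun_prop
    exact this.tendsto z.1
  have h3 : (fun t => θ (t, z.2)) =ᶠ[nhds z.1] fun _ => 0 := h2.eventually h1
  simpa using h3.deriv_eq

lemma memLp_dxdv_of_continuous {E : Type*} [NormedAddCommGroup E] {θ : ℝ × Vel d → E}
    (h : Continuous θ) (hc : HasCompactSupport θ) : MemLp θ 2 (dxdv 𝕍) := by
  have : dxdv 𝕍 = (volume : Measure (ℝ × Vel d)).restrict (Ioi 0 ×ˢ 𝕍) := by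
    rw [dxdv, Measure.prod_restrict]; rfl
  rw [this]
  exact (h.memLp_of_hasCompactSupport hc).restrict _

lemma memWL2_dxdv_of_continuous {ρ : Vel d → ℝ} (hρ : Continuous ρ) {θ : ℝ × Vel d → Val m}
    (h : Continuous θ) (hc : HasCompactSupport θ) :
    MemWL2 (fun z => ρ z.2) θ (dxdv 𝕍) := by
  have h1 : Continuous (fun z : ℝ × Vel d => Real.sqrt (ρ z.2) • θ z) :=
    ((hρ.comp continuous_snd).sqrt).smul h
  have h2 : HasCompactSupport (fun z : ℝ × Vel d => Real.sqrt (ρ z.2) • θ z) :=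
    HasCompactSupport.smul_left (f := fun z : ℝ × Vel d => Real.sqrt (ρ z.2)) (f' := θ) hc
  exact memLp_dxdv_of_continuous h1 h2

lemma continuous_weight_inv (ω₀ : ℝ) : Continuous (fun v : Vel d => (weight ω₀ v)⁻¹) :=
  (continuous_weight ω₀).inv₀ fun v => (weight_pos ω₀ v).ne'

lemma isPrimitive_slice {θ : ℝ × Vel d → Val m} (h : ContDiff ℝ ∞ θ) (b : ℝ) (v : Vel d) :
    IsPrimitive (fun x => b • θ (x, v)) (fun x => b • deriv (fun t => θ (t, v)) x)
      (b • θ (0, v)) := by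
  refine ae_of_all _ fun x => ?_
  have hc : Continuous (fun x : ℝ => deriv (fun t => θ (t, v)) x) :=
    (continuous_deriv_slice h).comp (continuous_id.prodMk continuous_const)
  rw [intervalIntegral.integral_smul, intervalIntegral.integral_eq_sub_of_hasDerivAt
    (fun t _ => hasDerivAt_slice h t v) (hc.intervalIntegrable _ _), ← smul_add]
  simp

/-- A smooth test function `θ` is itself transported along lines, with derivative `(v₁ + u) ∂ₓθ`, so
its Green formula with `f` is an instance of the energy identity. -/
lemma IsTransport.hasTransport {f w : ℝ × Vel d → Val m} {f₀ : Vel d → Val m}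
    (hω0 : 0 ≤ ω₀)
    (hf : MemWL2 (fun z => weight ω₀ z.2) f (dxdv 𝕍))
    (hw : MemWL2 (fun z => (weight ω₀ z.2)⁻¹) w (dxdv 𝕍))
    (h : IsTransport 𝕍 u f w f₀) (hm : AEStronglyMeasurable f₀ (dv 𝕍)) :
    HasTransport 𝕍 u f w f₀ := by
  refine ⟨h.memWL2_trace hω0 hf hw hm, fun θ h1 h2 => ?_⟩
  have hθ : MemWL2 (fun z => weight ω₀ z.2) θ (dxdv 𝕍) :=
    memWL2_dxdv_of_continuous (continuous_weight ω₀) h1.continuous h2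
  have hc : Continuous (fun z : ℝ × Vel d => speed u z.2 • deriv (fun t => θ (t, z.2)) z.1) :=
    ((continuous_speed u).comp continuous_snd).smul (continuous_deriv_slice h1)
  have hcs : HasCompactSupport
      (fun z : ℝ × Vel d => speed u z.2 • deriv (fun t => θ (t, z.2)) z.1) :=
    HasCompactSupport.smul_left (f := fun z : ℝ × Vel d => speed u z.2)
      (f' := fun z : ℝ × Vel d => deriv (fun t => θ (t, z.2)) z.1)
      (hasCompactSupport_deriv_slice h2)
  have hdθ : MemWL2 (fun z => (weight ω₀ z.2)⁻¹)
      (fun z : ℝ × Vel d => speed u z.2 • deriv (fun t => θ (t, z.2)) z.1) (dxdv 𝕍) :=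
    memWL2_dxdv_of_continuous (continuous_weight_inv ω₀) hc hcs
  have hT : IsTransport 𝕍 u θ (fun z => speed u z.2 • deriv (fun t => θ (t, z.2)) z.1)
      (fun v => θ (0, v)) := ae_of_all _ fun v => isPrimitive_slice h1 _ v
  rw [← h.energy hω0 hf hw hθ hdθ hT]
  refine integral_congr_ae (ae_of_all _ fun z => ?_)
  simp only [inner_smul_right]
  ring

end Transport

lemma inner_toLp {α : Type*} [MeasurableSpace α] {μ : Measure α} {E : Type*}
    [NormedAddCommGroup E] [InnerProductSpace ℝ E] {f g : α → E}
    (hf : MemLp f 2 μ) (hg : MemLp g 2 μ) :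
    ⟪hf.toLp f, hg.toLp g⟫_ℝ = ∫ x, ⟪f x, g x⟫_ℝ ∂μ := by
  rw [L2.inner_def]
  refine integral_congr_ae ?_
  filter_upwards [hf.coeFn_toLp, hg.coeFn_toLp] with x h1 h2
  rw [h1, h2]

/-- Null sets on almost every line give a null set of the product only when the set is measurable;
passing to measurable representatives ensures this. -/
lemma ae_eq_prod_of_ae_ae {α β F : Type*} [MeasurableSpace α] [MeasurableSpace β]
    [NormedAddCommGroup F] {μ : Measure α} {ν : Measure β} [SFinite μ] [SFinite ν]
    {f g : α × β → F} (hf : AEStronglyMeasurable f (μ.prod ν))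
    (hg : AEStronglyMeasurable g (μ.prod ν))
    (h : ∀ᵐ y ∂ν, ∀ᵐ x ∂μ, f (x, y) = g (x, y)) : f =ᵐ[μ.prod ν] g := by
  have hms : MeasurableSet {z : β × α | hf.mk f z.swap = hg.mk g z.swap} :=
    (hf.stronglyMeasurable_mk.comp_measurable measurable_swap).measurableSet_eq_fun
      (hg.stronglyMeasurable_mk.comp_measurable measurable_swap)
  have h1 : ∀ᵐ z ∂ν.prod μ, hf.mk f z.swap = hg.mk g z.swap := by
    rw [Measure.ae_prod_iff_ae_ae hms]
    filter_upwards [h, ae_ae_of_ae_prod_swap hf.ae_eq_mk, ae_ae_of_ae_prod_swap hg.ae_eq_mk]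
      with y h1 h2 h3
    filter_upwards [h1, h2, h3] with x h1 h2 h3
    simp only [Prod.swap]
    rw [← h2, ← h3, h1]
  have h2 : ∀ᵐ z ∂μ.prod ν, hf.mk f z = hg.mk g z :=
    (Measure.measurePreserving_swap (μ := μ) (ν := ν)).quasiMeasurePreserving.ae h1
  exact hf.ae_eq_mk.trans (EventuallyEq.trans h2 hg.ae_eq_mk.symm)

/-- By Cauchy–Schwarz in `y` the square of the moment is at most `‖q‖²` times the squared norm of
the slice, which is integrable in `x`. -/
lemma memLp_integral_inner {α β F : Type*} [MeasurableSpace α] [MeasurableSpace β]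
    [NormedAddCommGroup F] [InnerProductSpace ℝ F] {μ : Measure α} {ν : Measure β}
    [SFinite μ] [SFinite ν] {q : β → F} (hq : MemLp q 2 ν) {f : α × β → F}
    (hf : MemLp f 2 (μ.prod ν)) : MemLp (fun x => ∫ y, ⟪q y, f (x, y)⟫_ℝ ∂ν) 2 μ := by
  have hm : AEStronglyMeasurable (fun x => ∫ y, ⟪q y, f (x, y)⟫_ℝ ∂ν) μ :=
    AEStronglyMeasurable.integral_prod_right' (f := fun z : α × β => ⟪q z.2, f z⟫_ℝ)
      ((hq.1.comp_snd).inner hf.1)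
  have hsq := ((memLp_two_iff_integrable_sq_norm hf.1).1 hf)
  rw [memLp_two_iff_integrable_sq_norm hm]
  refine (hsq.integral_prod_left.const_mul (‖hq.toLp q‖ ^ 2)).mono' (hm.norm.pow 2) ?_
  filter_upwards [memLp_slice_right hf] with x hx
  rw [← inner_toLp hq hx, norm_pow, norm_norm]
  have h1 : ∫ y, ‖f (x, y)‖ ^ 2 ∂ν = ‖hx.toLp _‖ ^ 2 := by
    rw [← real_inner_self_eq_norm_sq, inner_toLp]
    simp only [real_inner_self_eq_norm_sq]
  rw [h1, ← mul_pow]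
  gcongr
  exact norm_inner_le_norm _ _

section Transport

variable {d m : ℕ} [NeZero d] {𝕍 : Set (Vel d)} {ω₀ u : ℝ}

lemma IsTransport.add {f₁ w₁ f₂ w₂ : ℝ × Vel d → Val m} {f₁₀ f₂₀ : Vel d → Val m}
    (hw₁ : MemWL2 (fun z => (weight ω₀ z.2)⁻¹) w₁ (dxdv 𝕍))
    (hw₂ : MemWL2 (fun z => (weight ω₀ z.2)⁻¹) w₂ (dxdv 𝕍))
    (h₁ : IsTransport 𝕍 u f₁ w₁ f₁₀) (h₂ : IsTransport 𝕍 u f₂ w₂ f₂₀) :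
    IsTransport 𝕍 u (fun z => f₁ z + f₂ z) (fun z => w₁ z + w₂ z) (fun v => f₁₀ v + f₂₀ v) := by
  filter_upwards [h₁, h₂, slice_target hw₁, slice_target hw₂] with v h1 h2 i1 i2
  filter_upwards [h1, h2, ae_restrict_mem measurableSet_Ioi] with x e1 e2 hx
  rw [smul_add, e1, e2, intervalIntegral.integral_add
    (intervalIntegrable_of_memLp_Ioi i1 (le_of_lt hx))
    (intervalIntegrable_of_memLp_Ioi i2 (le_of_lt hx)), smul_add]
  abel

lemma IsTransport.const_smul {f w : ℝ × Vel d → Val m} {f₀ : Vel d → Val m} (c : ℝ)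
    (h : IsTransport 𝕍 u f w f₀) :
    IsTransport 𝕍 u (fun z => c • f z) (fun z => c • w z) (fun v => c • f₀ v) := by
  filter_upwards [h] with v h1
  filter_upwards [h1] with x e1
  rw [smul_comm, e1, intervalIntegral.integral_smul, smul_add, smul_comm c]

lemma IsTransport.zero : IsTransport 𝕍 u (fun _ => (0 : Val m)) (fun _ => 0) (fun _ => 0) := by
  refine ae_of_all _ fun v => ae_of_all _ fun x => ?_
  simp

lemma integrable_smul_of_memLp {α : Type*} [MeasurableSpace α] {μ : Measure α} {E : Type*}
    [NormedAddCommGroup E] [NormedSpace ℝ E] {c : α → ℝ} {f : α → E}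
    (hc : MemLp c 2 μ) (hf : MemLp f 2 μ) : Integrable (fun z => c z • f z) μ := by
  refine (hc.norm.integrable_mul hf.norm).mono' (hc.1.smul hf.1) (ae_of_all _ fun z => ?_)
  simp [norm_smul]

/-- The compact supports of `ζ` and `χ` absorb the unbounded factors `v₁ + u` and `√a`. -/
lemma integrable_test {f w : ℝ × Vel d → Val m} (hω0 : 0 ≤ ω₀)
    (hf : MemWL2 (fun z => weight ω₀ z.2) f (dxdv 𝕍))
    (hw : MemWL2 (fun z => (weight ω₀ z.2)⁻¹) w (dxdv 𝕍)) {ζ : ℝ → ℝ} (h1 : ContDiff ℝ ∞ ζ)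
    (h2 : HasCompactSupport ζ) {χ : Vel d → ℝ} (h3 : Continuous χ) (h4 : HasCompactSupport χ) :
    Integrable (fun z => χ z.2 • (deriv ζ z.1 • speed u z.2 • f z + ζ z.1 • w z)) (dxdv 𝕍) := by
  have hprod : ∀ {ζ : ℝ → ℝ} {ρ : Vel d → ℝ}, Continuous ζ → HasCompactSupport ζ →
      Continuous ρ → MemLp (fun z : ℝ × Vel d => ζ z.1 * (χ z.2 * ρ z.2)) 2 (dxdv 𝕍) := by
    intro ζ ρ hζ1 hζ2 hρ
    refine memLp_dxdv_of_continuous (by fun_prop) ?_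
    refine HasCompactSupport.of_support_subset_isCompact
      (hζ2.isCompact.prod h4.isCompact) fun z hz => ?_
    refine ⟨subset_tsupport _ fun h => hz ?_, subset_tsupport _ fun h => hz ?_⟩
    · simp [h]
    · simp [h]
  have i1 := integrable_smul_of_memLp
    (hprod (h1.continuous_deriv (by simp)) h2.deriv (continuous_speed u))
    (hf.memLp (measurable_weight_snd ω₀) fun z => one_le_weight hω0 z.2)
  have i2 := integrable_smul_of_memLp
    (hprod (ρ := fun v => Real.sqrt (weight ω₀ v)) h1.continuous h2
      (continuous_weight ω₀).sqrt) hw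
  refine (i1.add i2).congr (ae_of_all _ fun z => ?_)
  have := (Real.sqrt_pos.2 (weight_pos ω₀ z.2)).ne'
  simp only [Pi.add_apply, smul_smul, Real.sqrt_inv, smul_add]
  congr 1
  · congr 1; ring
  · congr 1; field_simp

lemma locallyIntegrable_of_test {E : Type*} [NormedAddCommGroup E] [NormedSpace ℝ E]
    {g : Vel d → E} {μ : Measure (Vel d)}
    (hI : ∀ χ : Vel d → ℝ, Continuous χ → HasCompactSupport χ →
      Integrable (fun v => χ v • g v) μ) : LocallyIntegrable g μ := by
  rw [locallyIntegrable_iff]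
  intro K hK
  obtain ⟨R, hR⟩ := hK.isBounded.subset_closedBall 0
  let b : ContDiffBump (0 : Vel d) :=
    ⟨max R 1, max R 1 + 1, lt_of_lt_of_le one_pos (le_max_right _ _), by linarith⟩
  have hb := hI b b.continuous b.hasCompactSupport
  refine (hb.integrableOn (s := K)).congr_fun (fun v hv => ?_) hK.measurableSet
  have : b v = 1 := b.one_of_mem_closedBall
    (Metric.closedBall_subset_closedBall (le_max_left _ _) (hR hv))
  simp [this]

/-- Fubini turns the tensor test functions `ζ χ e` into tests of the line integral against arbitrary
`χ`, and the fundamental lemma in `v` applies. -/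
lemma ae_test_eq_zero {f w : ℝ × Vel d → Val m} (hω0 : 0 ≤ ω₀)
    (hf : MemWL2 (fun z => weight ω₀ z.2) f (dxdv 𝕍))
    (hw : MemWL2 (fun z => (weight ω₀ z.2)⁻¹) w (dxdv 𝕍)) {ζ : ℝ → ℝ} (h1 : ContDiff ℝ ∞ ζ)
    (h2 : HasCompactSupport ζ)
    (H : ∀ χ : Vel d → ℝ, ContDiff ℝ ∞ χ → HasCompactSupport χ → ∀ e : Val m,
      ∫ z, ⟪χ z.2 • (deriv ζ z.1 • speed u z.2 • f z + ζ z.1 • w z), e⟫_ℝ ∂dxdv 𝕍 = 0) :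
    ∀ᵐ v ∂dv 𝕍,
      ∫ x in Ioi (0 : ℝ), (deriv ζ x • speed u v • f (x, v) + ζ x • w (x, v)) = 0 := by
  have hI : ∀ χ : Vel d → ℝ, Continuous χ → HasCompactSupport χ → Integrable (fun v => χ v •
      ∫ x in Ioi (0 : ℝ), (deriv ζ x • speed u v • f (x, v) + ζ x • w (x, v))) (dv 𝕍) := by
    intro χ h3 h4
    have := (integrable_test (u := u) hω0 hf hw h1 h2 h3 h4).integral_prod_right
    simpa only [integral_smul] using this
  refine ae_eq_zero_of_integral_contDiff_smul_eq_zero ?_ ?_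
  · exact locallyIntegrable_of_test hI
  · intro χ h3 h4
    refine ext_inner_right ℝ fun e => ?_
    have hi := integrable_test (u := u) hω0 hf hw h1 h2 h3.continuous h4
    refine Eq.trans ?_ ((H χ h3 h4 e).trans (inner_zero_left e).symm)
    have e1 := ((innerSL ℝ e).integral_comp_comm hi)
    simp only [innerSL_apply_apply] at e1
    simp only [real_inner_comm e]
    rw [e1, integral_prod_symm _ hi]
    simp only [integral_smul]

end Transport

/-! ### Existence and uniqueness of traces -/

section Transport

variable {d m : ℕ} [NeZero d] {𝕍 : Set (Vel d)} {ω₀ u : ℝ}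

/-- Multiplication by such a `q` makes `L²` functions integrable on a space of infinite measure
without losing information. -/
lemma exists_pos_memLp_two {α : Type*} [MeasurableSpace α] (μ : Measure α) [SigmaFinite μ] :
    ∃ q : α → ℝ, (∀ x, 0 < q x) ∧ Measurable q ∧ MemLp q 2 μ := by
  obtain ⟨g, hg1, hg2, hg3⟩ := exists_pos_lintegral_lt_of_sigmaFinite μ one_ne_zero
  have hm : Measurable fun x => Real.sqrt (g x) := hg2.coe_nnreal_real.sqrt
  refine ⟨fun x => Real.sqrt (g x), fun x => Real.sqrt_pos.2 (by exact_mod_cast hg1 x), hm, ?_⟩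
  rw [memLp_two_iff_integrable_sq hm.aestronglyMeasurable]
  simp only [Real.sq_sqrt (NNReal.coe_nonneg _)]
  refine ⟨hg2.coe_nnreal_real.aestronglyMeasurable, ?_⟩
  refine lt_of_le_of_lt (le_of_eq ?_) (hg3.trans ENNReal.one_lt_top)
  refine lintegral_congr fun x => ?_
  simp

/-- Existence of a trace. -/
lemma exists_isTransport {f w : ℝ × Vel d → Val m} (hω0 : 0 ≤ ω₀)
    (hf : MemWL2 (fun z => weight ω₀ z.2) f (dxdv 𝕍))
    (hw : MemWL2 (fun z => (weight ω₀ z.2)⁻¹) w (dxdv 𝕍))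
    (H : ∀ ζ : ℝ → ℝ, ContDiff ℝ ∞ ζ → HasCompactSupport ζ → tsupport ζ ⊆ Ioi 0 →
      ∀ᵐ v ∂dv 𝕍,
        ∫ x in Ioi (0 : ℝ), (deriv ζ x • speed u v • f (x, v) + ζ x • w (x, v)) = 0) :
    ∃ f₀ : Vel d → Val m, AEStronglyMeasurable f₀ (dv 𝕍) ∧ IsTransport 𝕍 u f w f₀ := by
  obtain ⟨q, hq1, hq2, hq3⟩ := exists_pos_memLp_two (dv 𝕍)
  set s : Vel d → ℝ := fun v => Real.sqrt (weight ω₀ v) with hs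
  have hspos : ∀ v, 0 < s v := fun v => Real.sqrt_pos.2 (weight_pos ω₀ v)
  have hs1 : ∀ v, 1 ≤ s v := fun v => Real.one_le_sqrt.2 (one_le_weight hω0 v)
  have hsm : Measurable s := (measurable_weight ω₀).sqrt
  -- The factor `κ` depends on `v` only and so commutes with `∂ₓ`. Its part `q` turns `L²` into
  -- `L¹`, and the other two parts compensate `√a` and the speed, so that `κ (v₁ + u) f` and `κ w`
  -- are integrable up to any finite `x`.
  set κ : Vel d → ℝ := fun v => q v * (s v)⁻¹ * (1 + |speed u v|)⁻¹ with hκ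
  have hbpos : ∀ v : Vel d, 0 < 1 + |speed u v| := fun v => by positivity
  have hκpos : ∀ v, 0 < κ v := fun v =>
    mul_pos (mul_pos (hq1 v) (inv_pos.2 (hspos v))) (inv_pos.2 (hbpos v))
  have hbm : Measurable (speed u : Vel d → ℝ) := (continuous_speed u).measurable
  have hκm : Measurable κ := (hq2.mul hsm.inv).mul (measurable_const.add hbm.abs).inv
  have hfm := hf.aestronglyMeasurable_of_pos (measurable_weight_snd ω₀)
    (ae_of_all _ fun z => weight_pos ω₀ z.2)
  have hwm := hw.aestronglyMeasurable_of_pos (measurable_weight_snd ω₀).inv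
    (ae_of_all _ fun z => inv_pos.2 (weight_pos ω₀ z.2))
  have hcoordm : ∀ {h : ℝ × Vel d → Val m} (i : Fin m), AEStronglyMeasurable h (dxdv 𝕍) →
      AEStronglyMeasurable (fun z => h z i) (dxdv 𝕍) := fun i hh =>
    (EuclideanSpace.proj i : Val m →L[ℝ] ℝ).continuous.comp_aestronglyMeasurable hh
  have hle : ∀ T : ℝ, (volume.restrict (Ioc (0 : ℝ) T)).prod (dv 𝕍) ≤ dxdv 𝕍 := fun T =>
    Measure.prod_mono (Measure.restrict_mono Ioc_subset_Ioi_self le_rfl) le_rfl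
  have bound : ∀ (h : ℝ × Vel d → Val m) (r : Vel d → ℝ), MemLp h 2 (dxdv 𝕍) →
      Measurable r → (∀ v, |r v| ≤ 1) → ∀ (i : Fin m) (T : ℝ),
      Integrable (fun z => r z.2 * (q z.2 * h z i)) ((volume.restrict (Ioc (0 : ℝ) T)).prod (dv 𝕍)) := by
    intro h r hh hr hr1 i T
    have h1 : MemLp (fun z => h z i) 2 ((volume.restrict (Ioc (0 : ℝ) T)).prod (dv 𝕍)) :=
      memLp_coord (hh.mono_measure (hle T)) i
    have h2 : MemLp (fun z : ℝ × Vel d => q z.2) 2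
        ((volume.restrict (Ioc (0 : ℝ) T)).prod (dv 𝕍)) := hq3.comp_snd _
    exact (h2.integrable_mul h1).bdd_mul (c := 1) (hr.comp measurable_snd).aestronglyMeasurable
      (ae_of_all _ fun z => hr1 _)
  have hp : ∀ i T, Integrable (fun z => κ z.2 * (speed u z.2 * f z i))
      ((volume.restrict (Ioc (0 : ℝ) T)).prod (dv 𝕍)) := by
    intro i T
    refine (bound _ (fun v => (s v)⁻¹ * (s v)⁻¹ * ((1 + |speed u v|)⁻¹ * speed u v)) hf
      ((hsm.inv.mul hsm.inv).mul ((measurable_const.add hbm.abs).inv.mul hbm)) ?_ i T).congr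
      (ae_of_all _ fun z => ?_)
    · intro v
      have a1 : (s v)⁻¹ ≤ 1 := inv_le_one_of_one_le₀ (hs1 v)
      have a0 : 0 ≤ (s v)⁻¹ := (inv_pos.2 (hspos v)).le
      have a2 : (1 + |speed u v|)⁻¹ * |speed u v| ≤ 1 := by
        rw [inv_mul_le_iff₀ (hbpos v)]; linarith
      rw [abs_mul, abs_mul, abs_mul, abs_of_nonneg a0, abs_of_pos (inv_pos.2 (hbpos v))]
      exact mul_le_one₀ (mul_le_one₀ a1 a0 a1) (by positivity) a2
    · have := (hspos z.2).ne'
      simp only [hκ, PiLp.smul_apply, smul_eq_mul]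
      change _ * (_ * (s z.2 * _)) = _
      field_simp
  have hw' : ∀ i T, Integrable (fun z => κ z.2 * w z i)
      ((volume.restrict (Ioc (0 : ℝ) T)).prod (dv 𝕍)) := by
    intro i T
    refine (bound _ (fun v => (1 + |speed u v|)⁻¹) hw
      (measurable_const.add hbm.abs).inv ?_ i T).congr (ae_of_all _ fun z => ?_)
    · intro v
      rw [abs_of_pos (inv_pos.2 (hbpos v))]
      exact inv_le_one_of_one_le₀ (by linarith [abs_nonneg (speed u v)])
    · simp only [hκ, PiLp.smul_apply, smul_eq_mul, Real.sqrt_inv]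
      change _ * (_ * ((s z.2)⁻¹ * _)) = _
      ring
  have hex : ∀ i : Fin m, ∃ c : Vel d → ℝ, AEStronglyMeasurable c (dv 𝕍) ∧
      ∀ᵐ v ∂dv 𝕍, IsPrimitive (fun x => κ v * (speed u v * f (x, v) i))
        (fun x => κ v * w (x, v) i) (c v) := by
    intro i
    have hwi : AEStronglyMeasurable (fun z => κ z.2 * w z i) (dxdv 𝕍) :=
      (hκm.comp measurable_snd).aestronglyMeasurable.mul (hcoordm i hwm)
    refine exists_isPrimitive_of_test (p := fun z => κ z.2 * (speed u z.2 * f z i))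
      (w := fun z => κ z.2 * w z i) (hp i) hwi (hw' i) ?_
    intro ζ h1 h2 h3
    filter_upwards [H ζ h1 h2 h3, slice_source hω0 hf, slice_target hw] with v hv i1 i2
    have hd : Continuous (deriv ζ) := h1.continuous_deriv (by simp)
    have m1 : MemLp (deriv ζ) 2 (volume.restrict (Ioi (0 : ℝ))) :=
      (hd.memLp_of_hasCompactSupport h2.deriv).restrict _
    have m2 : MemLp ζ 2 (volume.restrict (Ioi (0 : ℝ))) :=
      (h1.continuous.memLp_of_hasCompactSupport h2).restrict _
    have hI : Integrable (fun x => deriv ζ x • speed u v • f (x, v) + ζ x • w (x, v))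
        (volume.restrict (Ioi (0 : ℝ))) :=
      (integrable_smul_of_memLp m1 (i1.const_smul (speed u v))).add
        (integrable_smul_of_memLp m2 i2)
    have e1 := (EuclideanSpace.proj i : Val m →L[ℝ] ℝ).integral_comp_comm hI
    rw [hv, map_zero] at e1
    have e2 := congrArg (fun r => κ v * r) e1
    simp only [mul_zero, ← integral_const_mul] at e2
    refine Eq.trans (integral_congr_ae (ae_of_all _ fun x => ?_)) e2
    simp only [PiLp.proj_apply, PiLp.add_apply, PiLp.smul_apply, smul_eq_mul]
    ring
  choose c hcm hc using hex
  -- The constants `c` are the initial values of `κ (v₁ + u) f`, componentwise; dividing by `κ (v₁ +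
  -- u)` yields the trace.
  refine ⟨fun v => WithLp.toLp 2 fun i => (κ v * speed u v)⁻¹ * c i v, ?_, ?_⟩
  · have : AEMeasurable (fun v i => (κ v * speed u v)⁻¹ * c i v) (dv 𝕍) :=
      aemeasurable_pi_lambda _ fun i =>
        ((hκm.mul hbm).inv.aemeasurable.mul (hcm i).aemeasurable)
    exact ((PiLp.continuous_toLp 2 _).measurable.comp_aemeasurable this).aestronglyMeasurable
  · have hc' : ∀ᵐ v ∂dv 𝕍, ∀ i, IsPrimitive (fun x => κ v * (speed u v * f (x, v) i))
        (fun x => κ v * w (x, v) i) (c i v) := ae_all_iff.2 hc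
    filter_upwards [hc', speed_ne_zero_ae 𝕍 u, slice_target hw] with v hv hb i2
    have hv' : ∀ᵐ x ∂volume.restrict (Ioi (0 : ℝ)), ∀ i, κ v * (speed u v * f (x, v) i) =
      c i v + ∫ t in (0 : ℝ)..x, κ v * w (t, v) i := ae_all_iff.2 hv
    filter_upwards [hv', ae_restrict_mem measurableSet_Ioi] with x hx hx0
    ext i
    have e3 := (EuclideanSpace.proj i : Val m →L[ℝ] ℝ).intervalIntegral_comp_comm
      (intervalIntegrable_of_memLp_Ioi i2 (le_of_lt hx0))
    simp only [PiLp.proj_apply] at e3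
    have e4 := hx i
    have hk := (hκpos v).ne'
    rw [intervalIntegral.integral_const_mul] at e4
    simp only [PiLp.add_apply, PiLp.smul_apply, smul_eq_mul]
    rw [← e3]
    apply mul_left_cancel₀ hk
    rw [e4]
    field_simp

/-- Tests supported away from `x = 0` do not see the boundary term. At this stage the initial value
is some `f₁`, not yet identified with `f₀`. -/
lemma HasTransport.exists_isTransport {f w : ℝ × Vel d → Val m} {f₀ : Vel d → Val m}
    (hω0 : 0 ≤ ω₀)
    (hf : MemWL2 (fun z => weight ω₀ z.2) f (dxdv 𝕍))
    (hw : MemWL2 (fun z => (weight ω₀ z.2)⁻¹) w (dxdv 𝕍))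
    (h : HasTransport 𝕍 u f w f₀) :
    ∃ f₁ : Vel d → Val m, AEStronglyMeasurable f₁ (dv 𝕍) ∧ IsTransport 𝕍 u f w f₁ := by
  refine HalfSpace.exists_isTransport hω0 hf hw fun ζ h1 h2 h3 => ?_
  refine ae_test_eq_zero hω0 hf hw h1 h2 fun χ h4 h5 e => ?_
  have hζ0 : ζ 0 = 0 := image_eq_zero_of_notMem_tsupport fun hh => lt_irrefl (0 : ℝ) (h3 hh)
  have := h.2 (fun z => (ζ z.1 * χ z.2) • e)
    (((h1.comp contDiff_fst).mul (h4.comp contDiff_snd)).smul contDiff_const)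
    (by
      refine HasCompactSupport.of_support_subset_isCompact
        (h2.isCompact.prod h5.isCompact) fun z hz => ?_
      refine ⟨subset_tsupport _ fun h => hz ?_, subset_tsupport _ fun h => hz ?_⟩
      · simp [h]
      · simp [h])
  simp only [hζ0, zero_mul, zero_smul, inner_zero_right, mul_zero, integral_zero, neg_zero] at this
  refine Eq.trans (integral_congr_ae (ae_of_all _ fun z => ?_)) this
  have hd : deriv (fun t => (ζ t * χ z.2) • e) z.1 = (deriv ζ z.1 * χ z.2) • e :=
    ((((h1.differentiable (by simp)) z.1).hasDerivAt.mul_const _).smul_const e).deriv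
  simp only [hd, inner_smul_left, inner_smul_right, inner_add_left, RCLike.conj_to_real]
  ring

end Transport

section Transport

variable {d m : ℕ} [NeZero d] {𝕍 : Set (Vel d)} {ω₀ u : ℝ}

lemma integrable_test_trace {f₀ : Vel d → Val m}
    (h : MemWL2 (fun v => |speed u v|) f₀ (dv 𝕍)) {χ : Vel d → ℝ} (h3 : Continuous χ)
    (h4 : HasCompactSupport χ) :
    Integrable (fun v => χ v • speed u v • f₀ v) (dv 𝕍) := by
  have hbm : Measurable (speed u : Vel d → ℝ) := (continuous_speed u).measurable
  have hm : AEStronglyMeasurable f₀ (dv 𝕍) :=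
    h.aestronglyMeasurable_of_pos hbm.abs
      ((speed_ne_zero_ae 𝕍 u).mono fun v hv => abs_pos.2 hv)
  have h1 : MemLp (fun v => χ v * Real.sqrt |speed u v|) 2 (dv 𝕍) := by
    have hc : Continuous fun v : Vel d => χ v * Real.sqrt |speed u v| :=
      h3.mul (continuous_speed u).abs.sqrt
    exact (hc.memLp_of_hasCompactSupport (HasCompactSupport.mul_right
      (f' := fun v : Vel d => Real.sqrt |speed u v|) h4)).restrict _
  refine (integrable_smul_of_memLp h1 h).mono
    (h3.measurable.aestronglyMeasurable.smul (hbm.aestronglyMeasurable.smul hm))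
    (ae_of_all _ fun v => le_of_eq ?_)
  simp only [norm_smul, norm_mul, Real.norm_of_nonneg (Real.sqrt_nonneg _), Real.norm_eq_abs]
  nth_rewrite 1 [← Real.mul_self_sqrt (abs_nonneg (speed u v))]
  ring

/-- The fundamental lemma identifies the functions `(v₁ + u) f₀` and `(v₁ + u) f₁`, which are
locally integrable, and the speed is nonzero almost everywhere. -/
lemma trace_ae_eq_of_test {f₀ f₁ : Vel d → Val m}
    (h₀ : MemWL2 (fun v => |speed u v|) f₀ (dv 𝕍))
    (h₁ : MemWL2 (fun v => |speed u v|) f₁ (dv 𝕍))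
    (H : ∀ χ : Vel d → ℝ, ContDiff ℝ ∞ χ → HasCompactSupport χ → ∀ e : Val m,
      ∫ v, speed u v * ⟪f₀ v, χ v • e⟫_ℝ ∂dv 𝕍 = ∫ v, speed u v * ⟪f₁ v, χ v • e⟫_ℝ ∂dv 𝕍) :
    f₀ =ᵐ[dv 𝕍] f₁ := by
  have hz : ∀ᵐ v ∂dv 𝕍, speed u v • f₀ v = speed u v • f₁ v := by
    refine ae_eq_of_integral_contDiff_smul_eq
      (locallyIntegrable_of_test fun χ h3 h4 => integrable_test_trace h₀ h3 h4)
      (locallyIntegrable_of_test fun χ h3 h4 => integrable_test_trace h₁ h3 h4)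
      fun χ h3 h4 => ext_inner_left ℝ fun e => ?_
    have e0 := (innerSL ℝ e).integral_comp_comm
      (integrable_test_trace h₀ h3.continuous h4)
    have e1 := (innerSL ℝ e).integral_comp_comm
      (integrable_test_trace h₁ h3.continuous h4)
    simp only [innerSL_apply_apply] at e0 e1
    rw [← e0, ← e1]
    refine Eq.trans (integral_congr_ae (ae_of_all _ fun v => ?_))
      ((H χ h3 h4 e).trans (integral_congr_ae (ae_of_all _ fun v => ?_)))
    · simp only [inner_smul_right, real_inner_comm e]; ring
    · simp only [inner_smul_right, real_inner_comm e]; ring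
  filter_upwards [hz, speed_ne_zero_ae 𝕍 u] with v h1 h2
  exact smul_right_injective _ h2 h1

lemma exists_test_one : ∃ ζ : ℝ → ℝ, ContDiff ℝ ∞ ζ ∧ HasCompactSupport ζ ∧ ζ 0 = 1 := by
  let b : ContDiffBump (0 : ℝ) := ⟨1, 2, by norm_num, by norm_num⟩
  exact ⟨b, b.contDiff, b.hasCompactSupport, b.one_of_mem_closedBall (by simp [b.rIn_pos.le])⟩

lemma contDiff_tensor {ζ : ℝ → ℝ} {χ : Vel d → ℝ} (h1 : ContDiff ℝ ∞ ζ) (h2 : ContDiff ℝ ∞ χ)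
    (e : Val m) : ContDiff ℝ ∞ (fun z : ℝ × Vel d => (ζ z.1 * χ z.2) • e) :=
  ((h1.comp contDiff_fst).mul (h2.comp contDiff_snd)).smul contDiff_const

lemma hasCompactSupport_tensor {ζ : ℝ → ℝ} {χ : Vel d → ℝ} (h1 : HasCompactSupport ζ)
    (h2 : HasCompactSupport χ) (e : Val m) :
    HasCompactSupport (fun z : ℝ × Vel d => (ζ z.1 * χ z.2) • e) := by
  refine HasCompactSupport.of_support_subset_isCompact
    (h1.isCompact.prod h2.isCompact) fun z hz => ?_
  refine ⟨subset_tsupport _ fun h => hz ?_, subset_tsupport _ fun h => hz ?_⟩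
  · simp [h]
  · simp [h]

/-- Both boundary integrals equal the same volume integral; a cut-off in `x` with value `1` at `0`
leaves arbitrary tests in `v`. -/
lemma HasTransport.trace_unique {f w : ℝ × Vel d → Val m} {f₀ f₁ : Vel d → Val m}
    (h₀ : HasTransport 𝕍 u f w f₀) (h₁ : HasTransport 𝕍 u f w f₁) : f₀ =ᵐ[dv 𝕍] f₁ := by
  refine trace_ae_eq_of_test h₀.1 h₁.1 fun χ h3 h4 e => ?_
  obtain ⟨ζ, hζ1, hζ2, hζ3⟩ := exists_test_one
  have e0 := h₀.2 _ (contDiff_tensor hζ1 h3 e) (hasCompactSupport_tensor hζ2 h4 e)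
  have e1 := h₁.2 _ (contDiff_tensor hζ1 h3 e) (hasCompactSupport_tensor hζ2 h4 e)
  rw [e0] at e1
  simpa [hζ3] using e1

lemma IsTransport.congr_trace {f w : ℝ × Vel d → Val m} {f₀ f₁ : Vel d → Val m}
    (h : IsTransport 𝕍 u f w f₀) (he : f₀ =ᵐ[dv 𝕍] f₁) : IsTransport 𝕍 u f w f₁ := by
  filter_upwards [h, he] with v h1 h2
  rwa [← h2]

/-- The initial value constructed on lines also satisfies Green's formula, so uniqueness of the
trace identifies it with `f₀`. -/
lemma HasTransport.isTransport {f w : ℝ × Vel d → Val m} {f₀ : Vel d → Val m}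
    (hω0 : 0 ≤ ω₀)
    (hf : MemWL2 (fun z => weight ω₀ z.2) f (dxdv 𝕍))
    (hw : MemWL2 (fun z => (weight ω₀ z.2)⁻¹) w (dxdv 𝕍))
    (h : HasTransport 𝕍 u f w f₀) : IsTransport 𝕍 u f w f₀ := by
  obtain ⟨f₁, hm, h1⟩ := h.exists_isTransport hω0 hf hw
  exact h1.congr_trace ((h1.hasTransport hω0 hf hw hm).trace_unique h)

lemma MemWL2.aestronglyMeasurable_trace {f₀ : Vel d → Val m}
    (h : MemWL2 (fun v => |speed u v|) f₀ (dv 𝕍)) : AEStronglyMeasurable f₀ (dv 𝕍) :=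
  h.aestronglyMeasurable_of_pos (continuous_speed u).abs.measurable
    ((speed_ne_zero_ae 𝕍 u).mono fun _ hv => abs_pos.2 hv)

/-- `f₀, g₀ ∈ L²(|v₁ + u| dv)` have an integrable flux. -/
lemma MemWL2.integrable_flux {f₀ g₀ : Vel d → Val m}
    (h₀ : MemWL2 (fun v => |speed u v|) f₀ (dv 𝕍))
    (h₁ : MemWL2 (fun v => |speed u v|) g₀ (dv 𝕍)) :
    Integrable (fun v => speed u v * ⟪f₀ v, g₀ v⟫_ℝ) (dv 𝕍) := by
  refine (integrable_inner h₀ h₁).mono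
    ((continuous_speed u).measurable.aestronglyMeasurable.mul
      (h₀.aestronglyMeasurable_trace.inner h₁.aestronglyMeasurable_trace))
    (ae_of_all _ fun v => le_of_eq ?_)
  simp only [inner_smul_left, inner_smul_right, RCLike.conj_to_real, ← mul_assoc,
    Real.mul_self_sqrt (abs_nonneg _), norm_mul, Real.norm_eq_abs, abs_abs]

/-- The density `|v₁ + u| |Z|²` is the modulus of the dual pairing of `Z ∈ L²(a dv)` with `(v₁ + u)
Z ∈ L²(a⁻¹ dv)`. -/
lemma memWL2_speed_of_dual {Z : Vel d → Val m}
    (h1 : MemWL2 (weight ω₀) Z (dv 𝕍))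
    (h2 : MemWL2 (fun v => (weight ω₀ v)⁻¹) (fun v => speed u v • Z v) (dv 𝕍)) :
    MemWL2 (fun v => |speed u v|) Z (dv 𝕍) := by
  have hm := h1.aestronglyMeasurable_of_pos (measurable_weight ω₀)
    (ae_of_all _ fun v => weight_pos ω₀ v)
  rw [memWL2_iff_integrable hm (continuous_speed u).abs.measurable fun v => abs_nonneg _]
  refine (h1.inner_integrable (weight_pos ω₀) h2).norm.congr (ae_of_all _ fun v => ?_)
  simp [inner_smul_right]

lemma flux_eq_inner (Z h : Vel d → Val m) :
    flux 𝕍 u Z h = ∫ v, ⟪(Real.sqrt (weight ω₀ v)⁻¹) • speed u v • Z v,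
      Real.sqrt (weight ω₀ v) • h v⟫_ℝ ∂dv 𝕍 := by
  refine integral_congr_ae (ae_of_all _ fun v => ?_)
  have := (Real.sqrt_pos.2 (weight_pos ω₀ v)).ne'
  simp only [inner_smul_left, inner_smul_right, RCLike.conj_to_real, Real.sqrt_inv]
  field_simp

lemma integral_eq_inner (Z h : Vel d → Val m) :
    ∫ v, ⟪Z v, h v⟫_ℝ ∂dv 𝕍 = ∫ v, ⟪(Real.sqrt (weight ω₀ v)) • Z v,
      Real.sqrt (weight ω₀ v)⁻¹ • h v⟫_ℝ ∂dv 𝕍 := by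
  refine integral_congr_ae (ae_of_all _ fun v => ?_)
  have := (Real.sqrt_pos.2 (weight_pos ω₀ v)).ne'
  simp only [inner_smul_left, inner_smul_right, RCLike.conj_to_real, Real.sqrt_inv]
  field_simp

/-- The moments `⟨(v₁ + u) Z, f⟩` are primitives. -/
lemma IsTransport.moment {f w : ℝ × Vel d → Val m} {f₀ Z : Vel d → Val m}
    (hf : MemWL2 (fun z => weight ω₀ z.2) f (dxdv 𝕍))
    (hw : MemWL2 (fun z => (weight ω₀ z.2)⁻¹) w (dxdv 𝕍))
    (h : IsTransport 𝕍 u f w f₀) (h₀ : MemWL2 (fun v => |speed u v|) f₀ (dv 𝕍))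
    (h1 : MemWL2 (weight ω₀) Z (dv 𝕍))
    (h2 : MemWL2 (fun v => (weight ω₀ v)⁻¹) (fun v => speed u v • Z v) (dv 𝕍)) :
    MemLp (fun x => flux 𝕍 u Z (fun v => f (x, v))) 2 (volume.restrict (Ioi (0 : ℝ))) ∧
    MemLp (fun x => ∫ v, ⟪Z v, w (x, v)⟫_ℝ ∂dv 𝕍) 2 (volume.restrict (Ioi (0 : ℝ))) ∧
    IsPrimitive (fun x => flux 𝕍 u Z (fun v => f (x, v)))
      (fun x => ∫ v, ⟪Z v, w (x, v)⟫_ℝ ∂dv 𝕍) (flux 𝕍 u Z f₀) := by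
  refine ⟨?_, ?_, ?_⟩
  · simp only [flux_eq_inner (ω₀ := ω₀)]
    exact memLp_integral_inner
      (q := fun v => Real.sqrt (weight ω₀ v)⁻¹ • speed u v • Z v)
      (f := fun z => Real.sqrt (weight ω₀ z.2) • f z) h2 hf
  · simp only [integral_eq_inner (ω₀ := ω₀) Z]
    exact memLp_integral_inner (q := fun v => Real.sqrt (weight ω₀ v) • Z v)
      (f := fun z => Real.sqrt (weight ω₀ z.2)⁻¹ • w z) h1 hw
  have hfm := hf.aestronglyMeasurable_of_pos (measurable_weight_snd ω₀)
    (ae_of_all _ fun z => weight_pos ω₀ z.2)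
  have hwm := hw.aestronglyMeasurable_of_pos (measurable_weight_snd ω₀).inv
    (ae_of_all _ fun z => inv_pos.2 (weight_pos ω₀ z.2))
  have hbm : AEStronglyMeasurable (fun z : ℝ × Vel d => speed u z.2) (dxdv 𝕍) :=
    ((continuous_speed u).measurable.comp measurable_snd).aestronglyMeasurable
  -- The identity on almost every line becomes one for almost every `(x, v)`, so that for almost
  -- every fixed `x` it can be paired with `Z` and integrated over `v`.
  have hae : (fun z => speed u z.2 • f z) =ᵐ[dxdv 𝕍]
      fun z => speed u z.2 • f₀ z.2 + ∫ t in (0 : ℝ)..z.1, w (t, z.2) :=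
    ae_eq_prod_of_ae_ae (hbm.smul hfm)
      ((hbm.smul (h₀.aestronglyMeasurable_trace.comp_snd)).add
        (aestronglyMeasurable_primitive hwm)) h
  have hZb := memWL2_speed_of_dual h1 h2
  have hwslice := slice_target hw
  have hprod : ∀ T : ℝ, Integrable (fun z : ℝ × Vel d => ⟪Z z.2, w z⟫_ℝ)
      ((volume.restrict (Ioc (0 : ℝ) T)).prod (dv 𝕍)) := by
    intro T
    have i1 : MemWL2 (fun z : ℝ × Vel d => weight ω₀ z.2) (fun z => Z z.2)
        ((volume.restrict (Ioc (0 : ℝ) T)).prod (dv 𝕍)) :=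
      MemLp.comp_snd (f := fun v => Real.sqrt (weight ω₀ v) • Z v) h1 _
    have i2 : MemWL2 (fun z : ℝ × Vel d => (weight ω₀ z.2)⁻¹) w
        ((volume.restrict (Ioc (0 : ℝ) T)).prod (dv 𝕍)) :=
      MemLp.mono_measure (Measure.prod_mono
        (Measure.restrict_mono Ioc_subset_Ioi_self le_rfl) le_rfl) hw
    exact i1.inner_integrable (fun z => weight_pos ω₀ z.2) i2
  filter_upwards [Measure.ae_ae_of_ae_prod hae, ae_restrict_mem measurableSet_Ioi] with x hx hx0
  have hx0' : (0 : ℝ) ≤ x := le_of_lt hx0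
  have e1 : ∀ᵐ v ∂dv 𝕍, speed u v * ⟪Z v, f (x, v)⟫_ℝ =
      speed u v * ⟪Z v, f₀ v⟫_ℝ + ∫ t in Ioc 0 x, ⟪Z v, w (t, v)⟫_ℝ := by
    filter_upwards [hx, hwslice] with v hv hv2
    have i1 := intervalIntegrable_of_memLp_Ioi hv2 hx0'
    have e2 := (innerSL ℝ (Z v)).intervalIntegral_comp_comm i1
    simp only [innerSL_apply_apply] at e2
    rw [← intervalIntegral.integral_of_le hx0', e2, ← inner_smul_right, ← inner_smul_right,
      ← inner_add_right, ← hv]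
  rw [flux, integral_congr_ae e1, integral_add (hZb.integrable_flux h₀)
    ((hprod x).integral_prod_right), intervalIntegral.integral_of_le hx0', flux]
  congr 1
  exact (integral_integral_swap (hprod x)).symm

end Transport

lemma MemWL2.memLp_smul {Z F : Type*} [MeasurableSpace Z] [NormedAddCommGroup F]
    [InnerProductSpace ℝ F] {ρ : Z → ℝ} {f : Z → F} {μ : Measure Z} (hf : MemWL2 ρ f μ) :
    MemLp (fun z => Real.sqrt (ρ z) • f z) 2 μ := hf

/-- The element `√ρ f` of `L²` that represents `f ∈ L²(ρ dμ)`. -/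
def MemWL2.toL2 {Z F : Type*} [MeasurableSpace Z] [NormedAddCommGroup F] [InnerProductSpace ℝ F]
    {ρ : Z → ℝ} {f : Z → F} {μ : Measure Z} (hf : MemWL2 ρ f μ) : Lp F 2 μ :=
  MemLp.toLp _ hf.memLp_smul

section

variable {Z F : Type*} [MeasurableSpace Z] [NormedAddCommGroup F] [InnerProductSpace ℝ F]
  {ρ : Z → ℝ} {f g : Z → F} {μ : Measure Z}

lemma MemWL2.coeFn_toL2 (hf : MemWL2 ρ f μ) : hf.toL2 =ᵐ[μ] fun z => Real.sqrt (ρ z) • f z :=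
  MemLp.coeFn_toLp hf.memLp_smul

lemma MemWL2.inner_toL2 (hρ : ∀ z, 0 < ρ z) (hf : MemWL2 ρ f μ)
    (hg : MemWL2 (fun z => (ρ z)⁻¹) g μ) : ⟪hf.toL2, hg.toL2⟫_ℝ = ∫ z, ⟪f z, g z⟫_ℝ ∂μ := by
  rw [MemWL2.toL2, MemWL2.toL2, inner_toLp]
  refine integral_congr_ae (ae_of_all _ fun z => ?_)
  have := (Real.sqrt_pos.2 (hρ z)).ne'
  simp only [inner_smul_left, inner_smul_right, Real.sqrt_inv, RCLike.conj_to_real]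
  field_simp

lemma MemWL2.norm_toL2_sq (hρ : ∀ z, 0 ≤ ρ z) (hf : MemWL2 ρ f μ) :
    ‖hf.toL2‖ ^ 2 = ∫ z, ρ z * ‖f z‖ ^ 2 ∂μ := by
  rw [← real_inner_self_eq_norm_sq, MemWL2.toL2, inner_toLp]
  refine integral_congr_ae (ae_of_all _ fun z => ?_)
  simp only [real_inner_self_eq_norm_sq, norm_smul, mul_pow,
    Real.norm_of_nonneg (Real.sqrt_nonneg _), Real.sq_sqrt (hρ z)]

lemma inner_eq_integral (F₁ F₂ : Lp F 2 μ) : ⟪F₁, F₂⟫_ℝ = ∫ z, ⟪F₁ z, F₂ z⟫_ℝ ∂μ := rfl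

end

/-! ### The bounded operator `a^{-1/2} L a^{-1/2}` -/

section Multiplication

variable {d m : ℕ} {𝕍 : Set (Vel d)}

/-- A multiplier: a measurable function bounded by one. -/
def IsMultiplier (g : Vel d → ℝ) : Prop := Measurable g ∧ ∀ v, |g v| ≤ 1

lemma IsMultiplier.memLp {g : Vel d → ℝ} (hg : IsMultiplier g) (F : L2v 𝕍 m) :
    MemLp (fun v => g v • F v) 2 (dv 𝕍) :=
  (Lp.memLp F).mono (hg.1.aestronglyMeasurable.smul (Lp.aestronglyMeasurable F))
    (ae_of_all _ fun v => by
      rw [norm_smul]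
      exact mul_le_of_le_one_left (norm_nonneg _) (hg.2 v))

/-- Multiplication by a multiplier on `(L²(dv))ᵐ`. -/
def mulOp {g : Vel d → ℝ} (hg : IsMultiplier g) : L2v 𝕍 m →L[ℝ] L2v 𝕍 m :=
  LinearMap.mkContinuous
    { toFun := fun F => (hg.memLp F).toLp _
      map_add' := fun F G => by
        rw [← MemLp.toLp_add]
        apply MemLp.toLp_congr
        filter_upwards [Lp.coeFn_add F G] with v hv
        rw [hv]
        simp
      map_smul' := fun c F => by
        rw [RingHom.id_apply, ← MemLp.toLp_const_smul]
        apply MemLp.toLp_congr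
        filter_upwards [Lp.coeFn_smul c F] with v hv
        rw [hv]
        simp [smul_comm c] } 1 fun F => by
    refine Lp.norm_le_mul_norm_of_ae_le_mul (f := (hg.memLp F).toLp _) ?_
    filter_upwards [(hg.memLp F).coeFn_toLp] with v hv
    rw [hv, norm_smul]
    exact mul_le_mul_of_nonneg_right (hg.2 v) (norm_nonneg _)

lemma mulOp_coe {g : Vel d → ℝ} (hg : IsMultiplier g) (F : L2v 𝕍 m) :
    mulOp hg F =ᵐ[dv 𝕍] fun v => g v • F v :=
  (hg.memLp F).coeFn_toLp

lemma mulOp_inner {g : Vel d → ℝ} (hg : IsMultiplier g) (F G : L2v 𝕍 m) :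
    ⟪mulOp hg F, G⟫_ℝ = ⟪F, mulOp hg G⟫_ℝ := by
  rw [inner_eq_integral, inner_eq_integral]
  refine integral_congr_ae ?_
  filter_upwards [mulOp_coe hg F, mulOp_coe hg G] with v h1 h2
  rw [h1, h2, inner_smul_left, inner_smul_right]; rfl

lemma mulOp_injective {g : Vel d → ℝ} (hg : IsMultiplier g) (h0 : ∀ᵐ v ∂dv 𝕍, g v ≠ 0)
    {F : L2v 𝕍 m} (h : mulOp hg F = 0) : F = 0 := by
  rw [Lp.eq_zero_iff_ae_eq_zero] at h ⊢
  filter_upwards [mulOp_coe hg F, h, h0] with v h1 h2 h3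
  rw [h1] at h2
  exact (smul_eq_zero.1 h2).resolve_left h3

lemma isMultiplier_sqrt_inv {ω₀ : ℝ} (hω0 : 0 ≤ ω₀) :
    IsMultiplier (fun v : Vel d => Real.sqrt (weight ω₀ v)⁻¹) := by
  refine ⟨(measurable_weight ω₀).inv.sqrt, fun v => ?_⟩
  rw [abs_of_nonneg (Real.sqrt_nonneg _)]
  exact Real.sqrt_le_one.2 (inv_le_one_of_one_le₀ (one_le_weight hω0 v))

end Multiplication

section Operator

variable {d m : ℕ} [NeZero d] {𝕍 : Set (Vel d)} {ω₀ u : ℝ} {L : L2v 𝕍 m →ₗ.[ℝ] L2v 𝕍 m}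

lemma sqrt_weight_mul_inv (ω₀ : ℝ) (v : Vel d) :
    Real.sqrt (weight ω₀ v) * Real.sqrt (weight ω₀ v)⁻¹ = 1 := by
  rw [Real.sqrt_inv]
  exact mul_inv_cancel₀ (Real.sqrt_pos.2 (weight_pos ω₀ v)).ne'

lemma CollisionOperator.memWL2 (hω0 : 0 ≤ ω₀) (hL : CollisionOperator ω₀ u L) {f : L2v 𝕍 m}
    (hf : f ∈ L.domain) : MemWL2 (weight ω₀) f (dv 𝕍) := by
  have h1 := (hL.mem_domain f).1 hf
  refine h1.mono ((measurable_weight ω₀).sqrt.aestronglyMeasurable.smul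
    (Lp.aestronglyMeasurable f)) (ae_of_all _ fun v => ?_)
  rw [norm_smul, norm_smul, Real.norm_of_nonneg (Real.sqrt_nonneg _),
    Real.norm_of_nonneg (weight_pos ω₀ v).le]
  gcongr
  rw [Real.sqrt_le_left (weight_pos ω₀ v).le]
  nlinarith [one_le_weight hω0 v]

/-- The map `ψ ↦ √a ψ` on `D(L)`. -/
def scaleUp (hω0 : 0 ≤ ω₀) (hL : CollisionOperator ω₀ u L) : L.domain →ₗ[ℝ] L2v 𝕍 m where
  toFun ψ := (hL.memWL2 hω0 ψ.2).toL2
  map_add' f g := by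
    rw [MemWL2.toL2, MemWL2.toL2, MemWL2.toL2, ← MemLp.toLp_add]
    apply MemLp.toLp_congr
    filter_upwards [Lp.coeFn_add (f : L2v 𝕍 m) (g : L2v 𝕍 m)] with v hv
    rw [Submodule.coe_add, hv]
    simp
  map_smul' c f := by
    rw [RingHom.id_apply, MemWL2.toL2, MemWL2.toL2, ← MemLp.toLp_const_smul]
    apply MemLp.toLp_congr
    filter_upwards [Lp.coeFn_smul c (f : L2v 𝕍 m)] with v hv
    rw [Submodule.coe_smul, hv]
    simp [smul_comm c]

/-- The map `F ↦ F / √a` on `(L²(dv))ᵐ`. -/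
def scaleDown (hω0 : 0 ≤ ω₀) : L2v 𝕍 m →L[ℝ] L2v 𝕍 m := mulOp (isMultiplier_sqrt_inv hω0)

lemma scaleDown_coe (hω0 : 0 ≤ ω₀) (F : L2v 𝕍 m) :
    scaleDown hω0 F =ᵐ[dv 𝕍] fun v => Real.sqrt (weight ω₀ v)⁻¹ • F v := mulOp_coe _ F

lemma scaleDown_injective (hω0 : 0 ≤ ω₀) {F : L2v 𝕍 m} (h : scaleDown hω0 F = 0) : F = 0 :=
  mulOp_injective _ (ae_of_all _ fun v =>
    (Real.sqrt_pos.2 (inv_pos.2 (weight_pos ω₀ v))).ne') h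

lemma scaleUp_coe (hω0 : 0 ≤ ω₀) (hL : CollisionOperator ω₀ u L) (ψ : L.domain) :
    scaleUp hω0 hL ψ =ᵐ[dv 𝕍] fun v => Real.sqrt (weight ω₀ v) • (ψ : L2v 𝕍 m) v :=
  (hL.memWL2 hω0 ψ.2).coeFn_toL2

lemma scaleDown_scaleUp (hω0 : 0 ≤ ω₀) (hL : CollisionOperator ω₀ u L) (ψ : L.domain) :
    scaleDown hω0 (scaleUp hω0 hL ψ) = ψ := by
  refine Lp.ext ?_
  filter_upwards [scaleDown_coe hω0 (scaleUp hω0 hL ψ), scaleUp_coe hω0 hL ψ] with v h1 h2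
  rw [h1, h2, smul_smul, mul_comm, sqrt_weight_mul_inv, one_smul]

/-- If `G` is orthogonal to `√a D(L)`, pairing it with `√a ψ` for `ψ = a^{-3/2} G` gives `‖a^{-1/2}
G‖² = 0`. -/
lemma denseRange_scaleUp (hω0 : 0 ≤ ω₀) (hL : CollisionOperator ω₀ u L) :
    DenseRange (scaleUp hω0 hL) := by
  have : (LinearMap.range (scaleUp hω0 hL)).topologicalClosure = ⊤ := by
    rw [Submodule.topologicalClosure_eq_top_iff, Submodule.eq_bot_iff]
    intro G hG
    set ψ := scaleDown hω0 (scaleDown hω0 (scaleDown hω0 G)) with hψ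
    have hc : ψ =ᵐ[dv 𝕍] fun v => (Real.sqrt (weight ω₀ v)⁻¹) ^ 3 • G v := by
      filter_upwards [scaleDown_coe hω0 (scaleDown hω0 (scaleDown hω0 G)),
        scaleDown_coe hω0 (scaleDown hω0 G), scaleDown_coe hω0 G] with v h1 h2 h3
      rw [hψ, h1, h2, h3, smul_smul, smul_smul]; congr 1; ring
    -- Three factors `a^{-1/2}` suffice because `a ψ = a^{-1/2} G` is still in `L²`.
    have hdom : ψ ∈ L.domain := by
      rw [hL.mem_domain]
      refine MemLp.ae_eq ?_ (Lp.memLp (scaleDown hω0 G))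
      filter_upwards [hc, scaleDown_coe hω0 G] with v h1 h2
      rw [h1, h2, smul_smul]
      congr 1
      have := sqrt_weight_mul_inv ω₀ v
      have h3 := Real.mul_self_sqrt (weight_pos ω₀ v).le
      calc Real.sqrt (weight ω₀ v)⁻¹ = (Real.sqrt (weight ω₀ v) * Real.sqrt (weight ω₀ v)⁻¹) ^ 2 *
            Real.sqrt (weight ω₀ v)⁻¹ := by rw [this]; ring
        _ = (Real.sqrt (weight ω₀ v) * Real.sqrt (weight ω₀ v)) * Real.sqrt (weight ω₀ v)⁻¹ ^ 3 := by
            ring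
        _ = _ := by rw [h3]
    have h0 := (Submodule.mem_orthogonal' _ _).1 hG _
      (LinearMap.mem_range_self (scaleUp hω0 hL) ⟨ψ, hdom⟩)
    have h1 : ⟪scaleDown hω0 G, scaleDown hω0 G⟫_ℝ = 0 := by
      rw [← h0, inner_eq_integral, inner_eq_integral]
      refine integral_congr_ae ?_
      filter_upwards [hc, scaleDown_coe hω0 G, scaleUp_coe hω0 hL ⟨ψ, hdom⟩] with v h1 h2 h3
      rw [h2, h3, h1, inner_smul_left, inner_smul_right, inner_smul_right, inner_smul_right]
      have := sqrt_weight_mul_inv ω₀ v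
      simp only [RCLike.conj_to_real]
      linear_combination (-(Real.sqrt (weight ω₀ v)⁻¹ ^ 2 * ⟪G v, G v⟫_ℝ)) * this
    exact scaleDown_injective hω0 (inner_self_eq_zero.1 h1)
  rw [DenseRange, ← LinearMap.coe_range]
  exact (Submodule.dense_iff_topologicalClosure_eq_top).2 this

/-- The bounded operator `a^{-1/2} L a^{-1/2}` on `(L²(dv))ᵐ`. -/
def scaledOp (hω0 : 0 ≤ ω₀) (hL : CollisionOperator ω₀ u L) : L2v 𝕍 m →L[ℝ] L2v 𝕍 m :=
  LinearMap.extendOfNorm ((scaleDown hω0).toLinearMap ∘ₗ L.toFun) (scaleUp hω0 hL)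

lemma norm_scaleDown_le (hω0 : 0 ≤ ω₀) (hL : CollisionOperator ω₀ u L) :
    ∃ C, ∀ ψ : L.domain, ‖((scaleDown hω0).toLinearMap ∘ₗ L.toFun) ψ‖ ≤
      C * ‖scaleUp hω0 hL ψ‖ := by
  obtain ⟨σ, hσ, h⟩ := hL.bounded
  refine ⟨σ, fun ψ => ?_⟩
  refine abs_le_of_sq_le_sq' ?_ (by positivity) |>.2
  have h1 : ‖scaleUp hω0 hL ψ‖ ^ 2 = _ :=
    MemWL2.norm_toL2_sq (fun v => (weight_pos ω₀ v).le) (hL.memWL2 hω0 ψ.2)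
  have h2 : ‖((scaleDown hω0).toLinearMap ∘ₗ L.toFun) ψ‖ ^ 2 =
      ∫ v, (weight ω₀ v)⁻¹ * ‖L ψ v‖ ^ 2 ∂dv 𝕍 :=
    MemWL2.norm_toL2_sq (ρ := fun v => (weight ω₀ v)⁻¹) (f := L ψ)
      (fun v => (inv_pos.2 (weight_pos ω₀ v)).le)
      ((isMultiplier_sqrt_inv hω0).memLp (L ψ))
  rw [mul_pow, h1, h2]
  exact h ψ

lemma scaledOp_scaleUp (hω0 : 0 ≤ ω₀) (hL : CollisionOperator ω₀ u L) (ψ : L.domain) :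
    scaledOp hω0 hL (scaleUp hω0 hL ψ) = scaleDown hω0 (L ψ) :=
  LinearMap.extendOfNorm_eq (denseRange_scaleUp hω0 hL) (norm_scaleDown_le hω0 hL) ψ

lemma scaleDown_inner_scaleUp (hω0 : 0 ≤ ω₀) (hL : CollisionOperator ω₀ u L) (F : L2v 𝕍 m)
    (ψ : L.domain) : ⟪scaleDown hω0 F, scaleUp hω0 hL ψ⟫_ℝ = ⟪F, (ψ : L2v 𝕍 m)⟫_ℝ := by
  refine (mulOp_inner (isMultiplier_sqrt_inv hω0) F _).trans ?_
  rw [show mulOp (isMultiplier_sqrt_inv hω0) (scaleUp hω0 hL ψ) = ψ from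
    scaleDown_scaleUp hω0 hL ψ]

lemma symm_apply (hL : CollisionOperator ω₀ u L) (f g : L.domain) :
    ⟪L f, (g : L2v 𝕍 m)⟫_ℝ = ⟪(f : L2v 𝕍 m), L g⟫_ℝ := by
  have h := LinearPMap.adjoint_isFormalAdjoint hL.selfAdjoint.dense_domain
  rw [LinearPMap.isSelfAdjoint_def.1 hL.selfAdjoint] at h
  exact h f g

lemma scaledOp_symm (hω0 : 0 ≤ ω₀) (hL : CollisionOperator ω₀ u L) (F G : L2v 𝕍 m) :
    ⟪scaledOp hω0 hL F, G⟫_ℝ = ⟪F, scaledOp hω0 hL G⟫_ℝ := by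
  refine (denseRange_scaleUp hω0 hL).induction_on₂
    (p := fun F G => ⟪scaledOp hω0 hL F, G⟫_ℝ = ⟪F, scaledOp hω0 hL G⟫_ℝ)
    (isClosed_eq (by fun_prop) (by fun_prop)) (fun f g => ?_) F G
  rw [scaledOp_scaleUp, scaledOp_scaleUp, scaleDown_inner_scaleUp, symm_apply hL,
    real_inner_comm, ← scaleDown_inner_scaleUp hω0 hL, real_inner_comm]

end Operator

/-- Coercivity bounds `A` from below, so its range is closed; a vector `w` orthogonal to the range
satisfies `⟨A w, w⟩ = 0` and is zero. -/
lemma exists_apply_eq_of_coercive {H : Type*} [NormedAddCommGroup H] [InnerProductSpace ℝ H]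
    [CompleteSpace H] (A : H →L[ℝ] H) {c : ℝ} (hc : 0 < c)
    (h : ∀ x, c * ‖x‖ ^ 2 ≤ ⟪A x, x⟫_ℝ) (y : H) : ∃ x, A x = y := by
  have hb : ∀ x, c * ‖x‖ ≤ ‖A x‖ := by
    intro x
    rcases eq_or_ne x 0 with rfl | hx
    · simp
    · have := (h x).trans (real_inner_le_norm _ _)
      have hx' := norm_pos_iff.2 hx
      nlinarith
  have hanti : AntilipschitzWith (c⁻¹).toNNReal A := by
    refine ContinuousLinearMap.antilipschitz_of_bound A fun x => ?_
    rw [Real.coe_toNNReal _ (inv_pos.2 hc).le, ← div_eq_inv_mul, le_div_iff₀ hc, mul_comm]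
    exact hb x
  have hclosed : IsClosed (LinearMap.range A.toLinearMap : Set H) :=
    hanti.isClosed_range A.uniformContinuous
  have : CompleteSpace (LinearMap.range A.toLinearMap) := hclosed.completeSpace_coe
  have htop : LinearMap.range A.toLinearMap = ⊤ := by
    rw [← (LinearMap.range A.toLinearMap).orthogonal_orthogonal]
    rw [Submodule.eq_top_iff']
    intro v w hw
    have h0 : ⟪A w, w⟫_ℝ = 0 := hw _ ⟨w, rfl⟩
    have h1 := h w
    rw [h0] at h1
    have : ‖w‖ = 0 := by
      have h2 : ‖w‖ ^ 2 ≤ 0 := by nlinarith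
      exact pow_eq_zero_iff two_ne_zero |>.1 (le_antisymm h2 (sq_nonneg _))
    rw [norm_eq_zero.1 this, inner_zero_left]
  exact LinearMap.range_eq_top.1 htop y

section Operator

variable {d m : ℕ} [NeZero d] {𝕍 : Set (Vel d)} {ω₀ u : ℝ} {L : L2v 𝕍 m →ₗ.[ℝ] L2v 𝕍 m}

lemma mem_nullSpace_iff {f : L2v 𝕍 m} :
    f ∈ nullSpace L ↔ ∃ h : f ∈ L.domain, L ⟨f, h⟩ = 0 := by
  simp only [nullSpace, Submodule.mem_map, LinearMap.mem_ker]
  constructor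
  · rintro ⟨g, hg, rfl⟩
    exact ⟨g.2, hg⟩
  · rintro ⟨h, h0⟩
    exact ⟨⟨f, h⟩, h0, rfl⟩

lemma nullSpace_le_domain : nullSpace L ≤ L.domain := fun _ hf => (mem_nullSpace_iff.1 hf).1

lemma apply_null (p : nullSpace L) : L ⟨p, nullSpace_le_domain p.2⟩ = 0 :=
  (mem_nullSpace_iff.1 p.2).2

/-- `p ↦ √a p` on the null space. -/
def nullUp (hω0 : 0 ≤ ω₀) (hL : CollisionOperator ω₀ u L) : nullSpace L →L[ℝ] L2v 𝕍 m :=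
  haveI : FiniteDimensional ℝ (nullSpace L) := hL.finite_null
  LinearMap.toContinuousLinearMap
    (scaleUp hω0 hL ∘ₗ Submodule.inclusion (nullSpace_le_domain (L := L)))

lemma nullUp_apply (hω0 : 0 ≤ ω₀) (hL : CollisionOperator ω₀ u L) (p : nullSpace L) :
    nullUp hω0 hL p = scaleUp hω0 hL ⟨p, nullSpace_le_domain p.2⟩ := rfl

/-- The orthogonal projection onto the null space. -/
def nullProj (hL : CollisionOperator ω₀ u L) : L2v 𝕍 m →L[ℝ] nullSpace L :=
  haveI : FiniteDimensional ℝ (nullSpace L) := hL.finite_null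
  (nullSpace L).orthogonalProjectionOnto

lemma sub_nullProj_mem (hL : CollisionOperator ω₀ u L) (f : L2v 𝕍 m) :
    f - nullProj hL f ∈ (nullSpace L)ᗮ := by
  have : FiniteDimensional ℝ (nullSpace L) := hL.finite_null
  exact Submodule.sub_starProjection_mem_orthogonal (K := nullSpace L) f

lemma nullProj_of_mem (hL : CollisionOperator ω₀ u L) (p : nullSpace L) :
    nullProj hL p = p := by
  have : FiniteDimensional ℝ (nullSpace L) := hL.finite_null
  exact Submodule.orthogonalProjectionOnto_mem_subspace_eq_self p

lemma inner_nullProj (hL : CollisionOperator ω₀ u L) (p : nullSpace L) (f : L2v 𝕍 m) :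
    ⟪(p : L2v 𝕍 m), (nullProj hL f : L2v 𝕍 m)⟫_ℝ = ⟪(p : L2v 𝕍 m), f⟫_ℝ := by
  have := (Submodule.mem_orthogonal _ _).1 (sub_nullProj_mem hL f) p p.2
  rw [inner_sub_right] at this
  linarith

lemma nullProj_eq_zero_iff (hL : CollisionOperator ω₀ u L) (f : L2v 𝕍 m) :
    nullProj hL f = 0 ↔ f ∈ (nullSpace L)ᗮ := by
  have : FiniteDimensional ℝ (nullSpace L) := hL.finite_null
  exact Submodule.orthogonalProjectionOnto_eq_zero_iff

/-- `F ↦ √a P (F / √a)`. -/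
def scaledProj (hω0 : 0 ≤ ω₀) (hL : CollisionOperator ω₀ u L) : L2v 𝕍 m →L[ℝ] L2v 𝕍 m :=
  nullUp hω0 hL ∘L nullProj hL ∘L scaleDown hω0

lemma scaledProj_apply (hω0 : 0 ≤ ω₀) (hL : CollisionOperator ω₀ u L) (F : L2v 𝕍 m) :
    scaledProj hω0 hL F = nullUp hω0 hL (nullProj hL (scaleDown hω0 F)) := rfl

lemma scaleDown_nullUp (hω0 : 0 ≤ ω₀) (hL : CollisionOperator ω₀ u L) (p : nullSpace L) :
    scaleDown hω0 (nullUp hω0 hL p) = p := by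
  rw [nullUp_apply, scaleDown_scaleUp]

lemma scaledProj_nullUp (hω0 : 0 ≤ ω₀) (hL : CollisionOperator ω₀ u L) (p : nullSpace L) :
    scaledProj hω0 hL (nullUp hω0 hL p) = nullUp hω0 hL p := by
  rw [scaledProj_apply, scaleDown_nullUp, nullProj_of_mem]

lemma scaledOp_nullUp (hω0 : 0 ≤ ω₀) (hL : CollisionOperator ω₀ u L) (p : nullSpace L) :
    scaledOp hω0 hL (nullUp hω0 hL p) = 0 := by
  rw [nullUp_apply, scaledOp_scaleUp, apply_null, map_zero]

/-- Both sides are continuous in `F`, so it suffices to check the dense set `√a D(L)`, where this is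
the spectral gap of `L`. The operator `scaledProj` is idempotent, but it is not claimed to be an
orthogonal projection; only its continuity is needed for the density argument. -/
lemma scaledOp_gap (hω0 : 0 ≤ ω₀) (hL : CollisionOperator ω₀ u L) :
    ∃ σ > 0, ∀ F : L2v 𝕍 m,
      σ * ‖F - scaledProj hω0 hL F‖ ^ 2 ≤ ⟪scaledOp hω0 hL F, F⟫_ℝ := by
  obtain ⟨σ, hσ, h⟩ := hL.gap
  refine ⟨σ, hσ, fun F => ?_⟩
  refine (denseRange_scaleUp hω0 hL).induction_on
    (p := fun F => σ * ‖F - scaledProj hω0 hL F‖ ^ 2 ≤ ⟪scaledOp hω0 hL F, F⟫_ℝ) F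
    (isClosed_le (by fun_prop) (by fun_prop)) fun ψ => ?_
  have h1 := h ψ (nullProj hL (ψ : L2v 𝕍 m)) (nullProj hL (ψ : L2v 𝕍 m)).2
    (sub_nullProj_mem hL ψ)
  rw [scaledOp_scaleUp, scaleDown_inner_scaleUp, real_inner_comm]
  refine le_trans (le_of_eq ?_) h1
  have e1 : scaleUp hω0 hL ψ - scaledProj hω0 hL (scaleUp hω0 hL ψ) =
      scaleUp hω0 hL (ψ - ⟨nullProj hL (ψ : L2v 𝕍 m),
        nullSpace_le_domain (nullProj hL (ψ : L2v 𝕍 m)).2⟩) := by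
    rw [scaledProj_apply, scaleDown_scaleUp, nullUp_apply, map_sub]
  rw [e1]
  congr 1
  exact MemWL2.norm_toL2_sq (fun v => (weight_pos ω₀ v).le) (hL.memWL2 hω0 (Subtype.prop _))

lemma scaledOp_nonneg (hω0 : 0 ≤ ω₀) (hL : CollisionOperator ω₀ u L) (F : L2v 𝕍 m) :
    0 ≤ ⟪scaledOp hω0 hL F, F⟫_ℝ := by
  obtain ⟨σ, hσ, h⟩ := scaledOp_gap hω0 hL
  exact le_trans (by positivity) (h F)

lemma eq_scaledProj_of_inner_eq_zero (hω0 : 0 ≤ ω₀) (hL : CollisionOperator ω₀ u L)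
    {F : L2v 𝕍 m} (h0 : ⟪scaledOp hω0 hL F, F⟫_ℝ ≤ 0) : F = scaledProj hω0 hL F := by
  obtain ⟨σ, hσ, h⟩ := scaledOp_gap hω0 hL
  have h1 := (h F).trans h0
  have h2 : ‖F - scaledProj hω0 hL F‖ ^ 2 ≤ 0 := by nlinarith
  have h3 := pow_eq_zero_iff two_ne_zero |>.1 (le_antisymm h2 (sq_nonneg _))
  exact sub_eq_zero.1 (norm_eq_zero.1 h3)

lemma scaledOp_scaledProj (hω0 : 0 ≤ ω₀) (hL : CollisionOperator ω₀ u L) (F : L2v 𝕍 m) :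
    scaledOp hω0 hL (scaledProj hω0 hL F) = 0 := scaledOp_nullUp hω0 hL _

/-- `OpEq` expresses the continuous extension of `L`. -/
lemma opEq_iff (hω0 : 0 ≤ ω₀) (hL : CollisionOperator ω₀ u L) {f h : Vel d → Val m}
    (hf : MemWL2 (weight ω₀) f (dv 𝕍)) (hh : MemWL2 (fun v => (weight ω₀ v)⁻¹) h (dv 𝕍)) :
    OpEq ω₀ L f h ↔ hh.toL2 = scaledOp hω0 hL hf.toL2 := by
  have key : ∀ ψ : L.domain, (∫ v, ⟪h v, (ψ : L2v 𝕍 m) v⟫_ℝ ∂dv 𝕍 = ∫ v, ⟪f v, L ψ v⟫_ℝ ∂dv 𝕍) ↔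
      ⟪hh.toL2, scaleUp hω0 hL ψ⟫_ℝ = ⟪scaledOp hω0 hL hf.toL2, scaleUp hω0 hL ψ⟫_ℝ := by
    intro ψ
    rw [scaledOp_symm, scaledOp_scaleUp]
    have e1 : ⟪hh.toL2, scaleUp hω0 hL ψ⟫_ℝ = ∫ v, ⟪h v, (ψ : L2v 𝕍 m) v⟫_ℝ ∂dv 𝕍 := by
      rw [real_inner_comm]
      refine ((hL.memWL2 hω0 ψ.2).inner_toL2 (weight_pos ω₀) hh).trans ?_
      simp only [real_inner_comm]
    have e2 : ⟪hf.toL2, scaleDown hω0 (L ψ)⟫_ℝ = ∫ v, ⟪f v, L ψ v⟫_ℝ ∂dv 𝕍 :=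
      hf.inner_toL2 (weight_pos ω₀) (g := L ψ) ((isMultiplier_sqrt_inv hω0).memLp (L ψ))
    rw [e1, e2]
  constructor
  · rintro ⟨-, -, h3⟩
    refine (denseRange_scaleUp hω0 hL).eq_of_inner_left ℝ fun ψ => ?_
    exact (key ψ).1 (h3 ψ)
  · intro h3
    exact ⟨hf, hh, fun ψ => (key ψ).2 (by rw [h3])⟩

/-- The hypothesis says that `y` lies in the domain of the adjoint with image `g`, and `L` is its
own adjoint. -/
lemma mem_domain_of_forall (hL : CollisionOperator ω₀ u L) {y g : L2v 𝕍 m}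
    (h : ∀ ψ : L.domain, ⟪g, (ψ : L2v 𝕍 m)⟫_ℝ = ⟪y, L ψ⟫_ℝ) :
    ∃ hy : y ∈ L.domain, L ⟨y, hy⟩ = g := by
  have hs := LinearPMap.isSelfAdjoint_def.1 hL.selfAdjoint
  have h1 := LinearPMap.mem_adjoint_domain_of_exists (T := L) y ⟨g, h⟩
  have h2 := LinearPMap.adjoint_apply_eq hL.selfAdjoint.dense_domain ⟨y, h1⟩ h
  obtain ⟨hy, e⟩ : ∃ hy : y ∈ L.domain, L ⟨y, hy⟩ = LinearPMap.adjoint L ⟨y, h1⟩ := by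
    -- Membership in the domain depends on the operator, so the equality of `L` with its adjoint is
    -- eliminated for a variable operator `T`.
    have : ∀ (T : L2v 𝕍 m →ₗ.[ℝ] L2v 𝕍 m) (hT : T = L) (h1 : y ∈ T.domain),
        ∃ hy : y ∈ L.domain, L ⟨y, hy⟩ = T ⟨y, h1⟩ := by
      rintro T rfl h1
      exact ⟨h1, rfl⟩
    exact this _ hs h1
  exact ⟨hy, e.trans h2⟩

/-- `L` maps `D(L) ∩ (Null L)^⊥` onto `(Null L)^⊥`. -/
lemma exists_preimage (hω0 : 0 ≤ ω₀) (hL : CollisionOperator ω₀ u L) {g : L2v 𝕍 m}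
    (hg : g ∈ (nullSpace L)ᗮ) :
    ∃ Y : L.domain, (Y : L2v 𝕍 m) ∈ (nullSpace L)ᗮ ∧ L Y = g := by
  obtain ⟨σ, hσ, hgap⟩ := scaledOp_gap hω0 hL
  set K := scaledOp hω0 hL
  set Q := scaledProj hω0 hL
  -- Adding `Q* Q` restores coercivity on `√a Null L`. It does not change the equation in the end:
  -- since `g` is orthogonal to the null space, testing with `Q F` gives `Q F = 0`.
  set A : L2v 𝕍 m →L[ℝ] L2v 𝕍 m := K + (ContinuousLinearMap.adjoint Q) ∘L Q with hA
  have hAi : ∀ F G, ⟪A F, G⟫_ℝ = ⟪K F, G⟫_ℝ + ⟪Q F, Q G⟫_ℝ := by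
    intro F G
    rw [hA, add_apply, inner_add_left, ContinuousLinearMap.comp_apply,
      ContinuousLinearMap.adjoint_inner_left]
  have hco : ∀ F, (min σ 1 / 2) * ‖F‖ ^ 2 ≤ ⟪A F, F⟫_ℝ := by
    intro F
    rw [hAi, real_inner_self_eq_norm_sq]
    have h1 := hgap F
    have h2 : ‖F‖ ^ 2 ≤ 2 * (‖F - Q F‖ ^ 2 + ‖Q F‖ ^ 2) := by
      have h3 : ‖F‖ ≤ ‖F - Q F‖ + ‖Q F‖ := by
        simpa using norm_add_le (F - Q F) (Q F)
      nlinarith [norm_nonneg F, sq_nonneg (‖F - Q F‖ - ‖Q F‖)]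
    have h4 : min σ 1 * ‖F - Q F‖ ^ 2 ≤ σ * ‖F - Q F‖ ^ 2 := by
      gcongr; exact min_le_left _ _
    have h5 : min σ 1 * ‖Q F‖ ^ 2 ≤ 1 * ‖Q F‖ ^ 2 := by
      gcongr; exact min_le_right _ _
    have h6 : 0 < min σ 1 := lt_min hσ one_pos
    nlinarith
  obtain ⟨F, hF⟩ := exists_apply_eq_of_coercive A
    (half_pos (lt_min hσ one_pos)) hco (scaleDown hω0 g)
  have hw : ∀ G, ⟪K F, G⟫_ℝ + ⟪Q F, Q G⟫_ℝ = ⟪scaleDown hω0 g, G⟫_ℝ := fun G => by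
    rw [← hAi, hF]
  have hQ0 : Q F = 0 := by
    have h1 := hw (Q F)
    have h2 : ⟪K F, Q F⟫_ℝ = 0 := by
      rw [scaledOp_symm, scaledOp_scaledProj, inner_zero_right]
    have h3 : Q (Q F) = Q F := scaledProj_nullUp hω0 hL _
    have h4 : ⟪scaleDown hω0 g, Q F⟫_ℝ = 0 := by
      have : Q F = nullUp hω0 hL (nullProj hL (scaleDown hω0 F)) := rfl
      rw [this, nullUp_apply, scaleDown_inner_scaleUp]
      exact (Submodule.mem_orthogonal' _ _).1 hg _
        (nullProj hL (scaleDown hω0 F)).2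
    rw [h2, h3, h4, zero_add] at h1
    exact inner_self_eq_zero.1 h1
  obtain ⟨hy, e⟩ := mem_domain_of_forall hL (y := scaleDown hω0 F) (g := g) fun ψ => by
    have h1 := hw (scaleUp hω0 hL ψ)
    rw [hQ0, inner_zero_left, add_zero, scaledOp_symm, scaledOp_scaleUp,
      scaleDown_inner_scaleUp] at h1
    rw [← h1]
    exact (mulOp_inner (isMultiplier_sqrt_inv hω0) F (L ψ)).symm
  refine ⟨⟨_, hy⟩, ?_, e⟩
  rw [← nullProj_eq_zero_iff hL]
  have h1 : nullUp hω0 hL (nullProj hL (scaleDown hω0 F)) = 0 := hQ0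
  have h2 := scaleDown_nullUp hω0 hL (nullProj hL (scaleDown hω0 F))
  rw [h1, map_zero] at h2
  exact Subtype.ext h2.symm

end Operator

/-! ### The modes and their Gram matrix -/

section Modes

variable {d m : ℕ} [NeZero d] {𝕍 : Set (Vel d)} {ω₀ u : ℝ} {L : L2v 𝕍 m →ₗ.[ℝ] L2v 𝕍 m}
  {hL : CollisionOperator ω₀ u L} {νp νm ν0 : ℕ}

lemma mulSpeed_coe (hL : CollisionOperator ω₀ u L) (p : nullSpace L) :
    mulSpeed hL p =ᵐ[dv 𝕍] fun v => speed u v • (p : L2v 𝕍 m) v :=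
  (hL.moment p p.2).coeFn_toLp

lemma mulSpeed_eq_zero (hL : CollisionOperator ω₀ u L) {p : nullSpace L}
    (h : mulSpeed hL p = 0) : p = 0 := by
  apply Subtype.ext
  rw [Lp.eq_zero_iff_ae_eq_zero] at h
  refine (Lp.eq_zero_iff_ae_eq_zero).2 ?_
  filter_upwards [h, mulSpeed_coe hL p, speed_ne_zero_ae 𝕍 u] with v h1 h2 h3
  rw [h2] at h1
  exact (smul_eq_zero.1 h1).resolve_left h3

lemma flux_null (hL : CollisionOperator ω₀ u L) (p : nullSpace L) (f : L2v 𝕍 m) :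
    flux 𝕍 u (p : L2v 𝕍 m) f = ⟪mulSpeed hL p, f⟫_ℝ := by
  rw [inner_eq_integral]
  refine integral_congr_ae ?_
  filter_upwards [mulSpeed_coe hL p] with v h1
  rw [h1, inner_smul_left]; rfl

lemma flux_comm (f g : Vel d → Val m) : flux 𝕍 u f g = flux 𝕍 u g f := by
  simp only [flux, real_inner_comm]

lemma flux_null_null (hL : CollisionOperator ω₀ u L) (p q : nullSpace L) :
    flux 𝕍 u (p : L2v 𝕍 m) (q : L2v 𝕍 m) =
      ⟪(P1 hL p : L2v 𝕍 m), (q : L2v 𝕍 m)⟫_ℝ := by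
  rw [flux_null hL, real_inner_comm, ← inner_nullProj hL, real_inner_comm]
  rfl

namespace EigenSystem

variable (S : EigenSystem hL νp νm ν0)

/-- All the eigenfunctions `X₊ᵢ`, `X₋ⱼ`, `X₀ₖ`. -/
def basis : Fin νp ⊕ (Fin νm ⊕ Fin ν0) → nullSpace L :=
  Sum.elim S.plus (Sum.elim S.minus S.zero)

/-- All the functions `X₊ᵢ`, `X₋ⱼ`, `X₀ₖ`, `Yₖ` that enter the damping. -/
def mode : (Fin νp ⊕ (Fin νm ⊕ Fin ν0)) ⊕ Fin ν0 → L2v 𝕍 m :=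
  Sum.elim (fun a => (S.basis a : L2v 𝕍 m)) S.Y

/-- The eigenvalue of `P₁` for each eigenfunction. -/
def eigenvalue : Fin νp ⊕ (Fin νm ⊕ Fin ν0) → ℝ :=
  Sum.elim (fun i => (S.plus_eigen i).choose)
    (Sum.elim (fun j => (S.minus_eigen j).choose) fun _ => 0)

lemma P1_basis (a) : P1 hL (S.basis a) = S.eigenvalue a • S.basis a := by
  rcases a with i | j | k
  · exact (S.plus_eigen i).choose_spec.2
  · exact (S.minus_eigen j).choose_spec.2
  · simpa [basis, eigenvalue] using S.zero_eigen k

lemma eigenvalue_plus (i) : 0 < S.eigenvalue (Sum.inl i) := (S.plus_eigen i).choose_spec.1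

lemma eigenvalue_minus (j) : S.eigenvalue (Sum.inr (Sum.inl j)) < 0 :=
  (S.minus_eigen j).choose_spec.1

lemma eigenvalue_zero (k) : S.eigenvalue (Sum.inr (Sum.inr k)) = 0 := rfl

lemma mulSpeed_zero_mem (k) : mulSpeed hL (S.zero k) ∈ (nullSpace L)ᗮ :=
  (nullProj_eq_zero_iff hL _).1 (S.zero_eigen k)

/-- The preimage required by `pseudoInverse` exists because `(v₁ + u) X₀ₖ` is orthogonal to the null
space. The equation then holds exactly: the residual lies in the null space, and also in its
complement because `L` is symmetric. -/
lemma Y_spec (hω0 : 0 ≤ ω₀) (k : Fin ν0) :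
    S.Y k ∈ (nullSpace L)ᗮ ∧ ∃ h : S.Y k ∈ L.domain, L ⟨S.Y k, h⟩ = mulSpeed hL (S.zero k) := by
  have hex : ∃ Y : L.domain, (Y : L2v 𝕍 m) ∈ (nullSpace L)ᗮ ∧
      mulSpeed hL (S.zero k) - L Y ∈ nullSpace L := by
    obtain ⟨Y, h1, h2⟩ := exists_preimage hω0 hL (S.mulSpeed_zero_mem k)
    exact ⟨Y, h1, by rw [h2, sub_self]; exact zero_mem _⟩
  have hY : S.Y k = hex.choose := by
    rw [EigenSystem.Y, pseudoInverse, dif_pos hex]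
  have hs := hex.choose_spec
  refine ⟨hY ▸ hs.1, hY ▸ hex.choose.2, ?_⟩
  have e : (⟨S.Y k, hY ▸ hex.choose.2⟩ : L.domain) = hex.choose := Subtype.ext hY
  rw [e]
  set Y := hex.choose
  have h3 : mulSpeed hL (S.zero k) - L Y ∈ (nullSpace L)ᗮ := by
    refine Submodule.sub_mem _ (S.mulSpeed_zero_mem k) ?_
    rw [Submodule.mem_orthogonal]
    intro p hp
    have := symm_apply hL ⟨p, nullSpace_le_domain hp⟩ Y
    rw [← this, apply_null ⟨p, hp⟩, inner_zero_left]
  have h4 : ⟪mulSpeed hL (S.zero k) - L Y, mulSpeed hL (S.zero k) - L Y⟫_ℝ = 0 :=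
    (Submodule.mem_orthogonal _ _).1 h3 _ hs.2
  exact (sub_eq_zero.1 (inner_self_eq_zero.1 h4)).symm

lemma mode_mem (hω0 : 0 ≤ ω₀) (z) : S.mode z ∈ L.domain := by
  rcases z with a | k
  · exact nullSpace_le_domain (S.basis a).2
  · exact (S.Y_spec hω0 k).2.1

/-- The image of each mode under `L`: `0` for the eigenfunctions, `(v₁ + u) X₀ₖ` for `Yₖ`. -/
lemma apply_basis (hω0 : 0 ≤ ω₀) (a) : L ⟨S.mode (Sum.inl a), S.mode_mem hω0 _⟩ = 0 :=
  apply_null (S.basis a)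

lemma apply_Y (hω0 : 0 ≤ ω₀) (k) :
    L ⟨S.mode (Sum.inr k), S.mode_mem hω0 _⟩ = mulSpeed hL (S.zero k) :=
  (S.Y_spec hω0 k).2.2

/-- The matrix `⟨(v₁ + u) Z, Z'⟩`. -/
def gram (z z' : (Fin νp ⊕ (Fin νm ⊕ Fin ν0)) ⊕ Fin ν0) : ℝ :=
  flux 𝕍 u (S.mode z) (S.mode z')

lemma gram_comm (z z') : S.gram z z' = S.gram z' z := flux_comm _ _

lemma inner_basis (a a') :
    ⟪(S.basis a : L2v 𝕍 m), (S.basis a' : L2v 𝕍 m)⟫_ℝ = if a = a' then 1 else 0 :=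
  orthonormal_iff_ite.1 S.orthonormal a a'

lemma gram_basis (a a') : S.gram (Sum.inl a) (Sum.inl a') = if a = a' then S.eigenvalue a else 0 := by
  rw [gram]
  change flux 𝕍 u (S.basis a : L2v 𝕍 m) (S.basis a' : L2v 𝕍 m) = _
  rw [flux_null_null hL, P1_basis, Submodule.coe_smul, inner_smul_left, inner_basis]
  simp

lemma gram_zero_Y (hω0 : 0 ≤ ω₀) (k l) :
    S.gram (Sum.inl (Sum.inr (Sum.inr k))) (Sum.inr l) =
      ⟪S.mode (Sum.inr l), L ⟨S.mode (Sum.inr k), S.mode_mem hω0 _⟩⟫_ℝ := by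
  rw [S.apply_Y hω0, real_inner_comm]
  exact flux_null hL (S.zero k) (S.Y l)

/-- As `L Yₖ = (v₁ + u) X₀ₖ`, the block of `X₀` against `Y` has entries `⟨L Yₖ, Yₗ⟩`: it represents
the quadratic form of `L` on the span of the `Yₖ`. -/
lemma sum_gram_zero_Y (hω0 : 0 ≤ ω₀) (c : Fin ν0 → ℝ) :
    ∑ k, c k * ∑ l, S.gram (Sum.inl (Sum.inr (Sum.inr k))) (Sum.inr l) * c l =
      ⟪((∑ k, c k • (⟨S.mode (Sum.inr k), S.mode_mem hω0 _⟩ : L.domain) : L.domain) : L2v 𝕍 m),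
        L (∑ k, c k • (⟨S.mode (Sum.inr k), S.mode_mem hω0 _⟩ : L.domain))⟫_ℝ := by
  have e : L (∑ k, c k • (⟨S.mode (Sum.inr k), S.mode_mem hω0 _⟩ : L.domain)) =
      ∑ k, c k • L ⟨S.mode (Sum.inr k), S.mode_mem hω0 _⟩ := by
    have := map_sum L.toFun (fun k => c k • (⟨S.mode (Sum.inr k), S.mode_mem hω0 _⟩ : L.domain))
      Finset.univ
    simp only [map_smul] at this
    exact this
  rw [e]
  simp only [gram_zero_Y S hω0, Submodule.coe_sum, Submodule.coe_smul, sum_inner, inner_sum,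
    inner_smul_left, inner_smul_right, Finset.mul_sum, RCLike.conj_to_real]
  refine Finset.sum_congr rfl fun k _ => Finset.sum_congr rfl fun l _ => ?_
  ring

lemma sum_gram_zero_Y_nonneg (hω0 : 0 ≤ ω₀) (c : Fin ν0 → ℝ) :
    0 ≤ ∑ k, c k * ∑ l, S.gram (Sum.inl (Sum.inr (Sum.inr k))) (Sum.inr l) * c l := by
  rw [sum_gram_zero_Y S hω0]
  exact hL.nonneg _

/-- If the form vanishes at `y = ∑ cₖ Yₖ`, the gap gives `L y = 0`. But `L y = (v₁ + u) ∑ cₖ X₀ₖ`,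
and the speed is nonzero almost everywhere, so orthonormality gives `c = 0`. -/
lemma eq_zero_of_gram_zero_Y (hω0 : 0 ≤ ω₀) {c : Fin ν0 → ℝ}
    (h : ∀ k, ∑ l, S.gram (Sum.inl (Sum.inr (Sum.inr k))) (Sum.inr l) * c l = 0) : c = 0 := by
  have h0 := sum_gram_zero_Y S hω0 c
  simp only [h, mul_zero, Finset.sum_const_zero] at h0
  set y : L.domain := ∑ k, c k • (⟨S.mode (Sum.inr k), S.mode_mem hω0 _⟩ : L.domain) with hy
  have h1 : scaleUp hω0 hL y = scaledProj hω0 hL (scaleUp hω0 hL y) := by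
    refine eq_scaledProj_of_inner_eq_zero hω0 hL (le_of_eq ?_)
    rw [scaledOp_scaleUp, scaleDown_inner_scaleUp, real_inner_comm, ← h0]
  have h2 : scaleDown hω0 (L y) = 0 := by
    rw [← scaledOp_scaleUp hω0 hL, h1, scaledOp_scaledProj]
  have h3 : L y = 0 := scaleDown_injective hω0 h2
  have h4 : L y = mulSpeed hL (∑ k, c k • S.zero k) := by
    have := map_sum L.toFun (fun k => c k • (⟨S.mode (Sum.inr k), S.mode_mem hω0 _⟩ : L.domain))
      Finset.univ
    simp only [map_smul] at this
    refine this.trans ?_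
    rw [map_sum]
    refine Finset.sum_congr rfl fun k _ => ?_
    rw [map_smul]
    congr 1
    exact S.apply_Y hω0 k
  have h5 := mulSpeed_eq_zero hL (h4 ▸ h3)
  funext k
  have h6 := congrArg
    (fun p : nullSpace L => ⟪(S.basis (Sum.inr (Sum.inr k)) : L2v 𝕍 m), (p : L2v 𝕍 m)⟫_ℝ) h5
  simp only [Submodule.coe_sum, Submodule.coe_smul, Submodule.coe_zero, inner_sum,
    inner_smul_right, inner_zero_right] at h6
  have h7 : ∀ l, ⟪(S.basis (Sum.inr (Sum.inr k)) : L2v 𝕍 m), (S.zero l : L2v 𝕍 m)⟫_ℝ = if k = l then 1 else 0 := by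
    intro l
    have := S.inner_basis (Sum.inr (Sum.inr k)) (Sum.inr (Sum.inr l))
    simpa [basis] using this
  simpa [h7] using h6

/-- The image of a coefficient vector under the Gram matrix. -/
lemma sum_gram_zero (c : (Fin νp ⊕ (Fin νm ⊕ Fin ν0)) ⊕ Fin ν0 → ℝ) (a) :
    ∑ z, S.gram (Sum.inl a) z * c z = S.eigenvalue a * c (Sum.inl a) +
      ∑ l, S.gram (Sum.inl a) (Sum.inr l) * c (Sum.inr l) := by
  rw [Fintype.sum_sum_type]
  simp [gram_basis]

/-- Coefficients with `(G c)₊ = 0` and `(G c)₀ = 0` have vanishing `+` and `Y` components. -/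
lemma coeff_eq_zero (hω0 : 0 ≤ ω₀) {c : (Fin νp ⊕ (Fin νm ⊕ Fin ν0)) ⊕ Fin ν0 → ℝ}
    (hp : ∀ i, ∑ z, S.gram (Sum.inl (Sum.inl i)) z * c z = 0)
    (h0 : ∀ k, ∑ z, S.gram (Sum.inl (Sum.inr (Sum.inr k))) z * c z = 0) :
    (∀ k, c (Sum.inr k) = 0) ∧ ∀ i, c (Sum.inl (Sum.inl i)) = 0 := by
  -- The eigenvalue in the `X₀` rows is zero, so these rows involve the `Y` coefficients only; once
  -- those vanish, the `X₊` rows are diagonal.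
  have h1 : (fun k => c (Sum.inr k)) = 0 := by
    refine S.eq_zero_of_gram_zero_Y hω0 fun k => ?_
    have := h0 k
    rwa [sum_gram_zero, eigenvalue_zero, zero_mul, zero_add] at this
  have h1' : ∀ k, c (Sum.inr k) = 0 := fun k => congrFun h1 k
  refine ⟨h1', fun i => ?_⟩
  have := hp i
  rw [sum_gram_zero] at this
  simp only [h1', mul_zero, Finset.sum_const_zero, add_zero] at this
  exact (mul_eq_zero.1 this).resolve_left (S.eigenvalue_plus i).ne'

/-- The `X₀` and `X₊` rows eliminate the `Y` and `X₊` coefficients, the `X₋` rows then eliminate the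
`X₋` coefficients, and the `Y` rows reduce to the transpose of the `X₀`–`Y` block, which is
symmetric because `L` is. -/
lemma gram_injective (hω0 : 0 ≤ ω₀) {c : (Fin νp ⊕ (Fin νm ⊕ Fin ν0)) ⊕ Fin ν0 → ℝ}
    (h : ∀ z', ∑ z, S.gram z' z * c z = 0) : c = 0 := by
  obtain ⟨h1, h2⟩ := S.coeff_eq_zero hω0 (fun i => h _) (fun k => h _)
  have h3 : ∀ j, c (Sum.inl (Sum.inr (Sum.inl j))) = 0 := by
    intro j
    have := h (Sum.inl (Sum.inr (Sum.inl j)))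
    rw [sum_gram_zero] at this
    simp only [h1, mul_zero, Finset.sum_const_zero, add_zero] at this
    exact (mul_eq_zero.1 this).resolve_left (S.eigenvalue_minus j).ne
  have h4 : (fun k => c (Sum.inl (Sum.inr (Sum.inr k)))) = 0 := by
    have h5 : ∀ l, ∑ k, S.gram (Sum.inl (Sum.inr (Sum.inr k))) (Sum.inr l) *
        c (Sum.inl (Sum.inr (Sum.inr k))) = 0 := by
      intro l
      have := h (Sum.inr l)
      rw [Fintype.sum_sum_type, Fintype.sum_sum_type, Fintype.sum_sum_type] at this
      simp only [h1, h2, h3, mul_zero, Finset.sum_const_zero, add_zero, zero_add] at this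
      simpa only [S.gram_comm (Sum.inr l)] using this
    refine S.eq_zero_of_gram_zero_Y hω0 fun k => ?_
    refine Eq.trans (Finset.sum_congr rfl fun l _ => ?_) (h5 k)
    congr 1
    rw [gram_zero_Y S hω0, gram_zero_Y S hω0, real_inner_comm]
    exact symm_apply hL ⟨S.mode (Sum.inr k), S.mode_mem hω0 _⟩
      ⟨S.mode (Sum.inr l), S.mode_mem hω0 _⟩
  funext z
  rcases z with (i | j | k) | k
  · exact h2 i
  · exact h3 j
  · exact congrFun h4 k
  · exact h1 k

end EigenSystem

end Modes

section ToL2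

variable {Z F : Type*} [MeasurableSpace Z] [NormedAddCommGroup F] [InnerProductSpace ℝ F]
  {ρ : Z → ℝ} {f g : Z → F} {μ : Measure Z}

lemma MemWL2.toL2_congr (hf : MemWL2 ρ f μ) (hg : MemWL2 ρ g μ) (h : f =ᵐ[μ] g) :
    hf.toL2 = hg.toL2 := by
  apply MemLp.toLp_congr
  filter_upwards [h] with z hz
  rw [hz]

lemma MemWL2.toL2_add (hf : MemWL2 ρ f μ) (hg : MemWL2 ρ g μ) :
    (hf.add hg).toL2 = hf.toL2 + hg.toL2 := by
  rw [MemWL2.toL2, MemWL2.toL2, MemWL2.toL2, ← MemLp.toLp_add]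
  apply MemLp.toLp_congr
  exact ae_of_all _ fun z => smul_add _ _ _

lemma MemWL2.toL2_const_smul (c : ℝ) (hf : MemWL2 ρ f μ) :
    (hf.const_smul c).toL2 = c • hf.toL2 := by
  rw [MemWL2.toL2, MemWL2.toL2, ← MemLp.toLp_const_smul]
  apply MemLp.toLp_congr
  exact ae_of_all _ fun z => smul_comm _ _ _

lemma MemWL2.toL2_neg (hf : MemWL2 ρ f μ) : hf.neg.toL2 = - hf.toL2 := by
  have := hf.toL2_const_smul (-1)
  rw [neg_one_smul] at this
  rw [← this]
  exact MemWL2.toL2_congr _ _ (ae_of_all _ fun z => by simp)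

lemma MemWL2.toL2_zero : (MemWL2.zero : MemWL2 ρ (fun _ => (0 : F)) μ).toL2 = 0 := by
  rw [Lp.eq_zero_iff_ae_eq_zero]
  filter_upwards [(MemWL2.zero : MemWL2 ρ (fun _ => (0 : F)) μ).coeFn_toL2] with z hz
  simp [hz]

lemma MemWL2.toL2_sum {ι : Type*} (s : Finset ι) {h : ι → Z → F} (H : ∀ i, MemWL2 ρ (h i) μ) :
    (MemWL2.sum s H).toL2 = ∑ i ∈ s, (H i).toL2 := by
  classical
  induction s using Finset.induction_on with
  | empty =>
    rw [Finset.sum_empty, ← MemWL2.toL2_zero]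
    exact MemWL2.toL2_congr _ _ (ae_of_all _ fun z => by simp)
  | insert i s hi ih =>
    rw [Finset.sum_insert hi, ← ih, ← MemWL2.toL2_add]
    exact MemWL2.toL2_congr _ _ (ae_of_all _ fun z => by simp [Finset.sum_insert hi])

end ToL2

/-- A nonnegative form with a spectral gap becomes coercive when finitely many squares are added
that are jointly injective on the null space. -/
lemma exists_coercive_of_gap {H N ι : Type*} [NormedAddCommGroup H] [InnerProductSpace ℝ H]
    [NormedAddCommGroup N] [NormedSpace ℝ N] [FiniteDimensional ℝ N] [Fintype ι]
    (J : N →L[ℝ] H) (P : H → N) (B : H → ℝ) (ζ : ι → H) {σ α : ℝ} (hσ : 0 < σ) (hα : 0 < α)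
    (hgap : ∀ F, σ * ‖F - J (P F)‖ ^ 2 ≤ B F) (hζ : ∀ p, (∀ z, ⟪ζ z, J p⟫_ℝ = 0) → p = 0) :
    ∃ c > 0, ∀ F, c * ‖F‖ ^ 2 ≤ B F + α * ∑ z, ⟪ζ z, F⟫_ℝ * ⟪ζ z, F⟫_ℝ := by
  let R : N →ₗ[ℝ] (ι → ℝ) :=
    LinearMap.pi fun z => (innerSL ℝ (ζ z)).toLinearMap ∘ₗ J.toLinearMap
  have hRz : ∀ p z, R p z = ⟪ζ z, J p⟫_ℝ := fun p z => rfl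
  have hR : LinearMap.ker R = ⊥ := by
    rw [LinearMap.ker_eq_bot']
    intro p hp
    exact hζ p fun z => by rw [← hRz, hp]; rfl
  -- An injective linear map on a finite dimensional space is bounded below; `κ` is the constant of
  -- this bound.
  obtain ⟨κ, -, hκ⟩ := LinearMap.exists_antilipschitzWith R hR
  have hκ' : ∀ p, ‖p‖ ≤ κ * ‖R p‖ := fun p => by
    simpa using hκ.le_mul_dist p 0
  obtain ⟨n, hn⟩ : ∃ n, n = ‖J‖ := ⟨_, rfl⟩
  obtain ⟨b, hb⟩ : ∃ b, b = ∑ z, ‖ζ z‖ := ⟨_, rfl⟩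
  have hb0 : 0 ≤ b := hb ▸ Finset.sum_nonneg fun z _ => norm_nonneg _
  have hn0 : 0 ≤ n := hn ▸ norm_nonneg _
  obtain ⟨M, hM⟩ : ∃ M, M = (1 + n * κ * b) ^ 2 + (n * κ) ^ 2 := ⟨_, rfl⟩
  have hMpos : 0 < M := by
    have : (0 : ℝ) ≤ n * κ * b := by positivity
    rw [hM]
    positivity
  refine ⟨min σ α / (2 * M), by positivity, fun F => ?_⟩
  obtain ⟨T2, hT2⟩ : ∃ T2, T2 = ∑ z, ⟪ζ z, F⟫_ℝ ^ 2 := ⟨_, rfl⟩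
  have hT2nn : 0 ≤ T2 := hT2 ▸ Finset.sum_nonneg fun z _ => sq_nonneg _
  obtain ⟨T, hT⟩ : ∃ T, T = Real.sqrt T2 := ⟨_, rfl⟩
  obtain ⟨D, hD⟩ : ∃ D, D = ‖F - J (P F)‖ := ⟨_, rfl⟩
  have hD0 : 0 ≤ D := hD ▸ norm_nonneg _
  have hT0 : 0 ≤ T := hT ▸ Real.sqrt_nonneg _
  have hTsq : T ^ 2 = T2 := hT ▸ Real.sq_sqrt hT2nn
  -- The moments of the null component are those of `F` up to an error controlled by the distance
  -- `D`, which the gap controls. Hence `D` and the moments of `F` together bound `‖F‖`.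
  have hRp : ‖R (P F)‖ ≤ T + b * D := by
    refine (pi_norm_le_iff_of_nonneg (by positivity)).2 fun z => ?_
    have e : R (P F) z = ⟪ζ z, F⟫_ℝ - ⟪ζ z, F - J (P F)⟫_ℝ := by
      rw [hRz, inner_sub_right]; ring
    rw [e]
    refine (norm_sub_le _ _).trans (add_le_add ?_ ?_)
    · rw [Real.norm_eq_abs, hT, hT2]
      exact Real.abs_le_sqrt (Finset.single_le_sum (f := fun z => ⟪ζ z, F⟫_ℝ ^ 2)
        (fun z _ => sq_nonneg _) (Finset.mem_univ z))
    · refine (norm_inner_le_norm _ _).trans ?_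
      rw [hD, hb]
      exact mul_le_mul_of_nonneg_right (Finset.single_le_sum (f := fun z => ‖ζ z‖)
        (fun z _ => norm_nonneg _) (Finset.mem_univ z)) (norm_nonneg _)
  have hQn : ‖J (P F)‖ ≤ n * κ * (T + b * D) := by
    calc ‖J (P F)‖ ≤ n * ‖P F‖ := hn ▸ J.le_opNorm (P F)
      _ ≤ n * (κ * (T + b * D)) := by
        gcongr
        exact (hκ' _).trans (by gcongr)
      _ = _ := by ring
  have hF : ‖F‖ ≤ (1 + n * κ * b) * D + n * κ * T := by
    have : ‖F‖ ≤ D + ‖J (P F)‖ := by simpa [hD] using norm_add_le (F - J (P F)) (J (P F))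
    linarith
  have hF2 : ‖F‖ ^ 2 ≤ 2 * M * (D ^ 2 + T2) := by
    have h1 : ‖F‖ ^ 2 ≤ ((1 + n * κ * b) * D + n * κ * T) ^ 2 :=
      pow_le_pow_left₀ (norm_nonneg _) hF 2
    rw [← hTsq, hM]
    have h2 := sq_nonneg ((1 + n * κ * b) * D - n * κ * T)
    have h3 : 0 ≤ ((1 + n * κ * b) * T) ^ 2 := sq_nonneg _
    have h4 : 0 ≤ (n * κ * D) ^ 2 := sq_nonneg _
    have h5 : 0 ≤ ((1 + n * κ * b) * D) ^ 2 := sq_nonneg _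
    have h6 : 0 ≤ (n * κ * T) ^ 2 := sq_nonneg _
    calc ‖F‖ ^ 2 ≤ 2 * (((1 + n * κ * b) * D) ^ 2 + (n * κ * T) ^ 2) := by linarith
      _ ≤ 2 * (((1 + n * κ * b) * D) ^ 2 + (n * κ * T) ^ 2 + ((1 + n * κ * b) * T) ^ 2
          + (n * κ * D) ^ 2) := by linarith
      _ = _ := by ring
  have hmain : min σ α * (D ^ 2 + T2) ≤ B F + α * ∑ z, ⟪ζ z, F⟫_ℝ * ⟪ζ z, F⟫_ℝ := by
    have h1 := hgap F
    rw [← hD] at h1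
    have h2 : ∑ z, ⟪ζ z, F⟫_ℝ * ⟪ζ z, F⟫_ℝ = T2 :=
      hT2 ▸ Finset.sum_congr rfl fun z _ => (sq _).symm
    rw [h2, mul_add]
    refine add_le_add (le_trans ?_ h1) ?_
    · exact mul_le_mul_of_nonneg_right (min_le_left _ _) (sq_nonneg _)
    · exact mul_le_mul_of_nonneg_right (min_le_right _ _) hT2nn
  refine le_trans ?_ hmain
  have hmin : 0 < min σ α := lt_min hσ hα
  calc min σ α / (2 * M) * ‖F‖ ^ 2 ≤ min σ α / (2 * M) * (2 * M * (D ^ 2 + T2)) := by gcongr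
    _ = min σ α * (D ^ 2 + T2) := by field_simp

/-! ### Coercivity of the damped operator -/

section Damped

variable {d m : ℕ} [NeZero d] {𝕍 : Set (Vel d)} {ω₀ u : ℝ} {L : L2v 𝕍 m →ₗ.[ℝ] L2v 𝕍 m}
  {hL : CollisionOperator ω₀ u L} {νp νm ν0 : ℕ}

namespace EigenSystem

variable (S : EigenSystem hL νp νm ν0)

lemma memWL2_mode (hω0 : 0 ≤ ω₀) (z) : MemWL2 (weight ω₀) (S.mode z) (dv 𝕍) :=
  hL.memWL2 hω0 (S.mode_mem hω0 z)

lemma memWL2_speed_null (hω0 : 0 ≤ ω₀) (hL : CollisionOperator ω₀ u L) {p : L2v 𝕍 m}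
    (hp : p ∈ nullSpace L) :
    MemWL2 (fun v => (weight ω₀ v)⁻¹) (fun v => speed u v • p v) (dv 𝕍) :=
  memWL2_inv_of_memLp (measurable_weight ω₀) (one_le_weight hω0) (hL.moment p hp)

/-- `(v₁ + u) Yₖ ∈ L²(a⁻¹ dv)`. -/
abbrev FiniteFlux : Prop :=
  ∀ k, MemWL2 (fun v => (weight ω₀ v)⁻¹) (fun v => speed u v • S.Y k v) (dv 𝕍)

variable {S}

lemma memWL2_speed_mode (hω0 : 0 ≤ ω₀) (hY : S.FiniteFlux) (z) :
    MemWL2 (fun v => (weight ω₀ v)⁻¹) (fun v => speed u v • S.mode z v) (dv 𝕍) := by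
  rcases z with a | k
  · exact memWL2_speed_null hω0 hL (S.basis a).2
  · exact hY k

/-- The elements `a^{-1/2} (v₁ + u) Z` of `(L²(dv))ᵐ`. -/
def coflux (hω0 : 0 ≤ ω₀) (hY : S.FiniteFlux)
    (z : (Fin νp ⊕ (Fin νm ⊕ Fin ν0)) ⊕ Fin ν0) : L2v 𝕍 m := (memWL2_speed_mode hω0 hY z).toL2

lemma flux_mode (hω0 : 0 ≤ ω₀) (hY : S.FiniteFlux) (z) {f : Vel d → Val m}
    (hf : MemWL2 (weight ω₀) f (dv 𝕍)) :
    flux 𝕍 u (S.mode z) f = ⟪coflux hω0 hY z, hf.toL2⟫_ℝ := by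
  rw [coflux, real_inner_comm, hf.inner_toL2 (weight_pos ω₀)]
  refine integral_congr_ae (ae_of_all _ fun v => ?_)
  simp only [inner_smul_right, real_inner_comm]

lemma damping_eq (S : EigenSystem hL νp νm ν0) (α : ℝ) (h : Vel d → Val m) (v : Vel d) :
    damping S α h v = α • ∑ z, flux 𝕍 u (S.mode z) h • speed u v • S.mode z v := by
  simp only [damping, dampTerm, Fintype.sum_sum_type, ← add_assoc]
  rfl

lemma memWL2_damping (hω0 : 0 ≤ ω₀) (hY : S.FiniteFlux) (α : ℝ) (h : Vel d → Val m) :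
    MemWL2 (fun v => (weight ω₀ v)⁻¹) (damping S α h) (dv 𝕍) := by
  have : damping S α h =
      fun v => α • ∑ z, flux 𝕍 u (S.mode z) h • speed u v • S.mode z v :=
    funext fun v => damping_eq S α h v
  rw [this]
  exact (MemWL2.sum _ fun z => (memWL2_speed_mode hω0 hY z).const_smul _).const_smul α

lemma toL2_damping (hω0 : 0 ≤ ω₀) (hY : S.FiniteFlux) (α : ℝ) {h : Vel d → Val m}
    (hh : MemWL2 (weight ω₀) h (dv 𝕍)) :
    (memWL2_damping hω0 hY α h).toL2 =
      α • ∑ z, ⟪coflux hω0 hY z, hh.toL2⟫_ℝ • coflux hω0 hY z := by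
  have e := ((MemWL2.sum Finset.univ fun z => (memWL2_speed_mode hω0 hY z).const_smul
    (flux 𝕍 u (S.mode z) h)).toL2_const_smul α)
  rw [MemWL2.toL2_sum Finset.univ fun z => (memWL2_speed_mode hω0 hY z).const_smul
    (flux 𝕍 u (S.mode z) h)] at e
  simp only [← flux_mode hω0 hY _ hh]
  refine (MemWL2.toL2_congr _ _ (ae_of_all _ fun v => damping_eq S α h v)).trans (e.trans ?_)
  exact congrArg _ (Finset.sum_congr rfl fun z _ => MemWL2.toL2_const_smul _ _)

/-- The bounded operator `a^{-1/2} L_d a^{-1/2}`. -/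
def dampedOp (hω0 : 0 ≤ ω₀) (hY : S.FiniteFlux) (α : ℝ) : L2v 𝕍 m →L[ℝ] L2v 𝕍 m :=
  scaledOp hω0 hL + α • ∑ z, (innerSL ℝ (coflux hω0 hY z)).smulRight (coflux hω0 hY z)

lemma dampedOp_apply (hω0 : 0 ≤ ω₀) (hY : S.FiniteFlux) (α : ℝ) (F : L2v 𝕍 m) :
    dampedOp hω0 hY α F = scaledOp hω0 hL F +
      α • ∑ z, ⟪coflux hω0 hY z, F⟫_ℝ • coflux hω0 hY z := by
  simp only [dampedOp, add_apply, smul_apply, sum_apply, ContinuousLinearMap.smulRight_apply,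
    innerSL_apply_apply]

lemma dampedOp_inner (hω0 : 0 ≤ ω₀) (hY : S.FiniteFlux) (α : ℝ) (F G : L2v 𝕍 m) :
    ⟪dampedOp hω0 hY α F, G⟫_ℝ = ⟪scaledOp hω0 hL F, G⟫_ℝ +
      α * ∑ z, ⟪coflux hω0 hY z, F⟫_ℝ * ⟪coflux hω0 hY z, G⟫_ℝ := by
  rw [dampedOp_apply, inner_add_left, inner_smul_left, sum_inner]
  simp only [inner_smul_left, RCLike.conj_to_real]

lemma dampedOp_symm (hω0 : 0 ≤ ω₀) (hY : S.FiniteFlux) (α : ℝ) (F G : L2v 𝕍 m) :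
    ⟪dampedOp hω0 hY α F, G⟫_ℝ = ⟪F, dampedOp hω0 hY α G⟫_ℝ := by
  rw [real_inner_comm (dampedOp hω0 hY α G), dampedOp_inner, dampedOp_inner, scaledOp_symm,
    real_inner_comm]
  congr 2
  exact Finset.sum_congr rfl fun z _ => mul_comm _ _

/-- After scaling, the damping becomes the finite rank part of `dampedOp`, and the weak equation
becomes an identity in `L²(dv)`. -/
lemma opEq_damped_iff (hω0 : 0 ≤ ω₀) (hY : S.FiniteFlux) (α : ℝ) {f w : Vel d → Val m}
    (hf : MemWL2 (weight ω₀) f (dv 𝕍)) (hw : MemWL2 (fun v => (weight ω₀ v)⁻¹) w (dv 𝕍)) :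
    OpEq ω₀ L f (fun v => - w v - damping S α f v) ↔
      hw.toL2 = - dampedOp hω0 hY α hf.toL2 := by
  have e : (hw.neg.add (memWL2_damping hω0 hY α f).neg).toL2 =
      - hw.toL2 - α • ∑ z, ⟪coflux hω0 hY z, hf.toL2⟫_ℝ • coflux hω0 hY z := by
    rw [MemWL2.toL2_add hw.neg (memWL2_damping hω0 hY α f).neg, MemWL2.toL2_neg hw,
      MemWL2.toL2_neg (memWL2_damping hω0 hY α f), toL2_damping hω0 hY α hf,
      sub_eq_add_neg]
  rw [opEq_iff hω0 hL hf (hw.neg.sub (memWL2_damping hω0 hY α f)),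
    MemWL2.toL2_congr (hw.neg.sub (memWL2_damping hω0 hY α f))
      (hw.neg.add (memWL2_damping hω0 hY α f).neg)
      (ae_of_all _ fun v => sub_eq_add_neg _ _), e, dampedOp_apply]
  constructor
  · intro h
    rw [← h]; abel
  · intro h
    rw [h]; abel

lemma coflux_inner_nullUp (hω0 : 0 ≤ ω₀) (hY : S.FiniteFlux) (z) (p : nullSpace L) :
    ⟪coflux hω0 hY z, nullUp hω0 hL p⟫_ℝ = flux 𝕍 u (S.mode z) (p : L2v 𝕍 m) :=
  (flux_mode hω0 hY z (hL.memWL2 hω0 (nullSpace_le_domain p.2))).symm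

/-- Expanding `p` in the eigenbasis, the vanishing moments say that `G` annihilates the coefficient
vector extended by zero in the `Y` slots. -/
lemma coflux_injective (hω0 : 0 ≤ ω₀) (hY : S.FiniteFlux) {p : nullSpace L}
    (h : ∀ z, ⟪coflux hω0 hY z, nullUp hω0 hL p⟫_ℝ = 0) : p = 0 := by
  have hp : p ∈ Submodule.span ℝ (range S.basis) := by
    have := S.complete
    rw [show S.basis = Sum.elim S.plus (Sum.elim S.minus S.zero) from rfl, this]
    trivial
  obtain ⟨c, hc⟩ := (Submodule.mem_span_range_iff_exists_fun ℝ).1 hp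
  have h0 : Sum.elim c (fun _ : Fin ν0 => (0 : ℝ)) = 0 := by
    refine S.gram_injective hω0 fun z => ?_
    have h1 := h z
    rw [← hc, map_sum, inner_sum] at h1
    rw [Fintype.sum_sum_type]
    simp only [Sum.elim_inr, mul_zero, Finset.sum_const_zero, add_zero, Sum.elim_inl]
    rw [← h1]
    refine Finset.sum_congr rfl fun a _ => ?_
    rw [map_smul, inner_smul_right, coflux_inner_nullUp, mul_comm]
    rfl
  rw [← hc]
  refine Finset.sum_eq_zero fun a _ => ?_
  have := congrFun h0 (Sum.inl a)
  simp only [Sum.elim_inl, Pi.zero_apply] at this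
  rw [this, zero_smul]

/-- The gap controls the part away from `√a Null L`; the added squares control the null part by
`coflux_injective`. -/
lemma dampedOp_coercive (hω0 : 0 ≤ ω₀) (hY : S.FiniteFlux) {α : ℝ} (hα : 0 < α) :
    ∃ c > 0, ∀ F : L2v 𝕍 m, c * ‖F‖ ^ 2 ≤ ⟪dampedOp hω0 hY α F, F⟫_ℝ := by
  obtain ⟨σ, hσ, hgap⟩ := scaledOp_gap hω0 hL
  have : FiniteDimensional ℝ (nullSpace L) := hL.finite_null
  obtain ⟨c, hc, H⟩ := exists_coercive_of_gap (nullUp hω0 hL)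
    (fun F => nullProj hL (scaleDown hω0 F)) (fun F => ⟪scaledOp hω0 hL F, F⟫_ℝ)
    (coflux hω0 hY) hσ hα hgap fun p => coflux_injective hω0 hY
  exact ⟨c, hc, fun F => (H F).trans_eq (dampedOp_inner hω0 hY α F F).symm⟩

end EigenSystem

end Damped

/-! ### Representing `L²(dx; L²(dv))` by functions of both variables -/

section Lift

open Topology

variable {X Y F : Type*} [MeasurableSpace X] [MeasurableSpace Y] [NormedAddCommGroup F]
  {μ : Measure X} {ν : Measure Y}

lemma enorm_sq_eq_lintegral (f : Lp F 2 μ) : ‖f‖ₑ ^ 2 = ∫⁻ x, ‖f x‖ₑ ^ 2 ∂μ := by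
  rw [Lp.enorm_def]
  have := eLpNorm_nnreal_pow_eq_lintegral (f := f) (μ := μ) (p := 2) (by norm_num)
  simpa using this

/-- `f` represents `Φ` as a function of both variables. -/
def IsLift (f : Lp F 2 (μ.prod ν)) (Φ : Lp (Lp F 2 ν) 2 μ) : Prop :=
  ∀ᵐ x ∂μ, (fun y => f (x, y)) =ᵐ[ν] Φ x

variable [SFinite μ] [SFinite ν]

lemma ae_ae_of_eq {f g : X × Y → F} (h : f =ᵐ[μ.prod ν] g) :
    ∀ᵐ x ∂μ, (fun y => f (x, y)) =ᵐ[ν] fun y => g (x, y) :=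
  Measure.ae_ae_of_ae_prod h

lemma IsLift.sub {f g : Lp F 2 (μ.prod ν)} {Φ Ψ : Lp (Lp F 2 ν) 2 μ} (hf : IsLift f Φ)
    (hg : IsLift g Ψ) : IsLift (f - g) (Φ - Ψ) := by
  filter_upwards [hf, hg, ae_ae_of_eq (Lp.coeFn_sub f g), Lp.coeFn_sub Φ Ψ] with x h1 h2 h3 h4
  rw [h4]
  filter_upwards [h1, h2, h3, Lp.coeFn_sub (Φ x) (Ψ x)] with y e1 e2 e3 e4
  rw [e3]
  simp only [Pi.sub_apply] at e4 ⊢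
  rw [e4, e1, e2]

lemma IsLift.add {f g : Lp F 2 (μ.prod ν)} {Φ Ψ : Lp (Lp F 2 ν) 2 μ} (hf : IsLift f Φ)
    (hg : IsLift g Ψ) : IsLift (f + g) (Φ + Ψ) := by
  filter_upwards [hf, hg, ae_ae_of_eq (Lp.coeFn_add f g), Lp.coeFn_add Φ Ψ] with x h1 h2 h3 h4
  rw [h4]
  filter_upwards [h1, h2, h3, Lp.coeFn_add (Φ x) (Ψ x)] with y e1 e2 e3 e4
  rw [e3]
  simp only [Pi.add_apply] at e4 ⊢
  rw [e4, e1, e2]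

lemma lintegral_prod_sq (f : Lp F 2 (μ.prod ν)) :
    ‖f‖ₑ ^ 2 = ∫⁻ x, ∫⁻ y, ‖f (x, y)‖ₑ ^ 2 ∂ν ∂μ := by
  rw [enorm_sq_eq_lintegral, lintegral_prod]
  exact (Lp.aestronglyMeasurable f).enorm.pow_const 2

/-- By Tonelli, lifting is isometric; therefore lifts of a convergent sequence form a Cauchy
sequence. -/
lemma IsLift.enorm_eq {f : Lp F 2 (μ.prod ν)} {Φ : Lp (Lp F 2 ν) 2 μ} (hf : IsLift f Φ) :
    ‖f‖ₑ = ‖Φ‖ₑ := by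
  have : ‖f‖ₑ ^ 2 = ‖Φ‖ₑ ^ 2 := by
    rw [lintegral_prod_sq, enorm_sq_eq_lintegral]
    refine lintegral_congr_ae ?_
    filter_upwards [hf] with x h1
    rw [enorm_sq_eq_lintegral]
    exact lintegral_congr_ae (h1.mono fun y hy => by simp only [hy])
  exact (ENNReal.pow_right_strictMono (n := 2) (by norm_num)).injective this

lemma enorm_sub_sq_le (a b c : F) : ‖a - b‖ₑ ^ 2 ≤ 2 * ‖a - c‖ₑ ^ 2 + 2 * ‖c - b‖ₑ ^ 2 := by
  have h : ‖a - b‖ₑ ≤ ‖a - c‖ₑ + ‖c - b‖ₑ := by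
    simpa using enorm_add_le (a - c) (c - b)
  refine (pow_le_pow_left' h 2).trans ?_
  have := ENNReal.rpow_add_le_mul_rpow_add_rpow ‖a - c‖ₑ ‖c - b‖ₑ (p := 2) (by norm_num)
  norm_num at this
  rwa [mul_add] at this

lemma IsLift.of_tendsto {f : ℕ → Lp F 2 (μ.prod ν)} {Φ : ℕ → Lp (Lp F 2 ν) 2 μ}
    {f' : Lp F 2 (μ.prod ν)} {Φ' : Lp (Lp F 2 ν) 2 μ} (h : ∀ n, IsLift (f n) (Φ n))
    (hf : Tendsto f atTop (𝓝 f')) (hΦ : Tendsto Φ atTop (𝓝 Φ')) : IsLift f' Φ' := by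
  set a : ℕ → X → ENNReal := fun n x => ∫⁻ y, ‖(f' - f n) (x, y)‖ₑ ^ 2 ∂ν
  set b : ℕ → X → ENNReal := fun n x => ‖(Φ n - Φ') x‖ₑ ^ 2
  have hm : ∀ n, AEMeasurable (a n) μ := fun n =>
    ((Lp.aestronglyMeasurable (f' - f n)).enorm.pow_const 2).lintegral_prod_right'
  have hmb : ∀ n, AEMeasurable (b n) μ := fun n =>
    (Lp.aestronglyMeasurable (Φ n - Φ')).enorm.pow_const 2
  -- Each term of this infimum bounds the slice error of the limits, and the integrals of the terms
  -- tend to zero. Taking the infimum avoids the extraction of an almost everywhere convergent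
  -- subsequence.
  set e : X → ENNReal := fun x => ⨅ n, (2 * a n x + 2 * b n x)
  have he : AEMeasurable e μ :=
    AEMeasurable.iInf fun n => ((hm n).const_mul 2).add ((hmb n).const_mul 2)
  have hle : ∀ n, ∫⁻ x, e x ∂μ ≤ 2 * ‖f' - f n‖ₑ ^ 2 + 2 * ‖Φ n - Φ'‖ₑ ^ 2 := fun n => by
    calc ∫⁻ x, e x ∂μ ≤ ∫⁻ x, (2 * a n x + 2 * b n x) ∂μ := lintegral_mono fun x => iInf_le _ n
      _ = 2 * ∫⁻ x, a n x ∂μ + 2 * ∫⁻ x, b n x ∂μ := by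
        rw [lintegral_add_left' ((hm n).const_mul 2), lintegral_const_mul'' _ (hm n),
          lintegral_const_mul'' _ (hmb n)]
      _ = _ := by rw [lintegral_prod_sq (f' - f n), enorm_sq_eq_lintegral (Φ n - Φ')]
  have hlim : Tendsto (fun n => 2 * ‖f' - f n‖ₑ ^ 2 + 2 * ‖Φ n - Φ'‖ₑ ^ 2) atTop (𝓝 0) := by
    have h1 : Tendsto (fun n => ‖f' - f n‖ₑ) atTop (𝓝 0) := by
      have := (continuous_enorm.tendsto _).comp (tendsto_const_nhds.sub hf : Tendsto (fun n => f' - f n) atTop (𝓝 (f' - f')))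
      simpa [Function.comp_def] using this
    have h2 : Tendsto (fun n => ‖Φ n - Φ'‖ₑ) atTop (𝓝 0) := by
      have := (continuous_enorm.tendsto _).comp (hΦ.sub_const Φ')
      simpa [Function.comp_def] using this
    have h3 := ENNReal.Tendsto.const_mul (a := 2) (ENNReal.Tendsto.pow (n := 2) h1) (Or.inr (by simp))
    have h4 := ENNReal.Tendsto.const_mul (a := 2) (ENNReal.Tendsto.pow (n := 2) h2) (Or.inr (by simp))
    simpa using h3.add h4
  have h0 : ∫⁻ x, e x ∂μ = 0 := le_antisymm (ge_of_tendsto' hlim hle) bot_le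
  rw [lintegral_eq_zero_iff' he] at h0
  have H : ∀ᵐ x ∂μ, ∀ n, ∫⁻ y, ‖f' (x, y) - Φ' x y‖ₑ ^ 2 ∂ν ≤ 2 * a n x + 2 * b n x := by
    rw [ae_all_iff]
    intro n
    filter_upwards [h n, ae_ae_of_eq (Lp.coeFn_sub f' (f n)), Lp.coeFn_sub (Φ n) Φ',
      (Lp.aestronglyMeasurable (f' - f n)).prodMk_left] with x h1 h2 h3 h4
    simp only [a, b, h3, Pi.sub_apply]
    rw [enorm_sq_eq_lintegral, ← lintegral_const_mul'' _ (h4.enorm.pow_const 2),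
      ← lintegral_const_mul'' _ ((Lp.aestronglyMeasurable _).enorm.pow_const 2),
      ← lintegral_add_left' ((h4.enorm.pow_const 2).const_mul 2)]
    refine lintegral_mono_ae ?_
    filter_upwards [h1, h2, Lp.coeFn_sub (Φ n x) (Φ' x)] with y e1 e2 e3
    rw [e2, e3]
    simp only [Pi.sub_apply, ← e1]
    exact enorm_sub_sq_le _ _ _
  filter_upwards [h0, H, (Lp.aestronglyMeasurable f').prodMk_left] with x h1 h2 h3
  have h4 : ∫⁻ y, ‖f' (x, y) - Φ' x y‖ₑ ^ 2 ∂ν = 0 :=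
    le_antisymm ((le_iInf h2).trans h1.le) bot_le
  replace h4 := (lintegral_eq_zero_iff'
    ((h3.sub (Lp.aestronglyMeasurable (Φ' x))).enorm.pow_const 2)).1 h4
  filter_upwards [h4] with y hy
  simpa [sub_eq_zero] using hy

/-- Every element of `L²(μ; L²(ν))` is represented by an element of `L²(μ ⊗ ν)`. -/
lemma exists_isLift (Φ : Lp (Lp F 2 ν) 2 μ) [CompleteSpace F] :
    ∃ f : Lp F 2 (μ.prod ν), IsLift f Φ := by
  refine Lp.induction (by norm_num) (motive := fun Φ => ∃ f : Lp F 2 (μ.prod ν), IsLift f Φ)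
    ?_ ?_ ?_ Φ
  · intro c s hs hμs
    have hcm : AEStronglyMeasurable (fun z : X × Y => s.indicator (fun _ => c z.2) z.1)
        (μ.prod ν) := by
      have := ((Lp.aestronglyMeasurable c).comp_snd (μ := μ)).indicator (measurable_fst hs)
      exact this
    have hL : MemLp (fun z : X × Y => s.indicator (fun _ => c z.2) z.1) 2 (μ.prod ν) := by
      refine ⟨hcm, ?_⟩
      refine (ENNReal.pow_lt_top_iff (n := 2).1 ?_).resolve_right two_ne_zero
      have e := eLpNorm_nnreal_pow_eq_lintegral (μ := μ.prod ν) (p := 2)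
        (f := fun z : X × Y => s.indicator (fun _ => c z.2) z.1) (by norm_num)
      simp only [ENNReal.coe_ofNat, NNReal.coe_ofNat, ENNReal.rpow_ofNat] at e
      rw [e, lintegral_prod _ (hcm.enorm.pow_const 2)]
      have e2 : ∀ x, ∫⁻ y, ‖s.indicator (fun _ => c y) x‖ₑ ^ 2 ∂ν =
          s.indicator (fun _ => ‖c‖ₑ ^ 2) x := fun x => by
        by_cases hx : x ∈ s
        · simp [hx, enorm_sq_eq_lintegral]
        · simp [hx]
      simp only [e2]
      rw [lintegral_indicator_const hs]
      exact ENNReal.mul_lt_top (ENNReal.pow_lt_top enorm_lt_top) hμs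
    refine ⟨hL.toLp _, ?_⟩
    have hc : ⇑(Lp.simpleFunc.indicatorConst 2 hs hμs.ne c : Lp (Lp F 2 ν) 2 μ) =ᵐ[μ]
        s.indicator fun _ => c := by
      rw [Lp.simpleFunc.coe_indicatorConst]
      exact indicatorConstLp_coeFn
    filter_upwards [ae_ae_of_eq hL.coeFn_toLp, hc] with x h1 h2
    rw [h2]
    refine h1.trans ?_
    by_cases hx : x ∈ s
    · simp [hx]
    · simp only [hx, not_false_eq_true, indicator_of_notMem]
      exact (Lp.coeFn_zero _ _ _).symm
  · rintro f g hf hg - ⟨f', h1⟩ ⟨g', h2⟩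
    exact ⟨f' + g', h1.add h2⟩
  · refine isClosed_of_closure_subset fun Φ' hΦ' => ?_
    obtain ⟨Φ, hΦ, hlim⟩ := mem_closure_iff_seq_limit.1 hΦ'
    choose f hf using hΦ
    have hd : ∀ n k, edist (f n) (f k) = edist (Φ n) (Φ k) := fun n k => by
      rw [edist_eq_enorm_sub, edist_eq_enorm_sub]
      exact ((hf n).sub (hf k)).enorm_eq
    have hc : CauchySeq f := by
      have := hlim.cauchySeq
      rw [EMetric.cauchySeq_iff] at this ⊢
      simpa only [hd] using this
    obtain ⟨f', hf'⟩ := cauchySeq_tendsto_of_complete hc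
    exact ⟨f', IsLift.of_tendsto hf hf' hlim⟩

end Lift

/-! ### A Riesz argument of Lions type for the half-line problem -/

section Lions

/-- The bound makes `l` factor through `A` as a continuous functional on the range, which is
extended by Hahn–Banach and represented by Riesz. -/
lemma exists_riesz_of_bound {V E : Type*} [AddCommGroup V] [Module ℝ V] [NormedAddCommGroup E]
    [InnerProductSpace ℝ E] [CompleteSpace E] (A : V →ₗ[ℝ] E) (l : V →ₗ[ℝ] ℝ) (C : ℝ)
    (h : ∀ p, |l p| ≤ C * ‖A p‖) : ∃ F : E, ∀ p, ⟪F, A p⟫_ℝ = l p := by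
  have hker : LinearMap.ker A ≤ LinearMap.ker l := fun p hp => by
    have := h p
    rw [LinearMap.mem_ker.1 hp, norm_zero, mul_zero] at this
    exact LinearMap.mem_ker.2 (abs_nonpos_iff.1 this)
  let r : LinearMap.range A →ₗ[ℝ] ℝ :=
    (LinearMap.ker A).liftQ l hker ∘ₗ A.quotKerEquivRange.symm.toLinearMap
  have hr : ∀ p, r ⟨A p, LinearMap.mem_range_self A p⟩ = l p := fun p => by
    simp only [r, LinearMap.comp_apply, LinearEquiv.coe_coe]
    rw [LinearMap.quotKerEquivRange_symm_apply_image A p (LinearMap.mem_range_self A p)]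
    rfl
  let R : StrongDual ℝ (LinearMap.range A) := r.mkContinuous C fun y => by
    obtain ⟨y, p, rfl⟩ := y
    rw [hr]
    exact h p
  obtain ⟨g, hg, -⟩ := exists_extension_norm_eq _ R
  refine ⟨(InnerProductSpace.toDual ℝ E).symm g, fun p => ?_⟩
  rw [InnerProductSpace.toDual_symm_apply]
  exact (hg ⟨A p, LinearMap.mem_range_self A p⟩).trans (hr p)

variable {H : Type*} [NormedAddCommGroup H] [InnerProductSpace ℝ H]

/-- Compactly supported `C¹` paths with initial value in a given subspace. -/
def testPath (Hp : Submodule ℝ H) : Submodule ℝ (ℝ → H) where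
  carrier := {p | ContDiff ℝ 1 p ∧ HasCompactSupport p ∧ p 0 ∈ Hp}
  add_mem' := fun ⟨h1, h2, h3⟩ ⟨g1, g2, g3⟩ => ⟨h1.add g1, h2.add g2, Hp.add_mem h3 g3⟩
  zero_mem' := ⟨contDiff_const, HasCompactSupport.zero, Hp.zero_mem⟩
  smul_mem' := fun c _ ⟨h1, h2, h3⟩ => ⟨contDiff_const.smul h1, h2.smul_left, Hp.smul_mem c h3⟩

lemma testPath_memLp {Hp : Submodule ℝ H} (T : H →L[ℝ] H) {p : ℝ → H} (hp : p ∈ testPath Hp) :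
    MemLp (fun x => T (p x)) 2 (volume.restrict (Ioi (0 : ℝ))) := by
  refine Continuous.memLp_of_hasCompactSupport (T.continuous.comp hp.1.continuous) ?_
  exact hp.2.1.comp_left T.map_zero

lemma testPath_memLp_deriv {Hp : Submodule ℝ H} (T : H →L[ℝ] H) {p : ℝ → H}
    (hp : p ∈ testPath Hp) :
    MemLp (fun x => T (deriv p x)) 2 (volume.restrict (Ioi (0 : ℝ))) := by
  refine Continuous.memLp_of_hasCompactSupport
    (T.continuous.comp (hp.1.continuous_deriv le_rfl)) ?_
  exact hp.2.1.deriv.comp_left T.map_zero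

/-- By the symmetry relation of `M` and `N`, the derivative of `⟨M p, N p⟩` is `2 ⟨M p, N p'⟩`, and
`p` has compact support. -/
lemma testPath_energy {Hp : Submodule ℝ H} {M N : H →L[ℝ] H}
    (hMN : ∀ x y, ⟪M x, N y⟫_ℝ = ⟪N x, M y⟫_ℝ) {p : ℝ → H} (hp : p ∈ testPath Hp) :
    2 * ∫ x in Ioi (0 : ℝ), ⟪M (p x), N (deriv p x)⟫_ℝ = - ⟪M (p 0), N (p 0)⟫_ℝ := by
  have hM : ContDiff ℝ 1 fun x => M (p x) := M.contDiff.comp hp.1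
  have hN : ContDiff ℝ 1 fun x => N (p x) := N.contDiff.comp hp.1
  have h1 : ContDiff ℝ 1 fun x => ⟪M (p x), N (p x)⟫_ℝ := hM.inner ℝ hN
  have h2 : HasCompactSupport fun x => ⟪M (p x), N (p x)⟫_ℝ :=
    hp.2.1.comp_left (g := fun y => ⟪M y, N y⟫_ℝ) (by simp)
  have h3 := HasCompactSupport.integral_Ioi_deriv_eq h1 h2 0
  rw [← h3, ← integral_const_mul]
  refine integral_congr_ae (ae_of_all _ fun x => ?_)
  have hd : HasDerivAt p (deriv p x) x := (hp.1.differentiable (by norm_num) x).hasDerivAt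
  have e := ((M.hasFDerivAt.comp_hasDerivAt x hd).inner ℝ (N.hasFDerivAt.comp_hasDerivAt x hd)).deriv
  simp only [Function.comp_def] at e
  simp only [e]
  rw [hMN (deriv p x) (p x), real_inner_comm (M (p x)) (N (deriv p x)), ← two_mul]

/-- For `A p = K M p - N p'`, the pairing of `A p` with `M p` equals `∫ ⟨K M p, M p⟩` plus half the
boundary term `⟨M p(0), N p(0)⟩ ≥ 0`. So `‖A p‖` controls first `‖M p‖`, by coercivity, and then the
boundary term, which dominates the boundary functional. Working with the two operators `M` and `N`
in place of a quotient keeps all of them bounded. -/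
lemma exists_lions [CompleteSpace H] {K M N : H →L[ℝ] H} {c : ℝ} (hc : 0 < c)
    (hK : ∀ x, c * ‖x‖ ^ 2 ≤ ⟪K x, x⟫_ℝ) (hMN : ∀ x y, ⟪M x, N y⟫_ℝ = ⟪N x, M y⟫_ℝ)
    (Hp : Submodule ℝ H) (l : H →ₗ[ℝ] ℝ) {C : ℝ} (hC : 0 ≤ C)
    (h0 : ∀ q ∈ Hp, 0 ≤ ⟪M q, N q⟫_ℝ) (hl : ∀ q ∈ Hp, l q ^ 2 ≤ C * ⟪M q, N q⟫_ℝ) :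
    ∃ F : Lp H 2 (volume.restrict (Ioi (0 : ℝ))), ∀ (ζ : ℝ → ℝ) (q : H), ContDiff ℝ ∞ ζ →
      HasCompactSupport ζ → ζ 0 • q ∈ Hp →
      ∫ x in Ioi (0 : ℝ), ⟪F x, ζ x • K (M q) - deriv ζ x • N q⟫_ℝ = ζ 0 * l q := by
  have hA : ∀ p : testPath Hp, MemLp (fun x => K (M (p.1 x)) - N (deriv p.1 x)) 2
      (volume.restrict (Ioi (0 : ℝ))) := fun p =>
    (testPath_memLp (K ∘L M) p.2).sub (testPath_memLp_deriv N p.2)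
  have hdiff : ∀ (p : testPath Hp) x, DifferentiableAt ℝ p.1 x := fun p x =>
    p.2.1.differentiable (by norm_num) x
  let A : testPath Hp →ₗ[ℝ] Lp H 2 (volume.restrict (Ioi (0 : ℝ))) :=
    { toFun := fun p => (hA p).toLp _
      map_add' := fun p q => by
        rw [← MemLp.toLp_add]
        refine MemLp.toLp_congr _ _ (ae_of_all _ fun x => ?_)
        have e : deriv (p + q).1 x = deriv p.1 x + deriv q.1 x := deriv_add (hdiff p x) (hdiff q x)
        beta_reduce
        rw [e]
        simp only [Submodule.coe_add, Pi.add_apply, map_add]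
        abel
      map_smul' := fun a p => by
        rw [RingHom.id_apply, ← MemLp.toLp_const_smul]
        refine MemLp.toLp_congr _ _ (ae_of_all _ fun x => ?_)
        have e : deriv (a • p).1 x = a • deriv p.1 x := deriv_const_smul a (hdiff p x)
        beta_reduce
        rw [e]
        simp only [Submodule.coe_smul, Pi.smul_apply, map_smul, smul_sub] }
  let ev : testPath Hp →ₗ[ℝ] ℝ := l ∘ₗ (LinearMap.proj 0 ∘ₗ (testPath Hp).subtype)
  have hev : ∀ p, ev p = l (p.1 0) := fun p => rfl
  have key : ∀ p : testPath Hp, ev p ^ 2 ≤ 2 * C / c * ‖A p‖ ^ 2 := fun p => by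
    have hM := testPath_memLp M p.2
    obtain ⟨P, hP⟩ : ∃ P, P = hM.toLp _ := ⟨_, rfl⟩
    have e1 : ⟪P, A p⟫_ℝ =
        (∫ x in Ioi (0 : ℝ), ⟪K (M (p.1 x)), M (p.1 x)⟫_ℝ) + ⟪M (p.1 0), N (p.1 0)⟫_ℝ / 2 := by
      have e2 := testPath_energy hMN p.2
      have e3 : ⟪P, A p⟫_ℝ = ∫ x in Ioi (0 : ℝ), ⟪M (p.1 x), K (M (p.1 x)) - N (deriv p.1 x)⟫_ℝ := by
        rw [hP]; exact inner_toLp hM (hA p)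
      rw [e3]
      simp only [inner_sub_right]
      refine (integral_sub (integrable_inner hM (testPath_memLp (K ∘L M) p.2))
        (integrable_inner hM (testPath_memLp_deriv N p.2))).trans ?_
      have e4 : (∫ x in Ioi (0 : ℝ), ⟪M (p.1 x), (K ∘L M) (p.1 x)⟫_ℝ) =
          ∫ x in Ioi (0 : ℝ), ⟪K (M (p.1 x)), M (p.1 x)⟫_ℝ :=
        integral_congr_ae (ae_of_all _ fun x => real_inner_comm _ _)
      linarith
    have e5 : c * ‖P‖ ^ 2 ≤ ∫ x in Ioi (0 : ℝ), ⟪K (M (p.1 x)), M (p.1 x)⟫_ℝ := by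
      rw [← real_inner_self_eq_norm_sq, hP, inner_toLp, ← integral_const_mul]
      refine integral_mono ((integrable_inner hM hM).const_mul c)
        (integrable_inner (testPath_memLp (K ∘L M) p.2) hM) fun x => ?_
      simp only [real_inner_self_eq_norm_sq]
      exact hK _
    have e6 : ⟪P, A p⟫_ℝ ≤ ‖P‖ * ‖A p‖ := real_inner_le_norm _ _
    have e7 := h0 _ p.2.2.2
    have e8 : c * ‖P‖ ≤ ‖A p‖ := by
      by_contra! hcon
      have hPpos : 0 < ‖P‖ := by
        by_contra! h
        have : ‖P‖ = 0 := le_antisymm h (norm_nonneg _)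
        rw [this, mul_zero] at hcon
        exact absurd hcon (not_lt.2 (norm_nonneg _))
      nlinarith
    -- The boundary term is at most `2 ‖P‖ ‖A p‖`, and `c ‖P‖ ≤ ‖A p‖`.
    have e9 : c * ⟪M (p.1 0), N (p.1 0)⟫_ℝ ≤ 2 * ‖A p‖ ^ 2 := by
      have : 0 ≤ c * ‖P‖ ^ 2 := by positivity
      have h1 : ⟪M (p.1 0), N (p.1 0)⟫_ℝ ≤ 2 * (‖P‖ * ‖A p‖) := by linarith
      nlinarith [norm_nonneg (A p)]
    rw [hev]
    refine (hl _ p.2.2.2).trans ?_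
    rw [div_mul_eq_mul_div, le_div_iff₀ hc]
    calc C * ⟪M (p.1 0), N (p.1 0)⟫_ℝ * c = C * (c * ⟪M (p.1 0), N (p.1 0)⟫_ℝ) := by ring
      _ ≤ C * (2 * ‖A p‖ ^ 2) := mul_le_mul_of_nonneg_left e9 hC
      _ = 2 * C * ‖A p‖ ^ 2 := by ring
  have hb : ∀ p, |ev p| ≤ Real.sqrt (2 * C / c) * ‖A p‖ := fun p => by
    rw [← Real.sqrt_sq (norm_nonneg (A p)), ← Real.sqrt_mul (by positivity)]
    exact Real.abs_le_sqrt (key p)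
  obtain ⟨F, hF⟩ := exists_riesz_of_bound A ev _ hb
  refine ⟨F, fun ζ q hζ hζs hq => ?_⟩
  have hp : (fun x => ζ x • q) ∈ testPath Hp :=
    ⟨(hζ.of_le (by exact_mod_cast le_top)).smul contDiff_const, hζs.smul_right, hq⟩
  have e := hF ⟨_, hp⟩
  rw [hev] at e
  simp only [map_smul, smul_eq_mul] at e
  rw [← e, L2.inner_def]
  refine integral_congr_ae ?_
  filter_upwards [(hA ⟨_, hp⟩).coeFn_toLp] with x hx
  change _ = ⟪F x, ((hA ⟨_, hp⟩).toLp _ : Lp H 2 (volume.restrict (Ioi (0 : ℝ)))) x⟫_ℝ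
  rw [hx]
  have hd : deriv (fun x => ζ x • q) x = deriv ζ x • q :=
    (((hζ.differentiable (by norm_num) x).hasDerivAt).smul_const q).deriv
  simp only [hd, map_smul]

end Lions

/-! ### Weak solutions with prescribed incoming data -/

section Exist

variable {d m : ℕ} [NeZero d] {𝕍 : Set (Vel d)} {ω₀ u : ℝ}

/-- The ratio of the speed and the weight. -/
def ratio (ω₀ u : ℝ) (v : Vel d) : ℝ := speed u v * (weight ω₀ v)⁻¹

lemma continuous_ratio (ω₀ u : ℝ) : Continuous (ratio ω₀ u : Vel d → ℝ) :=
  (continuous_speed u).mul (continuous_weight_inv ω₀)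

lemma ratio_pos {v : Vel d} (h : 0 < speed u v) : 0 < ratio ω₀ u v :=
  mul_pos h (inv_pos.2 (weight_pos ω₀ v))

/-- `1 / (1 + |β|)`. -/
def dampM (ω₀ u : ℝ) (v : Vel d) : ℝ := (1 + |ratio ω₀ u v|)⁻¹

/-- `β / (1 + |β|)`. -/
def dampN (ω₀ u : ℝ) (v : Vel d) : ℝ := ratio ω₀ u v * (1 + |ratio ω₀ u v|)⁻¹

lemma isMultiplier_dampM (ω₀ u : ℝ) : IsMultiplier (dampM ω₀ u : Vel d → ℝ) := by
  refine ⟨(measurable_const.add (continuous_ratio ω₀ u).abs.measurable).inv, fun v => ?_⟩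
  have h : 0 ≤ |ratio ω₀ u v| := abs_nonneg _
  rw [dampM, abs_of_nonneg (by positivity)]
  exact inv_le_one_of_one_le₀ (by linarith)

lemma isMultiplier_dampN (ω₀ u : ℝ) : IsMultiplier (dampN ω₀ u : Vel d → ℝ) := by
  refine ⟨(continuous_ratio ω₀ u).measurable.mul
    (measurable_const.add (continuous_ratio ω₀ u).abs.measurable).inv, fun v => ?_⟩
  have h : 0 ≤ |ratio ω₀ u v| := abs_nonneg _
  rw [dampN, abs_mul, abs_inv, abs_of_nonneg (by positivity : 0 ≤ 1 + |ratio ω₀ u v|),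
    ← div_eq_mul_inv]
  exact div_le_one_of_le₀ (by linarith) (by positivity)

lemma isMultiplier_sqrt_mul {g h : Vel d → ℝ} (hg : IsMultiplier g) (hh : IsMultiplier h) :
    IsMultiplier (fun v => Real.sqrt (g v * h v)) := by
  refine ⟨(hg.1.mul hh.1).sqrt, fun v => ?_⟩
  rw [abs_of_nonneg (Real.sqrt_nonneg _)]
  refine Real.sqrt_le_one.2 ((le_abs_self _).trans ?_)
  rw [abs_mul]
  exact mul_le_one₀ (hg.2 v) (abs_nonneg _) (hh.2 v)

lemma mulOp_inner_mulOp {g h : Vel d → ℝ} (hg : IsMultiplier g) (hh : IsMultiplier h)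
    (F G : L2v 𝕍 m) : ⟪mulOp hg F, mulOp hh G⟫_ℝ = ∫ v, g v * h v * ⟪F v, G v⟫_ℝ ∂dv 𝕍 := by
  rw [inner_eq_integral]
  refine integral_congr_ae ?_
  filter_upwards [mulOp_coe hg F, mulOp_coe hh G] with v h1 h2
  rw [h1, h2, inner_smul_left, inner_smul_right, RCLike.conj_to_real, mul_assoc]

/-- Functions that vanish for outgoing velocities. -/
def incoming (𝕍 : Set (Vel d)) (m : ℕ) (u : ℝ) : Submodule ℝ (L2v 𝕍 m) where
  carrier := {q | ∀ᵐ v ∂dv 𝕍, speed u v ≤ 0 → q v = 0}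
  add_mem' := fun {p q} hp hq => by
    filter_upwards [hp, hq, Lp.coeFn_add p q] with v h1 h2 h3 hv
    rw [h3, Pi.add_apply, h1 hv, h2 hv, add_zero]
  zero_mem' := by
    filter_upwards [Lp.coeFn_zero (Val m) 2 (dv 𝕍)] with v h1 _
    rw [h1, Pi.zero_apply]
  smul_mem' := fun c q hq => by
    filter_upwards [hq, Lp.coeFn_smul c q] with v h1 h2 hv
    rw [h2, Pi.smul_apply, h1 hv, smul_zero]

lemma measurableSet_incoming (u : ℝ) : MeasurableSet {v : Vel d | 0 < speed u v} :=
  measurableSet_lt measurable_const (continuous_speed u).measurable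

/-- With `β = (v₁ + u) / a`, the multipliers are `m = 1 / (1 + |β|)` and `n = β / (1 + |β|)`. For
incoming `q` the form `⟨M q, N q⟩` is `‖√(m n) q‖²`. Since `√(v₁ + u) √(m n) = √a n` there, the
functional equals the pairing of `√(v₁ + u) φ` with `√(m n) q`, and Cauchy–Schwarz bounds it by the
incoming flux of `φ`. -/
lemma exists_incoming_functional {φ : Vel d → Val m} (hφ : IncomingData 𝕍 ω₀ u φ) :
    ∃ (P : L2v 𝕍 m) (C : ℝ), 0 ≤ C ∧
      P =ᵐ[dv 𝕍] {v | 0 < speed u v}.indicator (fun v => Real.sqrt (weight ω₀ v) • φ v) ∧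
      ∀ q ∈ incoming 𝕍 m u,
        0 ≤ ⟪mulOp (isMultiplier_dampM ω₀ u) q, mulOp (isMultiplier_dampN ω₀ u) q⟫_ℝ ∧
        ⟪P, mulOp (isMultiplier_dampN ω₀ u) q⟫_ℝ ^ 2 ≤
          C * ⟪mulOp (isMultiplier_dampM ω₀ u) q, mulOp (isMultiplier_dampN ω₀ u) q⟫_ℝ := by
  have hP := (memLp_indicator_iff_restrict (measurableSet_incoming u)).2 hφ.1.memLp_smul
  have hB := (memLp_indicator_iff_restrict (measurableSet_incoming u)).2 hφ.2.memLp_smul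
  have hR := isMultiplier_sqrt_mul (isMultiplier_dampM (d := d) ω₀ u) (isMultiplier_dampN ω₀ u)
  refine ⟨hP.toLp _, ‖hB.toLp _‖ ^ 2, sq_nonneg _, hP.coeFn_toLp, fun q hq => ?_⟩
  have e : ⟪mulOp (isMultiplier_dampM ω₀ u) q, mulOp (isMultiplier_dampN ω₀ u) q⟫_ℝ =
      ‖mulOp hR q‖ ^ 2 := by
    rw [← real_inner_self_eq_norm_sq, mulOp_inner_mulOp, mulOp_inner_mulOp]
    refine integral_congr_ae ?_
    filter_upwards [hq] with v h1
    rcases le_or_gt (speed u v) 0 with h | h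
    · simp [h1 h]
    · have h2 := ratio_pos (ω₀ := ω₀) h
      rw [Real.mul_self_sqrt]
      unfold dampM dampN
      positivity
  rw [e]
  refine ⟨sq_nonneg _, ?_⟩
  have e2 : ⟪hP.toLp _, mulOp (isMultiplier_dampN ω₀ u) q⟫_ℝ = ⟪hB.toLp _, mulOp hR q⟫_ℝ := by
    rw [inner_eq_integral, inner_eq_integral]
    refine integral_congr_ae ?_
    filter_upwards [hP.coeFn_toLp, hB.coeFn_toLp, mulOp_coe (isMultiplier_dampN ω₀ u) q,
      mulOp_coe hR q] with v h1 h2 h3 h4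
    rw [h1, h2, h3, h4]
    by_cases h : 0 < speed u v
    · have hw := weight_pos ω₀ v
      have hr := ratio_pos (ω₀ := ω₀) h
      simp only [indicator, mem_ofPred_eq, h, if_true, inner_smul_left, inner_smul_right,
        RCLike.conj_to_real, ← mul_assoc]
      congr 1
      have e3 : Real.sqrt (speed u v) = Real.sqrt (weight ω₀ v) * Real.sqrt (ratio ω₀ u v) := by
        rw [← Real.sqrt_mul hw.le, ratio]
        congr 1
        field_simp
      have e4 : Real.sqrt (dampM ω₀ u v * dampN ω₀ u v) =
          Real.sqrt (ratio ω₀ u v) * (1 + |ratio ω₀ u v|)⁻¹ := by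
        rw [dampM, dampN, ← mul_assoc, mul_comm (1 + |ratio ω₀ u v|)⁻¹, mul_assoc,
          Real.sqrt_mul hr.le, Real.sqrt_mul_self (by positivity)]
      rw [e3, e4, dampN]
      have e5 := Real.mul_self_sqrt hr.le
      linear_combination (-(1 + |ratio ω₀ u v|)⁻¹ * Real.sqrt (weight ω₀ v)) * e5
    · simp [indicator, h]
  rw [e2]
  have := real_inner_le_norm (hB.toLp _) (mulOp hR q)
  rw [← mul_pow, ← sq_abs]
  exact pow_le_pow_left₀ (abs_nonneg _) (abs_real_inner_le_norm _ _) 2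

lemma memWL2_indicator_tensor {ρ : Vel d → ℝ} (hρ : Continuous ρ) {A : Set (Vel d)}
    (hA : MeasurableSet A) {ζ : ℝ → ℝ} {χ : Vel d → ℝ} (h1 : Continuous ζ) (h2 : Continuous χ)
    (h3 : HasCompactSupport ζ) (h4 : HasCompactSupport χ) (e : Val m) :
    MemWL2 (fun z : ℝ × Vel d => ρ z.2)
      (fun z => A.indicator (fun v => (ζ z.1 * χ v) • e) z.2) (dxdv 𝕍) := by
  have hc : Continuous fun z : ℝ × Vel d => (ζ z.1 * χ z.2) • e :=
    ((h1.comp continuous_fst).mul (h2.comp continuous_snd)).smul continuous_const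
  have h := memWL2_dxdv_of_continuous (𝕍 := 𝕍) hρ hc (hasCompactSupport_tensor h3 h4 e)
  refine (memLp_congr_ae (ae_of_all _ fun z => ?_)).1 (h.memLp_smul.indicator (measurable_snd hA))
  by_cases hz : z.2 ∈ A <;> simp [hz, indicator]

/-- The data of a weak solution of the problem with a bounded operator `K`. -/
lemma exists_weak_solution {K : L2v 𝕍 m →L[ℝ] L2v 𝕍 m} {c : ℝ} (hc : 0 < c)
    (hK : ∀ F, c * ‖F‖ ^ 2 ≤ ⟪K F, F⟫_ℝ) (hsymm : ∀ F G, ⟪K F, G⟫_ℝ = ⟪F, K G⟫_ℝ)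
    {φ : Vel d → Val m} (hφ : IncomingData 𝕍 ω₀ u φ) :
    ∃ (f w : ℝ × Vel d → Val m) (_ : MemWL2 (fun z => weight ω₀ z.2) f (dxdv 𝕍))
      (_ : MemWL2 (fun z => (weight ω₀ z.2)⁻¹) w (dxdv 𝕍)),
      (∀ᵐ x ∂volume.restrict (Ioi (0 : ℝ)),
        ∃ (hf : MemWL2 (weight ω₀) (fun v => f (x, v)) (dv 𝕍))
          (hw : MemWL2 (fun v => (weight ω₀ v)⁻¹) (fun v => w (x, v)) (dv 𝕍)),
          hw.toL2 = - K hf.toL2) ∧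
      ∀ (A : Set (Vel d)), MeasurableSet A → ∀ (ζ : ℝ → ℝ) (χ : Vel d → ℝ) (e : Val m),
        ContDiff ℝ ∞ ζ → HasCompactSupport ζ → ContDiff ℝ ∞ χ → HasCompactSupport χ →
        (ζ 0 = 0 ∨ A ⊆ {v | 0 < speed u v}) →
        ∫ z, (⟪w z, A.indicator (fun v => (ζ z.1 * χ v) • e) z.2⟫_ℝ +
          ⟪f z, A.indicator (fun v => (deriv ζ z.1 * (speed u v * χ v)) • e) z.2⟫_ℝ) ∂dxdv 𝕍 =
        - (ζ 0 * ∫ v in {v | 0 < speed u v}, speed u v *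
          ⟪φ v, A.indicator (fun v => χ v • e) v⟫_ℝ ∂dv 𝕍) := by
  obtain ⟨P, C, hC, hP, hbd⟩ := exists_incoming_functional hφ
  set M := mulOp (𝕍 := 𝕍) (m := m) (isMultiplier_dampM (d := d) ω₀ u) with hM
  set N := mulOp (𝕍 := 𝕍) (m := m) (isMultiplier_dampN (d := d) ω₀ u) with hN
  have hMN : ∀ x y, ⟪M x, N y⟫_ℝ = ⟪N x, M y⟫_ℝ := fun x y => by
    rw [hM, hN, mulOp_inner_mulOp, mulOp_inner_mulOp]
    exact integral_congr_ae (ae_of_all _ fun v => by simp only [mul_comm (dampM ω₀ u v)])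
  obtain ⟨F, hF⟩ := exists_lions hc hK hMN (incoming 𝕍 m u)
    ((innerSL ℝ P).toLinearMap ∘ₗ N.toLinearMap) hC (fun q hq => (hbd q hq).1)
    (fun q hq => (hbd q hq).2)
  -- Both `F` and `-K F` are realized as functions of `(x, v)`; undoing the scaling gives `f` and
  -- `w`.
  obtain ⟨f', hf'⟩ := exists_isLift F
  obtain ⟨g', hg'⟩ := exists_isLift ((-K).compLp F)
  have hsw : ∀ v : Vel d, Real.sqrt (weight ω₀ v)⁻¹ * Real.sqrt (weight ω₀ v) = 1 := fun v => by
    rw [mul_comm, sqrt_weight_mul_inv]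
  set f : ℝ × Vel d → Val m := fun z => Real.sqrt (weight ω₀ z.2)⁻¹ • f' z with hfdef
  set w : ℝ × Vel d → Val m := fun z => Real.sqrt (weight ω₀ z.2) • g' z with hwdef
  have hf : MemWL2 (fun z => weight ω₀ z.2) f (dxdv 𝕍) := by
    refine (memLp_congr_ae (ae_of_all _ fun z => ?_)).1 (Lp.memLp f')
    simp only [hfdef, smul_smul, sqrt_weight_mul_inv, one_smul]
  have hw : MemWL2 (fun z => (weight ω₀ z.2)⁻¹) w (dxdv 𝕍) := by
    refine (memLp_congr_ae (ae_of_all _ fun z => ?_)).1 (Lp.memLp g')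
    simp only [hwdef, smul_smul, hsw, one_smul]
  have hslice : ∀ᵐ x ∂volume.restrict (Ioi (0 : ℝ)),
        ∃ (hf : MemWL2 (weight ω₀) (fun v => f (x, v)) (dv 𝕍))
          (hw : MemWL2 (fun v => (weight ω₀ v)⁻¹) (fun v => w (x, v)) (dv 𝕍)),
          hf.toL2 = F x ∧ hw.toL2 = - K (F x) := by
    filter_upwards [hf', hg', ContinuousLinearMap.coeFn_compLp (-K) F] with x h1 h2 h3
    rw [h3] at h2
    have a1 : (fun v => Real.sqrt (weight ω₀ v) • f (x, v)) =ᵐ[dv 𝕍] F x := by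
      filter_upwards [h1] with v hv
      simp only [hfdef, smul_smul, sqrt_weight_mul_inv, one_smul, hv]
    have a2 : (fun v => Real.sqrt (weight ω₀ v)⁻¹ • w (x, v)) =ᵐ[dv 𝕍] (- K (F x) : L2v 𝕍 m) := by
      filter_upwards [h2] with v hv
      simp only [hwdef, smul_smul, hsw, one_smul, hv]
      rfl
    have b1 : MemWL2 (weight ω₀) (fun v => f (x, v)) (dv 𝕍) :=
      (memLp_congr_ae a1).2 (Lp.memLp (F x))
    have b2 : MemWL2 (fun v => (weight ω₀ v)⁻¹) (fun v => w (x, v)) (dv 𝕍) :=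
      (memLp_congr_ae a2).2 (Lp.memLp (- K (F x)))
    exact ⟨b1, b2, Lp.ext (b1.coeFn_toL2.trans a1), Lp.ext (b2.coeFn_toL2.trans a2)⟩
  refine ⟨f, w, hf, hw, ?_, fun A hA ζ χ e hζ hζs hχ hχs hcase => ?_⟩
  · filter_upwards [hslice] with x ⟨h1, h2, h3, h4⟩
    exact ⟨h1, h2, by rw [h4, h3]⟩
  -- The factor `(1 + |β|) √a` is chosen so that `M q = √a χ e` and `N q = a^{-1/2} (v₁ + u) χ e` on
  -- `A`.
  have hq : MemLp (A.indicator fun v => ((1 + |ratio ω₀ u v|) * Real.sqrt (weight ω₀ v) * χ v) • e)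
      2 (dv 𝕍) := by
    refine MemLp.indicator hA (Continuous.memLp_of_hasCompactSupport ?_ ?_)
    · exact (((continuous_const.add (continuous_ratio ω₀ u).abs).mul
        (continuous_weight ω₀).sqrt).mul hχ.continuous).smul continuous_const
    · exact (HasCompactSupport.mul_left hχs).smul_right
  set q : L2v 𝕍 m := hq.toLp _ with hqdef
  have hMq : M q =ᵐ[dv 𝕍] A.indicator fun v => (Real.sqrt (weight ω₀ v) * χ v) • e := by
    filter_upwards [mulOp_coe (isMultiplier_dampM ω₀ u) q, hq.coeFn_toLp] with v h1 h2
    rw [h1, hqdef, h2]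
    by_cases hv : v ∈ A
    · simp only [hv, indicator_of_mem, smul_smul, dampM]
      congr 1
      have : 0 < 1 + |ratio ω₀ u v| := by positivity
      field_simp
    · simp [hv]
  have hNq : N q =ᵐ[dv 𝕍] A.indicator fun v =>
      (Real.sqrt (weight ω₀ v)⁻¹ * (speed u v * χ v)) • e := by
    filter_upwards [mulOp_coe (isMultiplier_dampN ω₀ u) q, hq.coeFn_toLp] with v h1 h2
    rw [h1, hqdef, h2]
    by_cases hv : v ∈ A
    · simp only [hv, indicator_of_mem, smul_smul, dampN]
      congr 1
      have h3 : 0 < 1 + |ratio ω₀ u v| := by positivity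
      have h4 : ratio ω₀ u v * Real.sqrt (weight ω₀ v) = speed u v * Real.sqrt (weight ω₀ v)⁻¹ := by
        have h5 := weight_pos ω₀ v
        rw [ratio, Real.sqrt_inv]
        have h6 := Real.sqrt_pos.2 h5
        have h7 := Real.mul_self_sqrt h5.le
        field_simp
        rw [sq, h7]
      calc _ = ratio ω₀ u v * Real.sqrt (weight ω₀ v) * χ v *
            ((1 + |ratio ω₀ u v|)⁻¹ * (1 + |ratio ω₀ u v|)) := by ring
        _ = _ := by rw [h4, inv_mul_cancel₀ h3.ne']; ring
    · simp [hv]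
  -- Admissible paths start in the incoming subspace: either they start at zero, or the cut-off set
  -- consists of incoming velocities.
  have hmem : ζ 0 • q ∈ incoming 𝕍 m u := by
    rcases hcase with h | h
    · rw [h, zero_smul]; exact zero_mem _
    · refine Submodule.smul_mem _ _ ?_
      filter_upwards [hq.coeFn_toLp] with v h2 hv
      rw [h2, indicator_of_notMem]
      intro hvA
      exact absurd (h hvA) (not_lt.2 hv)
  have key := hF ζ q hζ hζs hmem
  have hI1 : Integrable (fun z => ⟪w z, A.indicator (fun v => (ζ z.1 * χ v) • e) z.2⟫_ℝ)
      (dxdv 𝕍) := by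
    exact integrable_energy' (memWL2_indicator_tensor (continuous_weight ω₀) hA hζ.continuous
      hχ.continuous hζs hχs e) hw
  have hI2 : Integrable (fun z => ⟪f z, A.indicator
      (fun v => (deriv ζ z.1 * (speed u v * χ v)) • e) z.2⟫_ℝ) (dxdv 𝕍) := by
    exact integrable_energy hf (memWL2_indicator_tensor (continuous_weight_inv ω₀) hA
      (hζ.continuous_deriv (by norm_num)) ((continuous_speed u).mul hχ.continuous)
      hζs.deriv hχs.mul_left e)
  have hl : ((innerSL ℝ P).toLinearMap ∘ₗ N.toLinearMap) q =
      ∫ v in {v | 0 < speed u v}, speed u v * ⟪φ v, A.indicator (fun v => χ v • e) v⟫_ℝ ∂dv 𝕍 := by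
    change ⟪P, N q⟫_ℝ = _
    rw [inner_eq_integral, ← integral_indicator (measurableSet_incoming u)]
    refine integral_congr_ae ?_
    filter_upwards [hP, hNq] with v h1 h2
    rw [h1, h2]
    by_cases hv : 0 < speed u v
    · by_cases hvA : v ∈ A
      · simp only [indicator, mem_ofPred_eq, hv, if_true, hvA, inner_smul_left, inner_smul_right,
          RCLike.conj_to_real]
        have := sqrt_weight_mul_inv ω₀ v
        linear_combination (speed u v * χ v * ⟪φ v, e⟫_ℝ) * this
      · simp [indicator, hvA]
    · simp [indicator, hv]
  rw [hl] at key
  rw [← key, ← integral_neg]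
  refine (integral_prod _ (hI1.add hI2)).trans (integral_congr_ae ?_)
  filter_upwards [hslice, hI1.prod_right_ae, hI2.prod_right_ae] with x ⟨h1, h2, h3, h4⟩ i1 i2
  simp only [Pi.add_apply]
  rw [integral_add i1 i2, inner_sub_right, inner_smul_right, inner_smul_right, ← hsymm, ← h3]
  have e1 : ∫ v, ⟪w (x, v), A.indicator (fun v => (ζ x * χ v) • e) v⟫_ℝ ∂dv 𝕍 =
      - (ζ x * ⟪K h1.toL2, M q⟫_ℝ) := by
    have : K h1.toL2 = - h2.toL2 := by rw [h4, h3, neg_neg]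
    rw [this, inner_neg_left, mul_neg, neg_neg, inner_eq_integral, ← integral_const_mul]
    refine integral_congr_ae ?_
    filter_upwards [h2.coeFn_toL2, hMq] with v a1 a2
    rw [a1, a2]
    by_cases hvA : v ∈ A
    · simp only [hvA, indicator_of_mem, inner_smul_left, inner_smul_right, RCLike.conj_to_real]
      linear_combination (- ζ x * χ v * ⟪w (x, v), e⟫_ℝ) * hsw v
    · simp [hvA]
  have e2 : ∫ v, ⟪f (x, v), A.indicator (fun v => (deriv ζ x * (speed u v * χ v)) • e) v⟫_ℝ ∂dv 𝕍 =
      deriv ζ x * ⟪h1.toL2, N q⟫_ℝ := by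
    rw [inner_eq_integral, ← integral_const_mul]
    refine integral_congr_ae ?_
    filter_upwards [h1.coeFn_toL2, hNq] with v a1 a2
    rw [a1, a2]
    by_cases hvA : v ∈ A
    · simp only [hvA, indicator_of_mem, inner_smul_left, inner_smul_right, RCLike.conj_to_real]
      linear_combination (- deriv ζ x * speed u v * χ v * ⟪f (x, v), e⟫_ℝ) * hsw v
    · simp [hvA]
  rw [e1, e2]
  ring

end Exist

lemma ae_eq_prod_of_ae_ae_right {α β F : Type*} [MeasurableSpace α] [MeasurableSpace β]
    [NormedAddCommGroup F] {μ : Measure α} {ν : Measure β} [SFinite μ] [SFinite ν]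
    {f g : α × β → F} (hf : AEStronglyMeasurable f (μ.prod ν))
    (hg : AEStronglyMeasurable g (μ.prod ν))
    (h : ∀ᵐ x ∂μ, ∀ᵐ y ∂ν, f (x, y) = g (x, y)) : f =ᵐ[μ.prod ν] g := by
  have h1 : ∀ᵐ z ∂μ.prod ν, hf.mk f z = hg.mk g z := by
    rw [Measure.ae_prod_iff_ae_ae
      (hf.stronglyMeasurable_mk.measurableSet_eq_fun hg.stronglyMeasurable_mk)]
    filter_upwards [h, Measure.ae_ae_of_ae_prod hf.ae_eq_mk, Measure.ae_ae_of_ae_prod hg.ae_eq_mk]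
      with x h1 h2 h3
    filter_upwards [h1, h2, h3] with y h1 h2 h3
    rw [← h2, ← h3, h1]
  exact hf.ae_eq_mk.trans (EventuallyEq.trans h1 hg.ae_eq_mk.symm)

/-! ### Solutions of the scaled equation: uniqueness and existence -/

section Solve

variable {d m : ℕ} [NeZero d] {𝕍 : Set (Vel d)} {ω₀ u : ℝ}

/-- `w = (v₁ + u) ∂ₓ f`, with trace `f₀`, and `√a⁻¹ w + K (√a f) = 0` for almost every `x`. -/
structure Solves (ω₀ u : ℝ) (K : L2v 𝕍 m →L[ℝ] L2v 𝕍 m) (f w : ℝ × Vel d → Val m)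
    (f₀ : Vel d → Val m) : Prop where
  source : MemWL2 (fun z => weight ω₀ z.2) f (dxdv 𝕍)
  target : MemWL2 (fun z => (weight ω₀ z.2)⁻¹) w (dxdv 𝕍)
  transport : IsTransport 𝕍 u f w f₀
  trace : MemWL2 (fun v => |speed u v|) f₀ (dv 𝕍)
  eq : ∀ᵐ x ∂volume.restrict (Ioi (0 : ℝ)),
    ∃ (hf : MemWL2 (weight ω₀) (fun v => f (x, v)) (dv 𝕍))
      (hw : MemWL2 (fun v => (weight ω₀ v)⁻¹) (fun v => w (x, v)) (dv 𝕍)),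
      hw.toL2 = - K hf.toL2

variable {K : L2v 𝕍 m →L[ℝ] L2v 𝕍 m} {f w f' w' : ℝ × Vel d → Val m} {f₀ f₀' : Vel d → Val m}

lemma Solves.add (h : Solves ω₀ u K f w f₀) (h' : Solves ω₀ u K f' w' f₀') :
    Solves ω₀ u K (fun z => f z + f' z) (fun z => w z + w' z) (fun v => f₀ v + f₀' v) := by
  refine ⟨h.source.add h'.source, h.target.add h'.target,
    h.transport.add h.target h'.target h'.transport, h.trace.add h'.trace, ?_⟩
  filter_upwards [h.eq, h'.eq] with x ⟨a1, a2, a3⟩ ⟨b1, b2, b3⟩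
  refine ⟨a1.add b1, a2.add b2, ?_⟩
  rw [MemWL2.toL2_add a1 b1, MemWL2.toL2_add a2 b2, a3, b3, map_add, neg_add]

lemma Solves.const_smul (c : ℝ) (h : Solves ω₀ u K f w f₀) :
    Solves ω₀ u K (fun z => c • f z) (fun z => c • w z) (fun v => c • f₀ v) := by
  refine ⟨h.source.const_smul c, h.target.const_smul c, h.transport.const_smul c,
    h.trace.const_smul c, ?_⟩
  filter_upwards [h.eq] with x ⟨a1, a2, a3⟩
  refine ⟨a1.const_smul c, a2.const_smul c, ?_⟩
  rw [MemWL2.toL2_const_smul c a1, MemWL2.toL2_const_smul c a2, a3, map_smul, smul_neg]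

lemma Solves.zero : Solves (𝕍 := 𝕍) (m := m) ω₀ u K (fun _ => 0) (fun _ => 0) (fun _ => 0) := by
  refine ⟨MemWL2.zero, MemWL2.zero, IsTransport.zero, MemWL2.zero, ae_of_all _ fun x => ?_⟩
  refine ⟨MemWL2.zero, MemWL2.zero, ?_⟩
  rw [MemWL2.toL2_zero, MemWL2.toL2_zero, map_zero, neg_zero]

lemma Solves.sub (h : Solves ω₀ u K f w f₀) (h' : Solves ω₀ u K f' w' f₀') :
    Solves ω₀ u K (fun z => f z - f' z) (fun z => w z - w' z) (fun v => f₀ v - f₀' v) := by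
  have := h.add (h'.const_smul (-1))
  simpa only [neg_one_smul, ← sub_eq_add_neg] using this

lemma Solves.sum {ι : Type*} (s : Finset ι) {F W : ι → ℝ × Vel d → Val m} {F₀ : ι → Vel d → Val m}
    (h : ∀ i, Solves ω₀ u K (F i) (W i) (F₀ i)) :
    Solves ω₀ u K (fun z => ∑ i ∈ s, F i z) (fun z => ∑ i ∈ s, W i z)
      (fun v => ∑ i ∈ s, F₀ i v) := by
  classical
  induction s using Finset.induction_on with
  | empty => simpa using Solves.zero
  | insert i s hi ih => simpa only [Finset.sum_insert hi] using (h i).add ih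

/-- A solution without energy influx vanishes. -/
lemma Solves.eq_zero (hω0 : 0 ≤ ω₀) (h : Solves ω₀ u K f w f₀) (hK : ∀ F, 0 ≤ ⟪K F, F⟫_ℝ)
    (hK0 : ∀ F, ⟪K F, F⟫_ℝ = 0 → K F = 0)
    (hin : ∫ v, speed u v * ⟪f₀ v, f₀ v⟫_ℝ ∂dv 𝕍 ≤ 0) :
    f =ᵐ[dxdv 𝕍] (fun _ => 0) ∧ f₀ =ᵐ[dv 𝕍] fun _ => 0 := by
  have hE := h.transport.energy hω0 h.source h.target h.source h.target h.transport
  have hI := (integrable_energy' h.source h.target).add (integrable_energy h.source h.target)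
  have hx : ∀ᵐ x ∂volume.restrict (Ioi (0 : ℝ)),
      ∃ (hf : MemWL2 (weight ω₀) (fun v => f (x, v)) (dv 𝕍))
      (hw : MemWL2 (fun v => (weight ω₀ v)⁻¹) (fun v => w (x, v)) (dv 𝕍)),
      hw.toL2 = - K hf.toL2 ∧ ∫ v, (⟪w (x, v), f (x, v)⟫_ℝ + ⟪f (x, v), w (x, v)⟫_ℝ) ∂dv 𝕍 =
        - (2 * ⟪K hf.toL2, hf.toL2⟫_ℝ) := by
    filter_upwards [h.eq] with x ⟨a1, a2, a3⟩
    refine ⟨a1, a2, a3, ?_⟩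
    have e := a1.inner_toL2 (weight_pos ω₀) a2
    rw [a3, inner_neg_right, real_inner_comm] at e
    have e2 : ∀ v, ⟪w (x, v), f (x, v)⟫_ℝ + ⟪f (x, v), w (x, v)⟫_ℝ = 2 * ⟪f (x, v), w (x, v)⟫_ℝ :=
      fun v => by rw [real_inner_comm]; ring
    simp only [e2]
    rw [integral_const_mul, ← e]
    ring
  have hIx := hI.integral_prod_left
  have e1 : ∫ x in Ioi (0 : ℝ), ∫ v, (⟪w (x, v), f (x, v)⟫_ℝ + ⟪f (x, v), w (x, v)⟫_ℝ) ∂dv 𝕍 =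
      - ∫ v, speed u v * ⟪f₀ v, f₀ v⟫_ℝ ∂dv 𝕍 := (integral_prod _ hI).symm.trans hE
  have h0 : 0 ≤ᵐ[volume.restrict (Ioi (0 : ℝ))] fun x =>
      - ∫ v, (⟪w (x, v), f (x, v)⟫_ℝ + ⟪f (x, v), w (x, v)⟫_ℝ) ∂dv 𝕍 := by
    filter_upwards [hx] with x ⟨a1, a2, a3, a4⟩
    rw [a4, neg_neg, Pi.zero_apply]
    exact mul_nonneg zero_le_two (hK _)
  have h1 : ∫ x in Ioi (0 : ℝ),
      - ∫ v, (⟪w (x, v), f (x, v)⟫_ℝ + ⟪f (x, v), w (x, v)⟫_ℝ) ∂dv 𝕍 = 0 := by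
    refine le_antisymm ?_ (integral_nonneg_of_ae h0)
    rw [integral_neg, e1, neg_neg]
    exact hin
  rw [integral_eq_zero_iff_of_nonneg_ae h0 hIx.neg] at h1
  -- Zero dissipation means `K F(x) = 0` for almost every `x`, so the transport derivative vanishes.
  have hw0 : w =ᵐ[dxdv 𝕍] fun _ => 0 := by
    have hm : AEStronglyMeasurable w (dxdv 𝕍) :=
      h.target.aestronglyMeasurable_of_pos (measurable_weight_snd ω₀).inv
        (ae_of_all _ fun z => inv_pos.2 (weight_pos ω₀ z.2))
    refine ae_eq_prod_of_ae_ae_right hm aestronglyMeasurable_const ?_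
    filter_upwards [hx, h1] with x ⟨a1, a2, a3, a4⟩ a5
    rw [a4, neg_neg, Pi.zero_apply] at a5
    have a6 := hK0 _ ((mul_eq_zero.1 a5).resolve_left two_ne_zero)
    rw [a6, neg_zero, Lp.eq_zero_iff_ae_eq_zero] at a3
    filter_upwards [a3, a2.coeFn_toL2] with v b1 b2
    rw [b2] at b1
    exact (smul_eq_zero.1 b1).resolve_left
      (Real.sqrt_pos.2 (inv_pos.2 (weight_pos ω₀ v))).ne'
  have hwv := ae_ae_of_ae_prod_swap hw0
  have hmain : ∀ᵐ v ∂dv 𝕍, f₀ v = 0 ∧ ∀ᵐ x ∂volume.restrict (Ioi (0 : ℝ)), f (x, v) = 0 := by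
    filter_upwards [hwv, h.transport, slice_source hω0 h.source, speed_ne_zero_ae 𝕍 u] with
      v b1 b2 b3 b4
    -- On almost every line the solution is constant in `x`; being square integrable on a half-line
    -- of infinite length, it is zero.
    have b5 : ∀ᵐ x ∂volume.restrict (Ioi (0 : ℝ)), f (x, v) = f₀ v := by
      filter_upwards [b2, ae_restrict_mem measurableSet_Ioi] with x hx hx0
      have : ∫ t in (0 : ℝ)..x, w (t, v) = 0 := by
        rw [intervalIntegral.integral_of_le (le_of_lt hx0)]
        refine integral_eq_zero_of_ae (ae_mono (Measure.restrict_mono Ioc_subset_Ioi_self le_rfl) b1)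
      rw [this, add_zero] at hx
      exact smul_right_injective _ b4 hx
    have b6 : MemLp (fun _ : ℝ => f₀ v) 2 (volume.restrict (Ioi (0 : ℝ))) :=
      (memLp_congr_ae b5).1 b3
    have b7 : f₀ v = 0 := by
      rw [memLp_const_iff (by norm_num) (by norm_num)] at b6
      refine b6.resolve_right ?_
      simp
    exact ⟨b7, b7 ▸ b5⟩
  refine ⟨?_, hmain.mono fun v hv => hv.1⟩
  have hm : AEStronglyMeasurable f (dxdv 𝕍) :=
    h.source.aestronglyMeasurable_of_pos (measurable_weight_snd ω₀)
      (ae_of_all _ fun z => weight_pos ω₀ z.2)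
  exact ae_eq_prod_of_ae_ae hm aestronglyMeasurable_const (hmain.mono fun v hv => hv.2)

/-- Transport differentiates in `x` only, so a sharp cut-off in `v` is harmless. -/
lemma isTransport_indicator_tensor (A : Set (Vel d)) {ζ : ℝ → ℝ} (hζ : ContDiff ℝ ∞ ζ)
    (χ : Vel d → ℝ) (e : Val m) :
    IsTransport 𝕍 u (fun z => A.indicator (fun v => (ζ z.1 * χ v) • e) z.2)
      (fun z => A.indicator (fun v => (deriv ζ z.1 * (speed u v * χ v)) • e) z.2)
      (fun v => ζ 0 • A.indicator (fun v => χ v • e) v) := by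
  refine ae_of_all _ fun v => ?_
  by_cases hv : v ∈ A
  · have hθ : ContDiff ℝ ∞ fun z : ℝ × Vel d => (ζ z.1 * χ v) • e :=
      ((hζ.comp contDiff_fst).mul contDiff_const).smul contDiff_const
    have h := isPrimitive_slice hθ (speed u v) v
    have e1 : ∀ x, deriv (fun t => (ζ t * χ v) • e) x = (deriv ζ x * χ v) • e := fun x =>
      (((hζ.differentiable (by norm_num) x).hasDerivAt.mul_const _).smul_const e).deriv
    simp only [e1] at h
    simp only [hv, indicator_of_mem]
    convert h using 2
    · rw [smul_smul]; congr 1; ring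
    · rw [smul_smul]
  · simp only [hv, not_false_eq_true, indicator_of_notMem, smul_zero]
    exact ae_of_all _ fun x => by simp

/-- Solvability with prescribed incoming data. -/
lemma exists_solves (hω0 : 0 ≤ ω₀) {c : ℝ} (hc : 0 < c)
    (hK : ∀ F, c * ‖F‖ ^ 2 ≤ ⟪K F, F⟫_ℝ) (hsymm : ∀ F G, ⟪K F, G⟫_ℝ = ⟪F, K G⟫_ℝ)
    {φ : Vel d → Val m} (hφ : IncomingData 𝕍 ω₀ u φ) :
    ∃ f w f₀, Solves ω₀ u K f w f₀ ∧ ∀ᵐ v ∂dv 𝕍, 0 < speed u v → f₀ v = φ v := by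
  obtain ⟨f, w, hf, hw, heq, htest⟩ := exists_weak_solution hc hK hsymm hφ
  obtain ⟨f₀, hm, hT⟩ := exists_isTransport (u := u) hω0 hf hw fun ζ hζ hζs hsupp => by
    refine ae_test_eq_zero hω0 hf hw hζ hζs fun χ hχ hχs e => ?_
    have hζ0 : ζ 0 = 0 := by
      by_contra h
      exact absurd (hsupp (subset_tsupport _ h)) (lt_irrefl (0 : ℝ))
    have := htest univ MeasurableSet.univ ζ χ e hζ hζs hχ hχs (Or.inl hζ0)
    rw [hζ0, zero_mul, neg_zero] at this
    rw [← this]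
    refine integral_congr_ae (ae_of_all _ fun z => ?_)
    simp only [indicator_univ, inner_smul_left, inner_smul_right, inner_add_left,
      RCLike.conj_to_real]
    ring
  have htr := hT.memWL2_trace hω0 hf hw hm
  refine ⟨f, w, f₀, ⟨hf, hw, hT, htr, heq⟩, ?_⟩
  set A : Set (Vel d) := {v | 0 < speed u v} with hA
  have hAm : MeasurableSet A := measurableSet_incoming u
  obtain ⟨ζ, hζ, hζs, hζ0⟩ := exists_test_one
  have h₀ : MemWL2 (fun v => |speed u v|) (A.indicator f₀) (dv 𝕍) := by
    refine (memLp_congr_ae (ae_of_all _ fun v => ?_)).1 (htr.memLp_smul.indicator hAm)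
    by_cases hv : v ∈ A <;> simp [hv]
  have h₁ : MemWL2 (fun v => |speed u v|) (A.indicator φ) (dv 𝕍) := by
    refine (memLp_congr_ae (ae_of_all _ fun v => ?_)).1
      ((memLp_indicator_iff_restrict hAm).2 hφ.2.memLp_smul)
    by_cases hv : v ∈ A
    · have hv' : 0 < speed u v := hv
      simp [hv, abs_of_pos hv']
    · simp [hv]
  -- The weak formulation and Green's formula have the same volume term for the cut-off test
  -- function, so their boundary terms agree: the trace equals `φ` on incoming velocities.
  have hae := trace_ae_eq_of_test h₀ h₁ fun χ hχ hχs e => by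
    have e1 := htest A hAm ζ χ e hζ hζs hχ hχs (Or.inr subset_rfl)
    have e2 := hT.energy hω0 hf hw
      (memWL2_indicator_tensor (continuous_weight ω₀) hAm hζ.continuous hχ.continuous hζs hχs e)
      (memWL2_indicator_tensor (continuous_weight_inv ω₀) hAm (hζ.continuous_deriv (by norm_num))
        ((continuous_speed u).mul hχ.continuous) hζs.deriv hχs.mul_left e)
      (isTransport_indicator_tensor A hζ χ e)
    have e3 := neg_injective (e2.symm.trans e1)
    rw [hζ0, one_mul, ← integral_indicator hAm] at e3
    simp only [one_smul] at e3
    refine Eq.trans ?_ (e3.trans ?_)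
    · refine integral_congr_ae (ae_of_all _ fun v => ?_)
      by_cases hv : v ∈ A <;> simp [hv]
    · refine integral_congr_ae (ae_of_all _ fun v => ?_)
      by_cases hv : v ∈ A <;> simp [hv]
  filter_upwards [hae] with v hv hpos
  have : v ∈ A := hpos
  simpa [this] using hv

end Solve

/-! ### A dissipative system of moment equations -/

section ODE

/-- The quadratic form `⟨B U, U⟩`, which may be indefinite, tends to zero at infinity, starts at a
value `≤ 0` and has derivative at most `-2α |U|²`. Integrating over the half-line leaves no room for
`U ≠ 0`. -/
lemma ae_eq_zero_of_dissipative {ι : Type*} [Fintype ι] {B : ι → ι → ℝ} (hB : ∀ z z', B z z' = B z' z)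
    {U W : ι → ℝ → ℝ} {c : ι → ℝ} {α : ℝ} (hα : 0 < α)
    (hU : ∀ z, MemLp (U z) 2 (volume.restrict (Ioi (0 : ℝ))))
    (hW : ∀ z, MemLp (W z) 2 (volume.restrict (Ioi (0 : ℝ))))
    (h : ∀ z, IsPrimitive (U z) (W z) (c z))
    (hd : ∀ᵐ x ∂volume.restrict (Ioi (0 : ℝ)),
      ∑ z, (∑ z', B z z' * U z' x) * W z x ≤ - (α * ∑ z, U z x ^ 2))
    (h0 : ∑ z, (∑ z', B z z' * c z') * c z ≤ 0) :
    ∀ᵐ x ∂volume.restrict (Ioi (0 : ℝ)), ∀ z, U z x = 0 := by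
  have hint : ∀ z z', Integrable (fun x => W z x * U z' x + U z x * W z' x)
      (volume.restrict (Ioi (0 : ℝ))) := fun z z' =>
    ((hW z).integrable_mul (hU z')).add ((hU z).integrable_mul (hW z'))
  set E : ℝ → ℝ := fun x => ∑ z, ∑ z', B z z' * (W z x * U z' x + U z x * W z' x)
  have hE : Integrable E (volume.restrict (Ioi (0 : ℝ))) :=
    integrable_finsetSum _ fun z _ => integrable_finsetSum _ fun z' _ => (hint z z').const_mul _
  have hEint : 0 ≤ ∫ x in Ioi (0 : ℝ), E x := by
    change 0 ≤ ∫ x in Ioi (0 : ℝ), ∑ z, ∑ z', B z z' * (W z x * U z' x + U z x * W z' x)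
    rw [integral_finsetSum _ fun z _ => integrable_finsetSum _ fun z' _ => (hint z z').const_mul _]
    have e : ∀ z, ∫ x in Ioi (0 : ℝ), ∑ z', B z z' * (W z x * U z' x + U z x * W z' x) =
        - ((∑ z', B z z' * c z') * c z) := fun z => by
      rw [integral_finsetSum _ fun z' _ => (hint z z').const_mul _, Finset.sum_mul,
        ← Finset.sum_neg_distrib]
      refine Finset.sum_congr rfl fun z' _ => ?_
      rw [integral_const_mul, (h z).integral_mul (hU z) (hW z) (hU z') (hW z') (h z')]
      ring
    simp only [e, Finset.sum_neg_distrib]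
    linarith
  have hE2 : ∀ x, E x = 2 * ∑ z, (∑ z', B z z' * U z' x) * W z x := fun x => by
    have e1 : ∑ z, ∑ z', B z z' * (U z x * W z' x) = ∑ z, ∑ z', B z z' * (W z x * U z' x) := by
      rw [Finset.sum_comm]
      refine Finset.sum_congr rfl fun z _ => Finset.sum_congr rfl fun z' _ => ?_
      rw [hB]; ring
    simp only [E, mul_add, Finset.sum_add_distrib]
    rw [e1, ← two_mul]
    congr 1
    refine Finset.sum_congr rfl fun z _ => ?_
    rw [Finset.sum_mul]
    exact Finset.sum_congr rfl fun z' _ => by ring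
  have hS : Integrable (fun x => ∑ z, U z x ^ 2) (volume.restrict (Ioi (0 : ℝ))) :=
    integrable_finsetSum _ fun z _ => (hU z).integrable_sq
  have hle : ∫ x in Ioi (0 : ℝ), E x ≤ ∫ x in Ioi (0 : ℝ), -(2 * α) * ∑ z, U z x ^ 2 := by
    refine integral_mono_ae hE (hS.const_mul _) ?_
    filter_upwards [hd] with x hx
    rw [hE2]
    linarith
  rw [integral_const_mul] at hle
  have hSnn : 0 ≤ᵐ[volume.restrict (Ioi (0 : ℝ))] fun x => ∑ z, U z x ^ 2 :=
    ae_of_all _ fun x => Finset.sum_nonneg fun z _ => sq_nonneg _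
  have hz : ∫ x in Ioi (0 : ℝ), ∑ z, U z x ^ 2 = 0 := by
    refine le_antisymm ?_ (integral_nonneg_of_ae hSnn)
    by_contra! hcon
    have : 0 < 2 * α * ∫ x in Ioi (0 : ℝ), ∑ z, U z x ^ 2 := by positivity
    linarith
  rw [integral_eq_zero_iff_of_nonneg_ae hSnn hS] at hz
  filter_upwards [hz] with x hx z
  have := (Finset.sum_eq_zero_iff_of_nonneg fun z _ => sq_nonneg (U z x)).1 hx z (Finset.mem_univ z)
  exact pow_eq_zero_iff (two_ne_zero) |>.1 this

end ODE

/-! ### Damped solutions and their moments -/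

section Damped

variable {d m : ℕ} [NeZero d] {𝕍 : Set (Vel d)} {ω₀ u : ℝ} {L : L2v 𝕍 m →ₗ.[ℝ] L2v 𝕍 m}
  {hL : CollisionOperator ω₀ u L} {νp νm ν0 : ℕ}

lemma integral_flux_nonpos {f₀ : Vel d → Val m} (h : ∀ᵐ v ∂dv 𝕍, 0 < speed u v → f₀ v = 0) :
    ∫ v, speed u v * ⟪f₀ v, f₀ v⟫_ℝ ∂dv 𝕍 ≤ 0 := by
  refine integral_nonpos_of_ae ?_
  filter_upwards [h] with v hv
  rcases le_or_gt (speed u v) 0 with h1 | h1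
  · exact mul_nonpos_of_nonpos_of_nonneg h1 real_inner_self_nonneg
  · simp [hv h1]

lemma memWL2_slice_target {w : ℝ × Vel d → Val m}
    (hw : MemWL2 (fun z => (weight ω₀ z.2)⁻¹) w (dxdv 𝕍)) :
    ∀ᵐ x ∂volume.restrict (Ioi (0 : ℝ)),
      MemWL2 (fun v => (weight ω₀ v)⁻¹) (fun v => w (x, v)) (dv 𝕍) :=
  memLp_slice_right hw.memLp_smul

lemma memWL2_speed_null_trace (hω0 : 0 ≤ ω₀) (hL : CollisionOperator ω₀ u L) {p : L2v 𝕍 m}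
    (hp : p ∈ nullSpace L) : MemWL2 (fun v => |speed u v|) p (dv 𝕍) :=
  memWL2_speed_of_dual (hL.memWL2 hω0 (nullSpace_le_domain hp))
    (EigenSystem.memWL2_speed_null hω0 hL hp)

lemma incomingData_null (hω0 : 0 ≤ ω₀) (hL : CollisionOperator ω₀ u L) {p : L2v 𝕍 m}
    (hp : p ∈ nullSpace L) : IncomingData 𝕍 ω₀ u p := by
  refine ⟨(hL.memWL2 hω0 (nullSpace_le_domain hp)).memLp_smul.restrict _, ?_⟩
  refine (memLp_congr_ae ?_).1 ((memWL2_speed_null_trace hω0 hL hp).memLp_smul.restrict _)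
  filter_upwards [ae_restrict_mem (measurableSet_incoming u)] with v hv
  rw [abs_of_pos hv]

namespace EigenSystem

variable {S : EigenSystem hL νp νm ν0} {α : ℝ} {f w : ℝ × Vel d → Val m} {f₀ : Vel d → Val m}

lemma X_mem (S : EigenSystem hL νp νm ν0) (s) : S.X s ∈ nullSpace L := by
  rcases s with i | k
  · exact (S.plus i).2
  · exact (S.zero k).2

lemma isDampedSolution_iff (hω0 : 0 ≤ ω₀) (hY : S.FiniteFlux) {φ : Vel d → Val m} :
    IsDampedSolution S α φ f f₀ ↔ ∃ w, Solves ω₀ u (dampedOp hω0 hY α) f w f₀ ∧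
      ∀ᵐ v ∂dv 𝕍, 0 < speed u v → f₀ v = φ v := by
  constructor
  · rintro ⟨hf, w, hw, hT, he, hb⟩
    refine ⟨w, ⟨hf, hw, hT.isTransport hω0 hf hw, hT.1, ?_⟩, hb⟩
    filter_upwards [he, memWL2_slice_target hw] with x h1 h2
    exact ⟨h1.1, h2, (opEq_damped_iff hω0 hY α h1.1 h2).1 h1⟩
  · rintro ⟨w, h, hb⟩
    refine ⟨h.source, w, h.target, h.transport.hasTransport hω0 h.source h.target
      h.trace.aestronglyMeasurable_trace, ?_, hb⟩
    filter_upwards [h.eq] with x ⟨h1, h2, h3⟩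
    exact (opEq_damped_iff hω0 hY α h1 h2).2 h3

lemma exists_isDampedSolution (hω0 : 0 ≤ ω₀) (hY : S.FiniteFlux) (hα : 0 < α)
    {φ : Vel d → Val m} (hφ : IncomingData 𝕍 ω₀ u φ) : ∃ f f₀, IsDampedSolution S α φ f f₀ := by
  obtain ⟨c, hc, hK⟩ := dampedOp_coercive hω0 hY hα
  obtain ⟨f, w, f₀, h1, h2⟩ := exists_solves hω0 hc hK (dampedOp_symm hω0 hY α) hφ
  exact ⟨f, f₀, (isDampedSolution_iff hω0 hY).2 ⟨w, h1, h2⟩⟩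

lemma isDampedSolution_unique (hω0 : 0 ≤ ω₀) (hY : S.FiniteFlux) (hα : 0 < α)
    {φ : Vel d → Val m} {f' : ℝ × Vel d → Val m} {f₀' : Vel d → Val m}
    (h : IsDampedSolution S α φ f f₀) (h' : IsDampedSolution S α φ f' f₀') :
    f' =ᵐ[dxdv 𝕍] f ∧ f₀' =ᵐ[dv 𝕍] f₀ := by
  obtain ⟨w, h1, h2⟩ := (isDampedSolution_iff hω0 hY).1 h
  obtain ⟨w', h1', h2'⟩ := (isDampedSolution_iff hω0 hY).1 h'
  obtain ⟨c, hc, hK⟩ := dampedOp_coercive hω0 hY hα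
  obtain ⟨e1, e2⟩ := (h1'.sub h1).eq_zero hω0 (fun F => (by positivity : 0 ≤ c * ‖F‖ ^ 2).trans (hK F))
    (fun F hF => by
      have h3 := hK F
      rw [hF] at h3
      have h4 : ‖F‖ ^ 2 ≤ 0 := by
        by_contra! hcon
        have : 0 < c * ‖F‖ ^ 2 := mul_pos hc hcon
        linarith
      have h5 : F = 0 := by
        rw [← norm_eq_zero]
        exact pow_eq_zero_iff two_ne_zero |>.1 (le_antisymm h4 (sq_nonneg _))
      rw [h5, map_zero])
    (integral_flux_nonpos (by
      filter_upwards [h2, h2'] with v a b hv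
      rw [a hv, b hv, sub_self]))
  exact ⟨e1.mono fun z hz => sub_eq_zero.1 hz, e2.mono fun v hv => sub_eq_zero.1 hv⟩

lemma coflux_inner_mode (hω0 : 0 ≤ ω₀) (hY : S.FiniteFlux) (z z') :
    ⟪coflux hω0 hY z', (S.memWL2_mode hω0 z).toL2⟫_ℝ = S.gram z' z :=
  (flux_mode hω0 hY z' (S.memWL2_mode hω0 z)).symm

lemma scaledOp_mode (hω0 : 0 ≤ ω₀) (z) : scaledOp hω0 hL (S.memWL2_mode hω0 z).toL2 =
    scaleDown hω0 (L ⟨S.mode z, S.mode_mem hω0 z⟩) :=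
  scaledOp_scaleUp hω0 hL ⟨S.mode z, S.mode_mem hω0 z⟩

/-- Since `L Yₖ = (v₁ + u) X₀ₖ`, this identifies the image of `√a Yₖ` under `K` with the coflux of
`X₀ₖ`; for this reason the moment equations close. -/
lemma scaleDown_mulSpeed (hω0 : 0 ≤ ω₀) (hY : S.FiniteFlux) (k) :
    scaleDown hω0 (mulSpeed hL (S.zero k)) = coflux hω0 hY (Sum.inl (Sum.inr (Sum.inr k))) := by
  refine Lp.ext ?_
  filter_upwards [scaleDown_coe hω0 (mulSpeed hL (S.zero k)), mulSpeed_coe hL (S.zero k),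
    (memWL2_speed_mode hω0 hY (Sum.inl (Sum.inr (Sum.inr k)))).coeFn_toL2] with v h1 h2 h3
  rw [h1, h2]
  exact h3.symm

/-- The part of the moment equations that comes from `L`. -/
def drift (U : (Fin νp ⊕ (Fin νm ⊕ Fin ν0)) ⊕ Fin ν0 → ℝ) :
    (Fin νp ⊕ (Fin νm ⊕ Fin ν0)) ⊕ Fin ν0 → ℝ :=
  Sum.elim (fun _ => 0) fun k => U (Sum.inl (Sum.inr (Sum.inr k)))

/-- By symmetry `K` is moved onto the mode: it gives zero for an eigenfunction and the `X₀ₖ` moment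
for `Yₖ`. The damping contributes `α G U`. -/
lemma integral_mode_target (hω0 : 0 ≤ ω₀) (hY : S.FiniteFlux) {f w : Vel d → Val m}
    (hf : MemWL2 (weight ω₀) f (dv 𝕍)) (hw : MemWL2 (fun v => (weight ω₀ v)⁻¹) w (dv 𝕍))
    (h : hw.toL2 = - dampedOp hω0 hY α hf.toL2) (z) :
    ∫ v, ⟪S.mode z v, w v⟫_ℝ ∂dv 𝕍 =
      - (α * ∑ z', S.gram z z' * flux 𝕍 u (S.mode z') f) -
        drift (fun z' => flux 𝕍 u (S.mode z') f) z := by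
  have e1 : ⟪scaledOp hω0 hL hf.toL2, (S.memWL2_mode hω0 z).toL2⟫_ℝ =
      drift (fun z' => flux 𝕍 u (S.mode z') f) z := by
    rw [scaledOp_symm, scaledOp_mode]
    rcases z with a | k
    · rw [S.apply_basis hω0, map_zero, inner_zero_right]; rfl
    · rw [S.apply_Y hω0, scaleDown_mulSpeed hω0 hY, real_inner_comm, ← flux_mode]; rfl
  rw [← (S.memWL2_mode hω0 z).inner_toL2 (weight_pos ω₀) hw, h, inner_neg_right, real_inner_comm,
    dampedOp_inner, e1, neg_add, sub_eq_add_neg, add_comm]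
  congr 3
  refine Finset.sum_congr rfl fun z' _ => ?_
  rw [coflux_inner_mode, ← flux_mode, S.gram_comm, mul_comm]

/-- The modes are not present in a damped solution with vanishing moments against the
`X₊ᵢ` and `X₀ₖ` at `x = 0`. -/
lemma moments_eq_zero (hω0 : 0 ≤ ω₀) (hY : S.FiniteFlux) (hα : 0 < α)
    (h : Solves ω₀ u (dampedOp hω0 hY α) f w f₀) (h0 : ∀ s, flux 𝕍 u (S.X s) f₀ = 0) :
    ∀ᵐ x ∂volume.restrict (Ioi (0 : ℝ)), ∀ z, flux 𝕍 u (S.mode z) (fun v => f (x, v)) = 0 := by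
  have hmom := fun z => IsTransport.moment h.source h.target h.transport h.trace
    (S.memWL2_mode hω0 z) (memWL2_speed_mode hω0 hY z)
  set G : Matrix ((Fin νp ⊕ (Fin νm ⊕ Fin ν0)) ⊕ Fin ν0) ((Fin νp ⊕ (Fin νm ⊕ Fin ν0)) ⊕ Fin ν0) ℝ :=
    Matrix.of S.gram with hG
  have hGs : G.IsSymm := Matrix.IsSymm.ext fun i j => S.gram_comm j i
  have hGinj : Function.Injective G.mulVec := by
    refine (injective_iff_map_eq_zero (Matrix.mulVecLin G)).2 fun c hc => ?_
    exact S.gram_injective hω0 fun z => congrFun hc z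
  have hGu : IsUnit G := Matrix.mulVec_injective_iff_isUnit.1 hGinj
  have hdet : IsUnit G.det := (Matrix.isUnit_iff_isUnit_det G).1 hGu
  have hcancel : ∀ U z, ∑ z', S.gram z z' * (G⁻¹.mulVec U) z' = U z := fun U z => by
    have : G.mulVec (G⁻¹.mulVec U) = U := by
      rw [Matrix.mulVec_mulVec, Matrix.mul_nonsing_inv G hdet, Matrix.one_mulVec]
    exact congrFun this z
  have hBs : (G⁻¹).IsSymm := by
    rw [Matrix.IsSymm, Matrix.transpose_nonsing_inv, hGs.eq]
  -- The form is given by `G⁻¹`, so that the damping term `-α G U` yields exactly `-α |U|²`.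
  refine ae_eq_zero_of_dissipative (B := fun z z' => G⁻¹ z z')
    (fun z z' => hBs.apply z' z) hα (fun z => (hmom z).1) (fun z => (hmom z).2.1)
    (fun z => (hmom z).2.2) ?_ ?_
  · filter_upwards [h.eq] with x ⟨a1, a2, a3⟩
    set U : (Fin νp ⊕ (Fin νm ⊕ Fin ν0)) ⊕ Fin ν0 → ℝ :=
      fun z => flux 𝕍 u (S.mode z) (fun v => f (x, v)) with hU
    set c := G⁻¹.mulVec U with hc
    have e2 : ∀ z, ∫ v, ⟪S.mode z v, w (x, v)⟫_ℝ ∂dv 𝕍 =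
        - (α * ∑ z', S.gram z z' * U z') - drift U z := fun z =>
      integral_mode_target hω0 hY a1 a2 a3 z
    suffices ∑ z, c z * ∫ v, ⟪S.mode z v, w (x, v)⟫_ℝ ∂dv 𝕍 ≤ - (α * ∑ z, U z ^ 2) from this
    simp only [e2]
    have e3 : ∑ z, c z * ∑ z', S.gram z z' * U z' = ∑ z, U z ^ 2 := by
      have : ∀ z, U z ^ 2 = (∑ z', S.gram z z' * c z') * U z := fun z => by rw [hcancel, sq]
      simp only [this, Finset.sum_mul, Finset.mul_sum]
      rw [Finset.sum_comm]
      refine Finset.sum_congr rfl fun z _ => Finset.sum_congr rfl fun z' _ => ?_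
      rw [S.gram_comm]; ring
    -- The `X₀` rows of `G c = U` express `U₀` through the `Y` coefficients of `c`, and the sum
    -- becomes the quadratic form of `L` at `∑ c_{Yₖ} Yₖ`.
    have e4 : 0 ≤ ∑ z, c z * drift U z := by
      rw [Fintype.sum_sum_type]
      simp only [drift, Sum.elim_inl, Sum.elim_inr, mul_zero, Finset.sum_const_zero, zero_add]
      have : ∀ k, U (Sum.inl (Sum.inr (Sum.inr k))) =
          ∑ l, S.gram (Sum.inl (Sum.inr (Sum.inr k))) (Sum.inr l) * c (Sum.inr l) := fun k => by
        rw [← hcancel U, sum_gram_zero, eigenvalue_zero, zero_mul, zero_add]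
      simp only [this]
      exact S.sum_gram_zero_Y_nonneg hω0 fun k => c (Sum.inr k)
    have e5 : ∑ z, c z * (- (α * ∑ z', S.gram z z' * U z') - drift U z) =
        - (α * ∑ z, c z * ∑ z', S.gram z z' * U z') - ∑ z, c z * drift U z := by
      rw [Finset.mul_sum, ← Finset.sum_neg_distrib, ← Finset.sum_sub_distrib]
      exact Finset.sum_congr rfl fun z _ => by ring
    rw [e5, e3]
    linarith
  · set U : (Fin νp ⊕ (Fin νm ⊕ Fin ν0)) ⊕ Fin ν0 → ℝ := fun z => flux 𝕍 u (S.mode z) f₀ with hU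
    set c := G⁻¹.mulVec U with hc
    have h1 : ∀ i, U (Sum.inl (Sum.inl i)) = 0 := fun i => h0 (Sum.inl i)
    have h2 : ∀ k, U (Sum.inl (Sum.inr (Sum.inr k))) = 0 := fun k => h0 (Sum.inr k)
    obtain ⟨h3, -⟩ := S.coeff_eq_zero hω0 (c := c) (fun i => by rw [hcancel, h1])
      (fun k => by rw [hcancel, h2])
    -- With `U₊`, `U₀` and the `Y` coefficients of `c` zero at `x = 0`, only the `X₋` terms `λ₋ c₋²`
    -- remain in the form.
    have h4 : ∀ j, U (Sum.inl (Sum.inr (Sum.inl j))) =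
        S.eigenvalue (Sum.inr (Sum.inl j)) * c (Sum.inl (Sum.inr (Sum.inl j))) := fun j => by
      rw [← hcancel U, sum_gram_zero]
      simp only [← hc, h3, mul_zero, Finset.sum_const_zero, add_zero]
    suffices ∑ z, c z * U z ≤ 0 from this
    rw [Fintype.sum_sum_type, Fintype.sum_sum_type, Fintype.sum_sum_type]
    simp only [h1, h2, h3, h4, mul_zero, zero_mul, Finset.sum_const_zero, zero_add, add_zero]
    refine Finset.sum_nonpos fun j _ => ?_
    have := S.eigenvalue_minus j
    have h5 := mul_self_nonneg (c (Sum.inl (Sum.inr (Sum.inl j))))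
    nlinarith

/-- A damped solution without modes is a solution of the undamped equation. -/
lemma solves_undamped (hω0 : 0 ≤ ω₀) (hY : S.FiniteFlux) (hα : 0 < α)
    (h : Solves ω₀ u (dampedOp hω0 hY α) f w f₀) (h0 : ∀ s, flux 𝕍 u (S.X s) f₀ = 0) :
    Solves ω₀ u (scaledOp hω0 hL) f w f₀ := by
  refine ⟨h.source, h.target, h.transport, h.trace, ?_⟩
  filter_upwards [h.eq, moments_eq_zero hω0 hY hα h h0] with x ⟨a1, a2, a3⟩ b
  refine ⟨a1, a2, ?_⟩
  rw [a3, dampedOp_apply]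
  simp only [← flux_mode hω0 hY _ a1, b, zero_smul, Finset.sum_const_zero, smul_zero, add_zero]

end EigenSystem

end Damped

/-! ### Adding functions that are constant in `x` -/

section Constant

variable {d m : ℕ} [NeZero d] {𝕍 : Set (Vel d)} {ω₀ u : ℝ}

lemma hasCompactSupport_slice {θ : ℝ × Vel d → Val m} (h : HasCompactSupport θ) (v : Vel d) :
    HasCompactSupport fun t => θ (t, v) := by
  refine HasCompactSupport.intro (h.isCompact.image continuous_fst) fun t ht => ?_
  by_contra hne
  exact ht ⟨(t, v), subset_tsupport θ hne, rfl⟩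

lemma continuous_speed_deriv_slice (u : ℝ) {θ : ℝ × Vel d → Val m} (h1 : ContDiff ℝ ∞ θ) :
    Continuous (fun z : ℝ × Vel d => speed u z.2 • deriv (fun t => θ (t, z.2)) z.1) :=
  ((continuous_speed u).comp continuous_snd).smul (continuous_deriv_slice h1)

lemma hasCompactSupport_speed_deriv_slice (u : ℝ) {θ : ℝ × Vel d → Val m}
    (h2 : HasCompactSupport θ) :
    HasCompactSupport (fun z : ℝ × Vel d => speed u z.2 • deriv (fun t => θ (t, z.2)) z.1) :=
  HasCompactSupport.smul_left (f := fun z : ℝ × Vel d => speed u z.2)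
    (f' := fun z : ℝ × Vel d => deriv (fun t => θ (t, z.2)) z.1)
    (hasCompactSupport_deriv_slice h2)

/-- A function constant in `x` is in general not in `L²(dx dv)`, but the compact support of `ψ`
restricts `x` to a bounded interval. -/
lemma integrable_inner_const {q : Vel d → Val m} (hq : MemLp q 2 (dv 𝕍))
    {ψ : ℝ × Vel d → Val m} (h1 : Continuous ψ) (h2 : HasCompactSupport ψ) :
    Integrable (fun z => ⟪q z.2, ψ z⟫_ℝ) (dxdv 𝕍) := by
  obtain ⟨R, hR⟩ := (h2.isCompact.image continuous_fst).bddAbove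
  have hfin : IsFiniteMeasure ((volume.restrict (Ioi (0 : ℝ))).restrict (Iic R)) := by
    rw [Measure.restrict_restrict measurableSet_Iic, inter_comm, Ioi_inter_Iic]
    infer_instance
  have hq2 : MemLp (fun z : ℝ × Vel d => q z.2) 2 ((dxdv 𝕍).restrict (Iic R ×ˢ univ)) := by
    rw [dxdv, ← Measure.prod_restrict, Measure.restrict_univ]
    exact hq.comp_snd _
  have hq3 : MemLp ((Iic R ×ˢ univ).indicator fun z : ℝ × Vel d => q z.2) 2 (dxdv 𝕍) :=
    (memLp_indicator_iff_restrict (measurableSet_Iic.prod MeasurableSet.univ)).2 hq2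
  refine (integrable_inner hq3 (memLp_dxdv_of_continuous h1 h2)).congr (ae_of_all _ fun z => ?_)
  by_cases hz : z ∈ Iic R ×ˢ (univ : Set (Vel d))
  · simp only [hz, indicator_of_mem]
  · have : ψ z = 0 := by
      by_contra hne
      exact hz ⟨hR ⟨z, subset_tsupport ψ hne, rfl⟩, trivial⟩
    simp [this]

lemma integrable_speed_inner_const {q : Vel d → Val m} (hq : MemLp q 2 (dv 𝕍))
    {θ : ℝ × Vel d → Val m} (h1 : ContDiff ℝ ∞ θ) (h2 : HasCompactSupport θ) :
    Integrable (fun z => speed u z.2 * ⟪q z.2, deriv (fun t => θ (t, z.2)) z.1⟫_ℝ) (dxdv 𝕍) := by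
  simpa only [inner_smul_right] using integrable_inner_const hq
    (continuous_speed_deriv_slice u h1) (hasCompactSupport_speed_deriv_slice u h2)

/-- Green's formula for functions that are constant in `x`. -/
lemma integral_speed_inner_const {q : Vel d → Val m} (hq : MemLp q 2 (dv 𝕍))
    {θ : ℝ × Vel d → Val m} (h1 : ContDiff ℝ ∞ θ) (h2 : HasCompactSupport θ) :
    ∫ z, speed u z.2 * ⟪q z.2, deriv (fun t => θ (t, z.2)) z.1⟫_ℝ ∂dxdv 𝕍 =
      - ∫ v, speed u v * ⟪q v, θ (0, v)⟫_ℝ ∂dv 𝕍 := by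
  rw [dxdv, integral_prod_symm _ (integrable_speed_inner_const hq h1 h2), ← integral_neg]
  refine integral_congr_ae (ae_of_all _ fun v => ?_)
  have hs : ContDiff ℝ ∞ fun t => θ (t, v) := h1.comp (contDiff_id.prodMk contDiff_const)
  have hc := hasCompactSupport_slice h2 v
  have hI : Integrable (fun x => deriv (fun t => θ (t, v)) x) (volume.restrict (Ioi (0 : ℝ))) :=
    ((hs.continuous_deriv (by norm_num)).integrable_of_hasCompactSupport hc.deriv).restrict
  refine (integral_const_mul (speed u v)
    fun x => ⟪q v, deriv (fun t => θ (t, v)) x⟫_ℝ).trans ?_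
  rw [integral_inner hI,
    HasCompactSupport.integral_Ioi_deriv_eq (hs.of_le (by exact_mod_cast le_top)) hc,
    inner_neg_right, mul_neg]

lemma memWL2_trace_test (u : ℝ) {θ : ℝ × Vel d → Val m} (h1 : ContDiff ℝ ∞ θ)
    (h2 : HasCompactSupport θ) :
    MemWL2 (fun v => |speed u v|) (fun v => θ (0, v)) (dv 𝕍) := by
  have hc : Continuous fun v : Vel d => Real.sqrt |speed u v| • θ (0, v) :=
    (continuous_speed u).abs.sqrt.smul (h1.continuous.comp (continuous_const.prodMk continuous_id))
  refine hc.memLp_of_hasCompactSupport ?_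
  refine HasCompactSupport.intro (h2.isCompact.image continuous_snd) fun v hv => ?_
  by_contra hne
  exact hv ⟨(0, v), subset_tsupport θ (right_ne_zero_of_smul hne), rfl⟩

/-- The hypothesis `hI` is needed to split the volume integral into the given Green formula and the
one for `q`. -/
lemma HasTransport.add_const {f w : ℝ × Vel d → Val m} {f₀ q : Vel d → Val m}
    (h : HasTransport 𝕍 u f w f₀) (hq : MemLp q 2 (dv 𝕍))
    (hqs : MemWL2 (fun v => |speed u v|) q (dv 𝕍))
    (hI : ∀ θ : ℝ × Vel d → Val m, ContDiff ℝ ∞ θ → HasCompactSupport θ →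
      Integrable (fun z => speed u z.2 * ⟪f z, deriv (fun t => θ (t, z.2)) z.1⟫_ℝ + ⟪w z, θ z⟫_ℝ)
        (dxdv 𝕍)) :
    HasTransport 𝕍 u (fun z => f z + q z.2) w (fun v => f₀ v + q v) := by
  refine ⟨h.1.add hqs, fun θ h1 h2 => ?_⟩
  have e1 : ∀ z : ℝ × Vel d, speed u z.2 * ⟪f z + q z.2, deriv (fun t => θ (t, z.2)) z.1⟫_ℝ +
      ⟪w z, θ z⟫_ℝ = (speed u z.2 * ⟪f z, deriv (fun t => θ (t, z.2)) z.1⟫_ℝ + ⟪w z, θ z⟫_ℝ) +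
      speed u z.2 * ⟪q z.2, deriv (fun t => θ (t, z.2)) z.1⟫_ℝ := fun z => by
    rw [inner_add_left]; ring
  have e2 : ∀ v, speed u v * ⟪f₀ v + q v, θ (0, v)⟫_ℝ =
      speed u v * ⟪f₀ v, θ (0, v)⟫_ℝ + speed u v * ⟪q v, θ (0, v)⟫_ℝ := fun v => by
    rw [inner_add_left]; ring
  simp only [e1, e2]
  rw [integral_add (hI θ h1 h2) (integrable_speed_inner_const hq h1 h2), h.2 θ h1 h2,
    integral_speed_inner_const hq h1 h2, integral_add
      (h.1.integrable_flux (memWL2_trace_test u h1 h2)) (hqs.integrable_flux (memWL2_trace_test u h1 h2))]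
  ring

lemma integrable_green {f w : ℝ × Vel d → Val m} (hf : MemLp f 2 (dxdv 𝕍))
    (hw : MemWL2 (fun z => (weight ω₀ z.2)⁻¹) w (dxdv 𝕍)) {θ : ℝ × Vel d → Val m}
    (h1 : ContDiff ℝ ∞ θ) (h2 : HasCompactSupport θ) :
    Integrable (fun z => speed u z.2 * ⟪f z, deriv (fun t => θ (t, z.2)) z.1⟫_ℝ + ⟪w z, θ z⟫_ℝ)
      (dxdv 𝕍) := by
  refine Integrable.add ?_ (integrable_energy'
    (memWL2_dxdv_of_continuous (continuous_weight ω₀) h1.continuous h2) hw)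
  simpa only [inner_smul_right] using integrable_inner hf (memLp_dxdv_of_continuous (𝕍 := 𝕍)
    (continuous_speed_deriv_slice u h1) (hasCompactSupport_speed_deriv_slice u h2))

end Constant

/-! ### Half-space solutions and decaying undamped solutions -/

section HalfSpaceProblem

variable {d m : ℕ} [NeZero d] {𝕍 : Set (Vel d)} {ω₀ u : ℝ} {L : L2v 𝕍 m →ₗ.[ℝ] L2v 𝕍 m}
  {hL : CollisionOperator ω₀ u L} {νp νm ν0 : ℕ}

lemma toL2_null (hω0 : 0 ≤ ω₀) (hL : CollisionOperator ω₀ u L) (p : nullSpace L) :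
    (hL.memWL2 hω0 (nullSpace_le_domain p.2)).toL2 = nullUp hω0 hL p :=
  (nullUp_apply hω0 hL p).symm

/-- Elliptic estimate: `√a f` is controlled by `a^{-1/2} L f` and `f`. -/
lemma exists_norm_le (hω0 : 0 ≤ ω₀) (hL : CollisionOperator ω₀ u L) :
    ∃ C ≥ 0, ∀ F : L2v 𝕍 m,
      ‖F‖ ^ 2 ≤ C * (‖scaledOp hω0 hL F‖ ^ 2 + ‖scaleDown hω0 F‖ ^ 2) := by
  obtain ⟨σ, hσ, hgap⟩ := scaledOp_gap hω0 hL
  obtain ⟨B, hB⟩ : ∃ B, B = ‖(nullUp hω0 hL) ∘L nullProj hL‖ := ⟨_, rfl⟩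
  refine ⟨2 * (1 / σ ^ 2 + B ^ 2), by positivity, fun F => ?_⟩
  obtain ⟨D, hD⟩ : ∃ D, D = ‖F - scaledProj hω0 hL F‖ := ⟨_, rfl⟩
  obtain ⟨w, hw⟩ : ∃ w, w = ‖scaledOp hω0 hL F‖ := ⟨_, rfl⟩
  obtain ⟨k, hk⟩ : ∃ k, k = ‖scaleDown hω0 F‖ := ⟨_, rfl⟩
  have hD0 : 0 ≤ D := hD ▸ norm_nonneg _
  have hw0 : 0 ≤ w := hw ▸ norm_nonneg _
  have h1 : σ * D ^ 2 ≤ w * D := by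
    rw [hD, hw]
    refine (hgap F).trans ?_
    -- By symmetry `K F` is orthogonal to the image of `scaledProj`, so only the distance `D`
    -- enters, and `σ D² ≤ ‖K F‖ D` bounds `D` by `‖K F‖ / σ`.
    have e : ⟪scaledOp hω0 hL F, F⟫_ℝ = ⟪scaledOp hω0 hL F, F - scaledProj hω0 hL F⟫_ℝ := by
      rw [inner_sub_right, scaledOp_symm hω0 hL F (scaledProj hω0 hL F), scaledOp_scaledProj,
        inner_zero_right, sub_zero]
    rw [e]
    exact real_inner_le_norm _ _
  have h2 : D ≤ w / σ := by
    rw [le_div_iff₀ hσ]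
    by_contra! hcon
    have : 0 < D := by
      by_contra! h
      have : D = 0 := le_antisymm h hD0
      rw [this, zero_mul] at hcon
      linarith
    nlinarith
  have h3 : ‖scaledProj hω0 hL F‖ ≤ B * k := by
    rw [scaledProj_apply, hB, hk]
    exact ((nullUp hω0 hL) ∘L nullProj hL).le_opNorm _
  have h4 : ‖F‖ ≤ w / σ + B * k := by
    have : ‖F‖ ≤ D + ‖scaledProj hω0 hL F‖ := by
      simpa [hD] using norm_add_le (F - scaledProj hω0 hL F) (scaledProj hω0 hL F)
    linarith
  rw [← hw, ← hk]
  calc ‖F‖ ^ 2 ≤ (w / σ + B * k) ^ 2 := pow_le_pow_left₀ (norm_nonneg _) h4 2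
    _ ≤ 2 * ((w / σ) ^ 2 + (B * k) ^ 2) := by nlinarith [sq_nonneg (w / σ - B * k)]
    _ ≤ 2 * ((w / σ) ^ 2 + (B * k) ^ 2 + (k / σ) ^ 2 + (B * w) ^ 2) := by
      nlinarith [sq_nonneg (k / σ), sq_nonneg (B * w)]
    _ = _ := by ring

/-- A half-space solution is only required to approach its end-state in `L²(dx; L²(dv))`. The
elliptic estimate on each slice, integrated in `x`, upgrades this to the weight `a`, as the energy
method requires. -/
lemma memWL2_source_of_eq (hω0 : 0 ≤ ω₀) (hL : CollisionOperator ω₀ u L)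
    {k w : ℝ × Vel d → Val m} (hk : MemLp k 2 (dxdv 𝕍))
    (hw : MemWL2 (fun z => (weight ω₀ z.2)⁻¹) w (dxdv 𝕍))
    (he : ∀ᵐ x ∂volume.restrict (Ioi (0 : ℝ)),
      ∃ (hf : MemWL2 (weight ω₀) (fun v => k (x, v)) (dv 𝕍))
        (hw : MemWL2 (fun v => (weight ω₀ v)⁻¹) (fun v => w (x, v)) (dv 𝕍)),
        hw.toL2 = - scaledOp hω0 hL hf.toL2) :
    MemWL2 (fun z => weight ω₀ z.2) k (dxdv 𝕍) := by
  obtain ⟨C, hC, hbd⟩ := exists_norm_le hω0 hL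
  have hwm := hw.aestronglyMeasurable_of_pos (measurable_weight_snd ω₀).inv
    (ae_of_all _ fun z => inv_pos.2 (weight_pos ω₀ z.2))
  have hI : Integrable (fun z => (weight ω₀ z.2)⁻¹ * ‖w z‖ ^ 2 + ‖k z‖ ^ 2) (dxdv 𝕍) :=
    ((memWL2_iff_integrable hwm (measurable_weight_snd ω₀).inv
      fun z => inv_nonneg.2 (weight_pos ω₀ z.2).le).1 hw).add
      ((memLp_two_iff_integrable_sq_norm hk.1).1 hk)
  have hm : AEStronglyMeasurable (fun z : ℝ × Vel d => weight ω₀ z.2 * ‖k z‖ ^ 2) (dxdv 𝕍) :=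
    (measurable_weight_snd ω₀).aestronglyMeasurable.mul (hk.1.norm.pow 2)
  rw [memWL2_iff_integrable hk.1 (measurable_weight_snd ω₀) fun z => (weight_pos ω₀ z.2).le,
    dxdv, integrable_prod_iff hm]
  constructor
  · filter_upwards [he, hk.1.prodMk_left] with x ⟨a1, a2, a3⟩ a4
    exact (memWL2_iff_integrable a4 (measurable_weight ω₀) fun v => (weight_pos ω₀ v).le).1 a1
  · refine (hI.integral_prod_left.const_mul C).mono' hm.norm.integral_prod_right' ?_
    filter_upwards [he, hI.prod_right_ae, hk.1.prodMk_left, memLp_slice_right hk] with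
      x ⟨a1, a2, a3⟩ a4 a5 a6
    have e1 : ∫ v, ‖weight ω₀ v * ‖k (x, v)‖ ^ 2‖ ∂dv 𝕍 = ‖a1.toL2‖ ^ 2 := by
      rw [a1.norm_toL2_sq fun v => (weight_pos ω₀ v).le]
      refine integral_congr_ae (ae_of_all _ fun v => ?_)
      exact Real.norm_of_nonneg (mul_nonneg (weight_pos ω₀ v).le (sq_nonneg _))
    have e2 : ‖scaleDown hω0 a1.toL2‖ ^ 2 = ∫ v, ‖k (x, v)‖ ^ 2 ∂dv 𝕍 := by
      rw [← real_inner_self_eq_norm_sq, inner_eq_integral]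
      refine integral_congr_ae ?_
      filter_upwards [scaleDown_coe hω0 a1.toL2, a1.coeFn_toL2] with v b1 b2
      rw [b1, b2, smul_smul, mul_comm, sqrt_weight_mul_inv, one_smul, real_inner_self_eq_norm_sq]
    have e3 : ‖scaledOp hω0 hL a1.toL2‖ ^ 2 = ∫ v, (weight ω₀ v)⁻¹ * ‖w (x, v)‖ ^ 2 ∂dv 𝕍 := by
      rw [← a2.norm_toL2_sq fun v => inv_nonneg.2 (weight_pos ω₀ v).le, a3, norm_neg]
    have hI1 : Integrable (fun v => ‖k (x, v)‖ ^ 2) (dv 𝕍) :=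
      (memLp_two_iff_integrable_sq_norm a6.1).1 a6
    have hI2 : Integrable (fun v => (weight ω₀ v)⁻¹ * ‖w (x, v)‖ ^ 2) (dv 𝕍) := by
      refine (a4.sub hI1).congr (ae_of_all _ fun v => ?_)
      simp
    rw [Real.norm_of_nonneg (integral_nonneg fun v => norm_nonneg _), e1, integral_add hI2 hI1,
      ← e2, ← e3]
    exact hbd _

/-- The deviation of a half-space solution from its end-state. -/
lemma IsHalfSpaceSolution.solves (hω0 : 0 ≤ ω₀) (hL : CollisionOperator ω₀ u L)
    {φ : Vel d → Val m} {h : ℝ × Vel d → Val m} {q : L2v 𝕍 m}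
    (hh : IsHalfSpaceSolution ω₀ u L φ h q) (hq : q ∈ nullSpace L) :
    ∃ (w : ℝ × Vel d → Val m) (h₀ : Vel d → Val m),
      Solves ω₀ u (scaledOp hω0 hL) (fun z => h z - q z.2) w (fun v => h₀ v - q v) ∧
      ∀ᵐ v ∂dv 𝕍, 0 < speed u v → h₀ v = φ v := by
  obtain ⟨hk, w, h₀, hw, hT, he, hb⟩ := hh
  have hqa := hL.memWL2 hω0 (nullSpace_le_domain hq)
  have hqs := memWL2_speed_null_trace hω0 hL hq
  have he' : ∀ᵐ x ∂volume.restrict (Ioi (0 : ℝ)),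
      ∃ (hf : MemWL2 (weight ω₀) (fun v => h (x, v) - q v) (dv 𝕍))
        (hw : MemWL2 (fun v => (weight ω₀ v)⁻¹) (fun v => w (x, v)) (dv 𝕍)),
        hw.toL2 = - scaledOp hω0 hL hf.toL2 := by
    filter_upwards [he, memWL2_slice_target hw] with x h1 h2
    refine ⟨h1.1.sub hqa, h2, ?_⟩
    have e1 := (opEq_iff hω0 hL h1.1 h2.neg).1 h1
    rw [MemWL2.toL2_neg h2] at e1
    have e2 : (h1.1.sub hqa).toL2 = h1.1.toL2 - hqa.toL2 := by
      rw [sub_eq_add_neg, ← MemWL2.toL2_neg hqa, ← MemWL2.toL2_add h1.1 hqa.neg]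
      exact MemWL2.toL2_congr _ _ (ae_of_all _ fun v => sub_eq_add_neg _ _)
    have e3 : scaledOp hω0 hL hqa.toL2 = 0 := by
      rw [toL2_null hω0 hL ⟨q, hq⟩, scaledOp_nullUp]
    rw [e2, map_sub, e3, sub_zero, ← e1, neg_neg]
  have hka := memWL2_source_of_eq hω0 hL hk hw he'
  have hT' : HasTransport 𝕍 u (fun z => h z - q z.2) w (fun v => h₀ v - q v) := by
    -- The function `h` need not be square integrable; its Green integrand is split as that of `h -
    -- q` plus that of the constant `q`.
    have := hT.add_const (q := fun v => - q v) (Lp.memLp q).neg hqs.neg fun θ h1 h2 => by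
      refine ((integrable_green (u := u) hk hw h1 h2).add (integrable_speed_inner_const (u := u)
        (Lp.memLp q) h1 h2)).congr (ae_of_all _ fun z => ?_)
      simp only [Pi.add_apply, inner_sub_left]
      ring
    simpa only [← sub_eq_add_neg] using this
  exact ⟨w, h₀, ⟨hka, hw, hT'.isTransport hω0 hka hw, hT'.1, he'⟩, hb⟩

/-- A decaying solution of the undamped equation plus a constant in the null space. -/
lemma Solves.isHalfSpaceSolution (hω0 : 0 ≤ ω₀) (hL : CollisionOperator ω₀ u L)
    {φ f₀ : Vel d → Val m} {f w : ℝ × Vel d → Val m} {q : L2v 𝕍 m}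
    (h : Solves ω₀ u (scaledOp hω0 hL) f w f₀) (hq : q ∈ nullSpace L)
    (hb : ∀ᵐ v ∂dv 𝕍, 0 < speed u v → f₀ v + q v = φ v) :
    IsHalfSpaceSolution ω₀ u L φ (fun z => f z + q z.2) q := by
  have hqa := hL.memWL2 hω0 (nullSpace_le_domain hq)
  have hf := h.source.memLp (measurable_weight_snd ω₀) fun z => one_le_weight hω0 z.2
  refine ⟨by simpa only [add_sub_cancel_right] using hf, w, fun v => f₀ v + q v, h.target, ?_, ?_,
    hb⟩
  · exact (h.transport.hasTransport hω0 h.source h.target h.trace.aestronglyMeasurable_trace).add_const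
      (Lp.memLp q) (memWL2_speed_null_trace hω0 hL hq) fun θ h1 h2 =>
        integrable_green hf h.target h1 h2
  · filter_upwards [h.eq] with x ⟨a1, a2, a3⟩
    refine (opEq_iff hω0 hL (a1.add hqa) a2.neg).2 ?_
    have e3 : scaledOp hω0 hL hqa.toL2 = 0 := by
      rw [toL2_null hω0 hL ⟨q, hq⟩, scaledOp_nullUp]
    rw [MemWL2.toL2_neg a2, a3, neg_neg, MemWL2.toL2_add a1 hqa, map_add, e3, add_zero]

/-- Moments of decaying undamped solutions against the null space vanish. -/
lemma Solves.flux_null_eq_zero (hω0 : 0 ≤ ω₀) (hL : CollisionOperator ω₀ u L)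
    {f₀ : Vel d → Val m} {f w : ℝ × Vel d → Val m}
    (h : Solves ω₀ u (scaledOp hω0 hL) f w f₀) (p : nullSpace L) :
    flux 𝕍 u (p : L2v 𝕍 m) f₀ = 0 := by
  have hpa := hL.memWL2 hω0 (nullSpace_le_domain p.2)
  obtain ⟨h1, -, h3⟩ := h.transport.moment h.source h.target h.trace hpa
    (EigenSystem.memWL2_speed_null hω0 hL p.2)
  have hz : ∀ᵐ x ∂volume.restrict (Ioi (0 : ℝ)),
      ∫ v, ⟪(p : L2v 𝕍 m) v, w (x, v)⟫_ℝ ∂dv 𝕍 = 0 := by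
    filter_upwards [h.eq] with x ⟨a1, a2, a3⟩
    rw [← hpa.inner_toL2 (weight_pos ω₀) a2, a3, toL2_null hω0 hL p, inner_neg_right,
      ← scaledOp_symm, scaledOp_nullUp, inner_zero_left, neg_zero]
  -- The flux has zero derivative because `K` annihilates `√a p`; a constant that is square
  -- integrable on the half-line vanishes.
  have hc : ∀ᵐ x ∂volume.restrict (Ioi (0 : ℝ)),
      flux 𝕍 u (p : L2v 𝕍 m) (fun v => f (x, v)) = flux 𝕍 u (p : L2v 𝕍 m) f₀ := by
    filter_upwards [h3, ae_restrict_mem measurableSet_Ioi] with x hx hx0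
    have : ∫ t in (0 : ℝ)..x, ∫ v, ⟪(p : L2v 𝕍 m) v, w (t, v)⟫_ℝ ∂dv 𝕍 = 0 := by
      rw [intervalIntegral.integral_of_le (le_of_lt hx0)]
      exact integral_eq_zero_of_ae (ae_mono (Measure.restrict_mono Ioc_subset_Ioi_self le_rfl) hz)
    rw [hx, this, add_zero]
  have h4 := (memLp_congr_ae hc).1 h1
  rw [memLp_const_iff (by norm_num) (by norm_num)] at h4
  refine h4.resolve_right ?_
  simp

end HalfSpaceProblem

/-! ### End-states, invertibility of `C` and recovery -/

section EndState

variable {d m : ℕ} [NeZero d] {𝕍 : Set (Vel d)} {ω₀ u : ℝ} {L : L2v 𝕍 m →ₗ.[ℝ] L2v 𝕍 m}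
  {hL : CollisionOperator ω₀ u L} {νp νm ν0 : ℕ}

lemma endSpace_le_nullSpace (hL : CollisionOperator ω₀ u L) :
    Hplus hL ⊔ Hzero hL ≤ nullSpace L :=
  sup_le (Submodule.map_subtype_le _ _) (Submodule.map_subtype_le _ _)

lemma P1_symm (hL : CollisionOperator ω₀ u L) (p q : nullSpace L) :
    ⟪(P1 hL p : L2v 𝕍 m), (q : L2v 𝕍 m)⟫_ℝ = ⟪(P1 hL q : L2v 𝕍 m), (p : L2v 𝕍 m)⟫_ℝ := by
  rw [← flux_null_null, ← flux_null_null, flux_comm]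

lemma inner_eigenvectors_eq_zero (hL : CollisionOperator ω₀ u L) {p q : nullSpace L} {a b : ℝ}
    (hp : P1 hL p = a • p) (hq : P1 hL q = b • q) (hab : a ≠ b) :
    ⟪(p : L2v 𝕍 m), (q : L2v 𝕍 m)⟫_ℝ = 0 := by
  have h := P1_symm hL p q
  rw [hp, hq, Submodule.coe_smul, Submodule.coe_smul, inner_smul_left, inner_smul_left,
    real_inner_comm (p : L2v 𝕍 m)] at h
  simp only [RCLike.conj_to_real] at h
  have h2 : (a - b) * ⟪(p : L2v 𝕍 m), (q : L2v 𝕍 m)⟫_ℝ = 0 := by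
    rw [sub_mul, sub_eq_zero, h, real_inner_comm]
  exact (mul_eq_zero.1 h2).resolve_left (sub_ne_zero.2 hab)

namespace EigenSystem

variable (S : EigenSystem hL νp νm ν0)

/-- Eigenvectors of the symmetric operator `P₁` for a negative and a nonnegative eigenvalue are
orthogonal. -/
lemma inner_minus_eq_zero {q : L2v 𝕍 m} (hq : q ∈ Hplus hL ⊔ Hzero hL) (j : Fin νm) :
    ⟪(S.minus j : L2v 𝕍 m), q⟫_ℝ = 0 := by
  obtain ⟨b, hb, hbj⟩ := S.minus_eigen j
  have hle : ∀ a : ℝ, 0 ≤ a → Module.End.eigenspace (P1 hL) a ≤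
      (LinearMap.ker (innerSL ℝ (S.minus j : L2v 𝕍 m)).toLinearMap).comap
        (nullSpace L).subtype := fun a ha p hp =>
    inner_eigenvectors_eq_zero hL hbj (Module.End.mem_eigenspace_iff.1 hp) (by linarith : b < a).ne
  have : Hplus hL ⊔ Hzero hL ≤ LinearMap.ker (innerSL ℝ (S.minus j : L2v 𝕍 m)).toLinearMap :=
    sup_le (Submodule.map_le_iff_le_comap.2 (iSup₂_le fun a ha => hle a (le_of_lt ha)))
      (Submodule.map_le_iff_le_comap.2 (hle 0 le_rfl))
  exact this hq

/-- In the eigenbasis the flux is `∑ λ c²`, and the coefficients for negative `λ` vanish. -/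
lemma flux_self_nonneg (S : EigenSystem hL νp νm ν0) {q : L2v 𝕍 m} (hq : q ∈ Hplus hL ⊔ Hzero hL) : 0 ≤ flux 𝕍 u q q := by
  obtain ⟨p, rfl⟩ : ∃ p : nullSpace L, (p : L2v 𝕍 m) = q :=
    ⟨⟨q, endSpace_le_nullSpace hL hq⟩, rfl⟩
  have hp : p ∈ Submodule.span ℝ (range S.basis) := by
    rw [show S.basis = Sum.elim S.plus (Sum.elim S.minus S.zero) from rfl, S.complete]
    trivial
  obtain ⟨c, hc⟩ := (Submodule.mem_span_range_iff_exists_fun ℝ).1 hp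
  have hca : ∀ a, ⟪(S.basis a : L2v 𝕍 m), (p : L2v 𝕍 m)⟫_ℝ = c a := fun a => by
    rw [← hc, Submodule.coe_sum, inner_sum]
    simp only [Submodule.coe_smul, inner_smul_right, inner_basis]
    simp
  have hP : (P1 hL p : L2v 𝕍 m) = ∑ a, (c a * S.eigenvalue a) • (S.basis a : L2v 𝕍 m) := by
    conv_lhs => rw [← hc]
    simp only [map_sum, map_smul, P1_basis, Submodule.coe_sum, Submodule.coe_smul, smul_smul]
  rw [flux_null_null hL, hP, sum_inner]
  refine Finset.sum_nonneg fun a _ => ?_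
  rw [inner_smul_left, hca, RCLike.conj_to_real]
  have h2 : 0 ≤ c a ^ 2 * S.eigenvalue a := by
    rcases a with i | j | k
    · exact mul_nonneg (sq_nonneg _) (S.eigenvalue_plus i).le
    · have : c (Sum.inr (Sum.inl j)) = 0 := by
        rw [← hca]
        exact S.inner_minus_eq_zero hq j
      rw [this]
      simp
    · simp [eigenvalue_zero]
  linarith [h2]

lemma X_mem_endSpace (s) : S.X s ∈ Hplus hL ⊔ Hzero hL := by
  rcases s with i | k
  · obtain ⟨a, ha, h⟩ := S.plus_eigen i
    refine Submodule.mem_sup_left (Submodule.mem_map.2 ⟨S.plus i, ?_, rfl⟩)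
    exact Submodule.mem_iSup_of_mem a (Submodule.mem_iSup_of_mem ha
      (Module.End.mem_eigenspace_iff.2 h))
  · refine Submodule.mem_sup_right (Submodule.mem_map.2 ⟨S.zero k, ?_, rfl⟩)
    rw [Module.End.mem_eigenspace_iff, zero_smul]
    exact S.zero_eigen k

lemma endState_mem (η) : S.endState η ∈ Hplus hL ⊔ Hzero hL :=
  Submodule.sum_mem _ fun s _ => Submodule.smul_mem _ _ (S.X_mem_endSpace s)

lemma coeFn_endState (η : Fin νp ⊕ Fin ν0 → ℝ) :
    S.endState η =ᵐ[dv 𝕍] fun v => ∑ s, η s • S.X s v := by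
  unfold endState
  refine (Lp.coeFn_finsetSum _ _).trans ?_
  have h : ∀ᵐ v ∂dv 𝕍, ∀ s, (η s • S.X s : L2v 𝕍 m) v = η s • S.X s v :=
    ae_all_iff.2 fun s => Lp.coeFn_smul _ _
  filter_upwards [h] with v hv
  simp only [Finset.sum_apply, hv]

lemma eq_zero_of_endState_eq_zero {η : Fin νp ⊕ Fin ν0 → ℝ} (h : S.endState η = 0) : η = 0 := by
  have hX : ∀ s, S.X s = S.basis (Sum.elim Sum.inl (fun k => Sum.inr (Sum.inr k)) s) := by
    rintro (i | k) <;> rfl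
  have hi : ∀ s t, ⟪S.X s, S.X t⟫_ℝ = if s = t then 1 else 0 := by
    intro s t
    rw [hX, hX, inner_basis]
    rcases s with i | k <;> rcases t with j | l <;> simp
  funext s
  have h2 : ⟪S.X s, S.endState η⟫_ℝ = η s := by
    simp only [endState, inner_sum, inner_smul_right, hi]
    simp
  rw [← h2, h, inner_zero_right]
  rfl

end EigenSystem

/-- A decaying undamped solution whose trace matches an end-state for incoming velocities. -/
lemma Solves.eq_zero_of_incoming (hω0 : 0 ≤ ω₀) (S : EigenSystem hL νp νm ν0)
    {f w : ℝ × Vel d → Val m} {r : Vel d → Val m} {q : L2v 𝕍 m}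
    (h : Solves ω₀ u (scaledOp hω0 hL) f w (fun v => r v - q v))
    (hr : ∀ᵐ v ∂dv 𝕍, 0 < speed u v → r v = 0) (hq : q ∈ Hplus hL ⊔ Hzero hL) :
    f =ᵐ[dxdv 𝕍] (fun _ => 0) ∧ q = 0 := by
  have hqn := endSpace_le_nullSpace hL hq
  have hqs := memWL2_speed_null_trace hω0 hL hqn
  have hrs : MemWL2 (fun v => |speed u v|) r (dv 𝕍) := by
    simpa only [sub_add_cancel] using h.trace.add hqs
  have h1 : flux 𝕍 u q r = flux 𝕍 u q q := by
    have := h.flux_null_eq_zero hω0 hL ⟨q, hqn⟩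
    simp only [flux, inner_sub_right, mul_sub] at this
    rw [integral_sub (hqs.integrable_flux hrs) (hqs.integrable_flux hqs)] at this
    exact sub_eq_zero.1 this
  have h2 := integral_flux_nonpos hr
  have h3 := S.flux_self_nonneg hq
  -- In the expanded square the cross term is `-2 flux(q, r) = -2 flux(q, q)`, because the flux of
  -- the trace `r - q` against the null vector `q` vanishes.
  have h4 : ∫ v, speed u v * ⟪r v - q v, r v - q v⟫_ℝ ∂dv 𝕍 =
      (∫ v, speed u v * ⟪r v, r v⟫_ℝ ∂dv 𝕍) - flux 𝕍 u q q := by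
    have e : ∀ v, speed u v * ⟪r v - q v, r v - q v⟫_ℝ =
        (speed u v * ⟪r v, r v⟫_ℝ - 2 * (speed u v * ⟪q v, r v⟫_ℝ)) + speed u v * ⟪q v, q v⟫_ℝ :=
      fun v => by
        simp only [inner_sub_left, inner_sub_right, real_inner_comm (q v) (r v)]
        ring
    simp only [e]
    have e2 := integral_sub (hrs.integrable_flux hrs) ((hqs.integrable_flux hrs).const_mul 2)
    rw [integral_const_mul] at e2
    refine (integral_add ((hrs.integrable_flux hrs).sub ((hqs.integrable_flux hrs).const_mul 2))
      (hqs.integrable_flux hqs)).trans ((congrArg (· + flux 𝕍 u q q) e2).trans ?_)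
    change _ - 2 * flux 𝕍 u q r + flux 𝕍 u q q = _
    rw [h1]
    ring
  obtain ⟨h5, h6⟩ := h.eq_zero hω0 (scaledOp_nonneg hω0 hL)
    (fun F hF => by
      rw [eq_scaledProj_of_inner_eq_zero hω0 hL hF.le, scaledOp_scaledProj]) (by linarith)
  refine ⟨h5, ?_⟩
  -- The trace vanishes, so `r = q` almost everywhere. Then a quantity `≤ 0` equals a quantity `≥
  -- 0`; both are zero, and so is the integrand, which has a sign.
  have h7 : (∫ v, speed u v * ⟪r v, r v⟫_ℝ ∂dv 𝕍) = flux 𝕍 u q q := by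
    refine integral_congr_ae (h6.mono fun v hv => ?_)
    simp only [sub_eq_zero.1 hv]
  have h8 : ∫ v, - (speed u v * ⟪r v, r v⟫_ℝ) ∂dv 𝕍 = 0 := by
    rw [integral_neg]; linarith
  have h9 : 0 ≤ᵐ[dv 𝕍] fun v => - (speed u v * ⟪r v, r v⟫_ℝ) := by
    filter_upwards [hr] with v hv
    rcases le_or_gt (speed u v) 0 with a | a
    · exact neg_nonneg.2 (mul_nonpos_of_nonpos_of_nonneg a real_inner_self_nonneg)
    · simp [hv a]
  rw [integral_eq_zero_iff_of_nonneg_ae h9 (hrs.integrable_flux hrs).neg] at h8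
  rw [Lp.eq_zero_iff_ae_eq_zero]
  filter_upwards [h6, h8, speed_ne_zero_ae 𝕍 u] with v a1 a2 a3
  have a4 : ⟪r v, r v⟫_ℝ = 0 := (mul_eq_zero.1 (neg_eq_zero.1 a2)).resolve_left a3
  rw [inner_self_eq_zero] at a4
  rw [a4, zero_sub, neg_eq_zero] at a1
  exact a1

/-- Uniqueness of half-space solutions, together with their end-states. -/
lemma isHalfSpaceSolution_unique (hω0 : 0 ≤ ω₀) (S : EigenSystem hL νp νm ν0)
    {φ : Vel d → Val m} {h h' : ℝ × Vel d → Val m} {q q' : L2v 𝕍 m}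
    (hh : IsHalfSpaceSolution ω₀ u L φ h q) (hh' : IsHalfSpaceSolution ω₀ u L φ h' q')
    (hq : q ∈ Hplus hL ⊔ Hzero hL) (hq' : q' ∈ Hplus hL ⊔ Hzero hL) :
    h =ᵐ[dxdv 𝕍] h' ∧ q = q' := by
  obtain ⟨w, h₀, h1, h2⟩ := hh.solves hω0 hL (endSpace_le_nullSpace hL hq)
  obtain ⟨w', h₀', h1', h2'⟩ := hh'.solves hω0 hL (endSpace_le_nullSpace hL hq')
  have h3 := h1.sub h1'
  have h4 : Solves ω₀ u (scaledOp hω0 hL) (fun z => h z - q z.2 - (h' z - q' z.2))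
      (fun z => w z - w' z) (fun v => (h₀ v - h₀' v) - (q - q' : L2v 𝕍 m) v) := by
    have e : (fun v => h₀ v - q v - (h₀' v - q' v)) =ᵐ[dv 𝕍]
        fun v => (h₀ v - h₀' v) - (q - q' : L2v 𝕍 m) v := by
      filter_upwards [Lp.coeFn_sub q q'] with v hv
      rw [hv, Pi.sub_apply]; abel
    exact ⟨h3.source, h3.target, h3.transport.congr_trace e, h3.trace.congr e, h3.eq⟩
  obtain ⟨h5, h6⟩ := h4.eq_zero_of_incoming hω0 S
    (by filter_upwards [h2, h2'] with v a b hv; rw [a hv, b hv, sub_self])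
    (Submodule.sub_mem _ hq hq')
  have h7 := sub_eq_zero.1 h6
  refine ⟨?_, h7⟩
  filter_upwards [h5] with z hz
  rw [h7] at hz
  simpa [sub_eq_zero] using hz

lemma flux_sum_smul {ι : Type*} [Fintype ι] {X : Vel d → Val m}
    (hX : MemWL2 (fun v => |speed u v|) X (dv 𝕍)) {g : ι → Vel d → Val m}
    (hg : ∀ s, MemWL2 (fun v => |speed u v|) (g s) (dv 𝕍)) (η : ι → ℝ) :
    flux 𝕍 u X (fun v => ∑ s, η s • g s v) = ∑ s, flux 𝕍 u X (g s) * η s := by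
  simp only [flux, inner_sum, inner_smul_right, Finset.mul_sum]
  rw [integral_finsetSum _ fun s _ => ?_]
  · refine Finset.sum_congr rfl fun s _ => ?_
    rw [← integral_mul_const]
    exact integral_congr_ae (ae_of_all _ fun v => by ring)
  · refine ((hX.integrable_flux (hg s)).const_mul (η s)).congr (ae_of_all _ fun v => by ring)

lemma flux_sub {X g g' : Vel d → Val m} (hX : MemWL2 (fun v => |speed u v|) X (dv 𝕍))
    (hg : MemWL2 (fun v => |speed u v|) g (dv 𝕍)) (hg' : MemWL2 (fun v => |speed u v|) g' (dv 𝕍)) :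
    flux 𝕍 u X (fun v => g v - g' v) = flux 𝕍 u X g - flux 𝕍 u X g' := by
  simp only [flux, inner_sub_right, mul_sub]
  exact integral_sub (hX.integrable_flux hg) (hX.integrable_flux hg')

namespace EigenSystem

variable {S : EigenSystem hL νp νm ν0} {α : ℝ} {g : Fin νp ⊕ Fin ν0 → ℝ × Vel d → Val m}
  {g₀ : Fin νp ⊕ Fin ν0 → Vel d → Val m}

/-- For `η` in the kernel of `C`, the combination `∑ ηₛ gₛ` has vanishing moments at `x = 0` and is
thus an undamped decaying solution with incoming data `∑ ηₛ Xₛ`; such a solution forces `∑ ηₛ Xₛ =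
0`. -/
lemma isUnit_det_C (hω0 : 0 ≤ ω₀) (hY : S.FiniteFlux) (hα : 0 < α)
    (hg : ∀ s, IsDampedSolution S α (S.X s) (g s) (g₀ s)) : IsUnit (S.C g₀).det := by
  choose w hw hb using fun s => (isDampedSolution_iff hω0 hY).1 (hg s)
  have hinj : Function.Injective (S.C g₀).mulVec := by
    refine (injective_iff_map_eq_zero (Matrix.mulVecLin (S.C g₀))).2 fun η hη => ?_
    have h1 := Solves.sum Finset.univ fun s => (hw s).const_smul (η s)
    have h2 := solves_undamped hω0 hY hα h1 fun r => by
      rw [flux_sum_smul (memWL2_speed_null_trace hω0 hL (S.X_mem r)) fun s => (hw s).trace]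
      exact congrFun hη r
    -- The trace is written as `r - q` with `q = -∑ ηₛ Xₛ`, so that `r` vanishes for incoming
    -- velocities.
    have hadd : ∀ v, ∑ s, η s • g₀ s v =
        (∑ s, η s • g₀ s v + S.endState (-η) v) - S.endState (-η) v := fun v => by
      rw [add_sub_cancel_right]
    rw [funext hadd] at h2
    obtain ⟨-, h3⟩ := h2.eq_zero_of_incoming hω0 S (r := fun v => ∑ s, η s • g₀ s v + S.endState (-η) v)
      (by
        filter_upwards [ae_all_iff.2 hb, S.coeFn_endState (-η)] with v a b hv
        rw [b, ← Finset.sum_add_distrib]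
        refine Finset.sum_eq_zero fun s _ => ?_
        rw [a s hv, Pi.neg_apply, neg_smul, add_neg_cancel]) (S.endState_mem _)
    exact neg_eq_zero.1 (S.eq_zero_of_endState_eq_zero h3)
  exact (Matrix.isUnit_iff_isUnit_det _).1 (Matrix.mulVec_injective_iff_isUnit.1 hinj)

/-- The equation `C η = (⟨(v₁ + u) X_r, f₀⟩)_r` says precisely that `f - g` has vanishing `X₊` and
`X₀` moments at `x = 0`, so its damping is inactive. For incoming velocities `g₀` equals `Φ`, hence
adding `Φ` gives back `φ`. -/
lemma isHalfSpaceSolution_recovered (hω0 : 0 ≤ ω₀) (hY : S.FiniteFlux) (hα : 0 < α)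
    {φ : Vel d → Val m} {f : ℝ × Vel d → Val m} {f₀ : Vel d → Val m}
    (hf : IsDampedSolution S α φ f f₀)
    (hg : ∀ s, IsDampedSolution S α (S.X s) (g s) (g₀ s)) :
    IsHalfSpaceSolution ω₀ u L φ (S.recovered (S.eta g₀ f₀) f g) (S.endState (S.eta g₀ f₀)) := by
  have hdet := isUnit_det_C hω0 hY hα hg
  choose w hw hb using fun s => (isDampedSolution_iff hω0 hY).1 (hg s)
  obtain ⟨wf, hwf, hbf⟩ := (isDampedSolution_iff hω0 hY).1 hf
  set η := S.eta g₀ f₀ with hη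
  have h0 := Solves.sum Finset.univ fun s => (hw s).const_smul (η s)
  have h1 := hwf.sub h0
  have hCη : (S.C g₀).mulVec η = fun r => flux 𝕍 u (S.X r) f₀ := by
    rw [hη, EigenSystem.eta, Matrix.mulVec_mulVec, Matrix.mul_nonsing_inv _ hdet, Matrix.one_mulVec]
  have h2 := solves_undamped hω0 hY hα h1 fun r => by
    have hX := memWL2_speed_null_trace hω0 hL (S.X_mem r)
    rw [flux_sub hX hwf.trace h0.trace, flux_sum_smul hX fun s => (hw s).trace, sub_eq_zero]
    exact (congrFun hCη r).symm
  refine h2.isHalfSpaceSolution hω0 hL (endSpace_le_nullSpace hL (S.endState_mem η)) ?_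
  filter_upwards [hbf, ae_all_iff.2 hb, S.coeFn_endState η] with v a b c hv
  rw [a hv, c, sub_add_eq_add_sub, add_sub_assoc, ← Finset.sum_sub_distrib]
  simp only [fun s => b s hv, sub_self, Finset.sum_const_zero, add_zero]

end EigenSystem

end EndState

end HalfSpace

end

theorem proposition3p6 {d m : ℕ} [NeZero d] (𝕍 : Set (HalfSpace.Vel d)) (h𝕍 : MeasurableSet 𝕍)
    (u ω₀ : ℝ) (hω0 : 0 ≤ ω₀) (hω1 : ω₀ ≤ 1)
    (L : HalfSpace.L2v 𝕍 m →ₗ.[ℝ] HalfSpace.L2v 𝕍 m)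
    (hL : HalfSpace.CollisionOperator ω₀ u L)
    (νp νm ν0 : ℕ) (S : HalfSpace.EigenSystem hL νp νm ν0)
    (hY : ∀ k, HalfSpace.MemWL2 (fun v => (HalfSpace.weight ω₀ v)⁻¹)
      (fun v => HalfSpace.speed u v • S.Y k v) (HalfSpace.dv 𝕍))
    (α : ℝ) (hα : 0 < α) :
    -- the damped problem is uniquely solvable, for all incoming data
    (∀ φ : HalfSpace.Vel d → HalfSpace.Val m, HalfSpace.IncomingData 𝕍 ω₀ u φ →
      ∃ f f₀, HalfSpace.IsDampedSolution S α φ f f₀ ∧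
        ∀ f' f₀', HalfSpace.IsDampedSolution S α φ f' f₀' →
          f' =ᵐ[HalfSpace.dxdv 𝕍] f ∧ f₀' =ᵐ[HalfSpace.dv 𝕍] f₀) ∧
    -- the eigenfunctions are incoming data
    (∀ s, HalfSpace.IncomingData 𝕍 ω₀ u (S.X s)) ∧
    -- recovery of the undamped solution
    ∀ (φ : HalfSpace.Vel d → HalfSpace.Val m)
      (f : ℝ × HalfSpace.Vel d → HalfSpace.Val m) (f₀ : HalfSpace.Vel d → HalfSpace.Val m)
      (g : Fin νp ⊕ Fin ν0 → ℝ × HalfSpace.Vel d → HalfSpace.Val m)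
      (g₀ : Fin νp ⊕ Fin ν0 → HalfSpace.Vel d → HalfSpace.Val m),
      HalfSpace.IncomingData 𝕍 ω₀ u φ →
      HalfSpace.IsDampedSolution S α φ f f₀ →
      (∀ s, HalfSpace.IsDampedSolution S α (S.X s) (g s) (g₀ s)) →
      IsUnit (S.C g₀).det ∧
      S.endState (S.eta g₀ f₀) ∈ HalfSpace.Hplus hL ⊔ HalfSpace.Hzero hL ∧
      HalfSpace.IsHalfSpaceSolution ω₀ u L φ (S.recovered (S.eta g₀ f₀) f g)
        (S.endState (S.eta g₀ f₀)) ∧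
      ∀ (h : ℝ × HalfSpace.Vel d → HalfSpace.Val m) (hinf : HalfSpace.L2v 𝕍 m),
        hinf ∈ HalfSpace.Hplus hL ⊔ HalfSpace.Hzero hL →
        HalfSpace.IsHalfSpaceSolution ω₀ u L φ h hinf →
          h =ᵐ[HalfSpace.dxdv 𝕍] S.recovered (S.eta g₀ f₀) f g ∧
            hinf = S.endState (S.eta g₀ f₀) := by
  refine ⟨fun φ hφ => ?_, fun s => HalfSpace.incomingData_null hω0 hL (S.X_mem s),
    fun φ f f₀ g g₀ hφ hf hg => ?_⟩
  · obtain ⟨f, f₀, h⟩ := HalfSpace.EigenSystem.exists_isDampedSolution hω0 hY hα hφ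
    exact ⟨f, f₀, h, fun f' f₀' h' =>
      HalfSpace.EigenSystem.isDampedSolution_unique hω0 hY hα h h'⟩
  · have hrec := HalfSpace.EigenSystem.isHalfSpaceSolution_recovered hω0 hY hα hf hg
    exact ⟨HalfSpace.EigenSystem.isUnit_det_C hω0 hY hα hg, S.endState_mem _, hrec,
      fun h hinf hmem hh =>
        HalfSpace.isHalfSpaceSolution_unique hω0 S hh hrec hmem (S.endState_mem _)⟩
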